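/- Let $\mathbb K$ be an algebraically closed field of characteristic zero. Fix integers $r\ge c>0$, $n_0,\dots,n_r>0$ and $m\ge 0$, and put $n:=n_0+\dots+n_r$. Let $A$ be a $(c+1)\times(r+1)$ matrix over $\mathbb K$ with columns $a_0,\dots,a_r$ such that any $c+1$ of them are linearly independent, and let $l_i=(l_{i1},\dots,l_{in_i})$, $i=0,\dots,r$, be tuples of positive integers. Let $P_0$ be the integral $r\times(n+m)$ matrix $$P_0=\begin{bmatrix}-l_0&l_1&&0&0&\ldots&0\\ \vdots&\vdots&\ddots&\vdots&\vdots&&\vdots\\ -l_0&0&&l_r&0&\ldots&0\end{bmatrix}.$$ In the polynomial ring $\mathbb K[T_{ij},S_k]$ in the variables $T_{ij}$ ($0\le i\le r$, $1\le j\le n_i$) and $S_k$ ($1\le k\le m$), put $T_i^{l_i}:=T_{i1}^{l_{i1}}\cdots T_{in_i}^{l_{in_i}}$ and, for $t=1,\dots,r-c$, $$g_t:=\det\begin{bmatrix}a_0&\ldots&a_c&a_{c+t}\\ T_0^{l_0}&\ldots&T_c^{l_c}&T_{c+t}^{l_{c+t}}\end{bmatrix}.$$ Let $Q_0\colon\mathbb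 Z^{n+m}\to K_0:=\mathbb Z^{n+m}/\mathrm{im}(P_0^*)$ be the projection onto the factor group by the row lattice of $P_0$, and set $$R(A,P_0):=\mathbb K[T_{ij},S_k]/\langle g_1,\dots,g_{r-c}\rangle,\qquad \deg(T_{ij}):=Q_0(e_{ij}),\quad \deg(S_k):=Q_0(e_k),$$ where $e_{ij},e_k$ denote the canonical basis vectors of $\mathbb Z^{n+m}$. Terminology: let $R=\bigoplus_{w\in K}R_w$ be a $\mathbb K$-algebra graded by a finitely generated abelian group $K$. The grading is *effective* if the weights $w$ with $R_w\neq\{0\}$ generate $K$ as a group, and *pointed* if $R_0=\mathbb K$ and $R_w\ne\{0\}\ne R_{-w}$ is only possible for torsion elements $w\in K$. An effective grading is of *complexity* $c$ if $\dim(R)-\mathrm{rk}(K)=c$. A nonzero homogeneous non-unit $f\in R$ is *$K$-prime* if, whenever $f$ divides a product $gh$ of homogeneous elements, it divides $g$ or $h$. The grading is *factorial* if $R$ has no homogeneous zero divisors and every nonzero homogeneous non-unit is a product of $K$-primes. A presentation $\mathbb K[x_1,\dots,x_N]/\langle g_1,\dots,g_s\rangle$ is a *complete intersection* if $g_1,\dots,g_s$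 is a regular sequence in $\mathbb K[x_1,\dots,x_N]$. Theorem. The assignment of degrees defines a $K_0$-grading on $R(A,P_0)$. The ring $R(A,P_0)$ is integral and normal, and its presentation above is a complete intersection; moreover $$\dim(R(A,P_0))=n+m-r+c,\qquad R(A,P_0)^*=\mathbb K^*.$$ The $K_0$-grading of $R(A,P_0)$ is effective, pointed, factorial and of complexity $c$. The variables $T_{ij}$, $S_k$ define pairwise non-associated $K_0$-primes in $R(A,P_0)$, and for $c\ge 2$ they even define primes. -/

import Mathlib

/-! ### Gradings of algebras by abelian groups -/

section Grading

variable {𝕜 R K : Type*} [Field 𝕜] [CommRing R] [Algebra 𝕜 R] [AddCommGroup K]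

/-- The subspaces `𝒜 w`, `w ∈ K`, form a `K`-grading of the `𝕜`-algebra `R`: they are compatible
with the multiplication and `R` is their (internal) direct sum. -/
def IsGrading (𝒜 : K → Submodule 𝕜 R) : Prop :=
  SetLike.GradedMonoid 𝒜 ∧ iSupIndep 𝒜 ∧ ⨆ w, 𝒜 w = ⊤

/-- The weights `w` with `R_w ≠ 0` generate `K` as a group. -/
def IsEffectiveGrading (𝒜 : K → Submodule 𝕜 R) : Prop :=
  AddSubgroup.closure {w : K | 𝒜 w ≠ ⊥} = ⊤

/-- `R_0` consists of the constants, and `R_w ≠ 0 ≠ R_{-w}` is only possible for torsion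
elements `w`. -/
def IsPointedGrading (𝒜 : K → Submodule 𝕜 R) : Prop :=
  𝒜 0 = LinearMap.range (Algebra.linearMap 𝕜 R) ∧
    ∀ w : K, 𝒜 w ≠ ⊥ → 𝒜 (-w) ≠ ⊥ → IsOfFinAddOrder w

/-- An effective grading is of complexity `c` if `dim R - rk K = c`. -/
def IsGradingOfComplexity (𝒜 : K → Submodule 𝕜 R) (c : ℕ) : Prop :=
  IsEffectiveGrading 𝒜 ∧ ringKrullDim R = ((Module.finrank ℤ K + c : ℕ) : WithBot ℕ∞)

/-- `K`-integral: there are no homogeneous zero divisors. -/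
def IsGradedIntegral (𝒜 : K → Submodule 𝕜 R) : Prop :=
  ∀ f g : R, SetLike.IsHomogeneousElem 𝒜 f → SetLike.IsHomogeneousElem 𝒜 g →
    f * g = 0 → f = 0 ∨ g = 0

/-- `K`-prime: a nonzero homogeneous non-unit `f` such that whenever `f` divides a product `g * h`
of homogeneous elements, it divides one of the factors. -/
def IsGradedPrime (𝒜 : K → Submodule 𝕜 R) (f : R) : Prop :=
  SetLike.IsHomogeneousElem 𝒜 f ∧ f ≠ 0 ∧ ¬ IsUnit f ∧
    ∀ g h : R, SetLike.IsHomogeneousElem 𝒜 g → SetLike.IsHomogeneousElem 𝒜 h →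
      f ∣ g * h → f ∣ g ∨ f ∣ h

/-- `K`-factorial: `K`-integral, and every nonzero homogeneous non-unit is a product of
`K`-primes. -/
def IsGradedFactorial (𝒜 : K → Submodule 𝕜 R) : Prop :=
  IsGradedIntegral 𝒜 ∧
    ∀ f : R, SetLike.IsHomogeneousElem 𝒜 f → f ≠ 0 → ¬ IsUnit f →
      ∃ s : Multiset R, (∀ p ∈ s, IsGradedPrime 𝒜 p) ∧ s.prod = f

/-- The presentation `𝕜[x] / ⟨g₁, …, g_s⟩` is a complete intersection: `g₁, …, g_s` is a regular
sequence in the polynomial ring (in particular the quotient is nonzero). -/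
def IsCompleteIntersectionPresentation {σ : Type*} {s : ℕ} (g : Fin s → MvPolynomial σ 𝕜) :
    Prop :=
  RingTheory.Sequence.IsRegular (MvPolynomial σ 𝕜) (List.ofFn g)

end Grading

/-! ### The graded algebra `R(A, P₀)` -/

/-- The input data: integers `r ≥ c > 0`, `n₀, …, n_r > 0`, `m ≥ 0`, a `(c+1) × (r+1)` matrix `A`
any `c + 1` of whose columns are linearly independent, and tuples `l_i` of positive integers
(which determine the matrix `P₀`). -/
structure ArrangementData (𝕜 : Type*) [Field 𝕜] where
  r : ℕ
  c : ℕ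
  c_pos : 0 < c
  c_le_r : c ≤ r
  /-- the numbers `n₀, …, n_r` -/
  size : Fin (r + 1) → ℕ
  size_pos : ∀ i, 0 < size i
  m : ℕ
  A : Matrix (Fin (c + 1)) (Fin (r + 1)) 𝕜
  linearIndependent_columns : ∀ e : Fin (c + 1) ↪ Fin (r + 1),
    LinearIndependent 𝕜 (fun q : Fin (c + 1) => fun p : Fin (c + 1) => A p (e q))
  l : (i : Fin (r + 1)) → Fin (size i) → ℕ
  l_pos : ∀ i j, 0 < l i j

namespace ArrangementData

variable {𝕜 : Type*} [Field 𝕜] (D : ArrangementData 𝕜)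

/-- `n = n₀ + … + n_r` -/
def n : ℕ := ∑ i, D.size i

/-- Index set of the `n + m` variables: `Sum.inl ⟨i, j⟩` stands for `T_{ij}` and `Sum.inr k` for
`S_k`. -/
abbrev Var : Type := (Σ i : Fin (D.r + 1), Fin (D.size i)) ⊕ Fin D.m

/-- The integral `r × (n + m)` matrix `P₀`. -/
def P₀ : Matrix (Fin D.r) D.Var ℤ :=
  Matrix.of fun p v =>
    match v with
    | Sum.inl ⟨i, j⟩ => if i = 0 then -(D.l i j : ℤ) else if i = p.succ then (D.l i j : ℤ) else 0
    | Sum.inr _ => 0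

/-- `K₀ = ℤ^{n+m} / im(P₀^*)`, the factor group by the row lattice of `P₀`. -/
abbrev K₀ : Type := (D.Var → ℤ) ⧸ LinearMap.range D.P₀.transpose.mulVecLin

/-- The projection `Q₀ : ℤ^{n+m} → K₀`. -/
def Q₀ : (D.Var → ℤ) →ₗ[ℤ] D.K₀ := Submodule.mkQ _

/-- The degree of a variable: the class of the corresponding canonical basis vector. -/
noncomputable def degree (v : D.Var) : D.K₀ := D.Q₀ (Pi.single v 1)

/-- The polynomial ring `𝕜[T_{ij}, S_k]`. -/
abbrev Poly : Type _ := MvPolynomial D.Var 𝕜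

/-- The monomial `T_i^{l_i} = T_{i1}^{l_{i1}} ⋯ T_{in_i}^{l_{in_i}}`. -/
noncomputable def monomial (i : Fin (D.r + 1)) : D.Poly :=
  ∏ j : Fin (D.size i), MvPolynomial.X (Sum.inl ⟨i, j⟩) ^ D.l i j

/-- The column indices `0, …, c, c + t` occurring in `g_t`; since `t : Fin (r - c)` is counted from
`0`, the last one is `c + 1 + t`. -/
def columnIndex (t : Fin (D.r - D.c)) : Fin (D.c + 2) → Fin (D.r + 1) :=
  Fin.snoc (α := fun _ => Fin (D.r + 1))
    (Fin.castLE (Nat.succ_le_succ D.c_le_r) : Fin (D.c + 1) → Fin (D.r + 1))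
    ⟨D.c + 1 + t, by have := t.isLt; omega⟩

/-- The `(c + 2) × (c + 2)` matrix with columns `(a_i, T_i^{l_i})`, `i = 0, …, c, c + t`. -/
noncomputable def relationMatrix (t : Fin (D.r - D.c)) :
    Matrix (Fin (D.c + 2)) (Fin (D.c + 2)) D.Poly :=
  Matrix.of (Fin.snoc (α := fun _ => Fin (D.c + 2) → D.Poly)
    (fun p q => MvPolynomial.C (D.A p (D.columnIndex t q)))
    (fun q => D.monomial (D.columnIndex t q)))

/-- The relations `g₁, …, g_{r-c}` (indexed from `0`). -/
noncomputable def g (t : Fin (D.r - D.c)) : D.Poly := (D.relationMatrix t).det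

/-- The algebra `R(A, P₀) = 𝕜[T_{ij}, S_k] / ⟨g₁, …, g_{r-c}⟩`. -/
abbrev R : Type _ := D.Poly ⧸ Ideal.span (Set.range D.g)

/-- The homogeneous component of weight `w` of `R(A, P₀)`: the classes of the polynomials all of
whose monomials have degree `w`, where the variables have the degrees `degree v`. -/
noncomputable def component (w : D.K₀) : Submodule 𝕜 D.R :=
  (MvPolynomial.weightedHomogeneousSubmodule 𝕜 D.degree w).map
    (Ideal.Quotient.mkₐ 𝕜 (Ideal.span (Set.range D.g))).toLinearMap

/-- The class of a variable `T_{ij}` or `S_k` in `R(A, P₀)`. -/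
noncomputable def x (v : D.Var) : D.R := Ideal.Quotient.mk _ (MvPolynomial.X v)

end ArrangementData

/-! Write `ℓ_i` for the linear form in `Y_0, …, Y_c` with coefficient vector `a_i`, and `F = 𝕜[Y_0,
…, Y_c, S_k]`. Call a monomial reduced if it involves no `S_k` and is divisible by no `T_i^{l_i}`.
The whole proof rests on one fact: `R(A, P₀)` is a free `F`-module with the reduced monomials as
basis, and `T_i^{l_i} = ℓ_i` in it. Indeed `𝕜[T_{ij}, S_k]` is free with this basis over `𝕜[U_i,
S_k]`, where `U_i = T_i^{l_i}`. Up to a nonzero constant, `g_t` is a linear relation that expresses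
one more `U_i` through `U_0, …, U_c`, and dividing these relations out of `𝕜[U_i, S_k]` leaves `F`
(`base`, `coords`, `sum_coords`). Divisibility in `R` is then read off from coordinates, using that
any `c + 1` of the `ℓ_i` and the `S_k` together form a coordinate system of `F`
(`isPrime_span_blockForm`).

Integrality and primes: specialize `F → B`, choose roots `θ_i` of the images of the `ℓ_i` in an
algebraically closed field, and map `R` to a Laurent polynomial ring over that field. Kummer theory
computes the kernel, a prime ideal, in coordinates (`exists_isPrime_of_algHom`). The identity of `F`
shows that `R` is a domain. Reduction modulo `S_k`, and modulo `ℓ_i` if `c ≥ 2`, shows that the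
variables are prime.

Normality: the diagonal group that fixes `F` acts on the reduced monomials by pairwise different
characters (`eq_of_character_eq`). An integral fraction therefore splits into integral terms `T^ρ b
/ a` with `a, b ∈ F`. The powers of such a term have a common denominator, and comparing prime
multiplicities gives `a ∣ b`.

Regularity of the sequence is that of the linear relations, transported by freeness. The dimension
follows from regularity together with Krull's height theorem. The grading comes from a coaction `R →
R[K₀]`, the units from a grading with positive weights.

Factoriality: a homogeneous element is a monomial times a homogeneous polynomial `q` in the `Y_p`
(`exists_eq_mono_mul_linBase`). The prime factors of `q` are homogeneous; one associated to some
`ℓ_i` is a monomial in `R` up to a constant, and every other one is `K₀`-prime. -/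

namespace ArrangementData

/-! ### Division of exponents by the tuples `l_i` -/

section Exponents

variable {𝕜 : Type*} [Field 𝕜] (D : ArrangementData 𝕜)

/-- Index set of the variables `U_i` (standing for `T_i^{l_i}`) and `S_k`. -/
abbrev BlockVar : Type := Fin (D.r + 1) ⊕ Fin D.m

/-- The polynomial ring `𝕜[U_i, S_k]`. -/
abbrev BlockPoly : Type _ := MvPolynomial D.BlockVar 𝕜

theorem univ_size_nonempty (i : Fin (D.r + 1)) : (Finset.univ : Finset (Fin (D.size i))).Nonempty :=
  ⟨⟨0, D.size_pos i⟩, Finset.mem_univ _⟩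

/-- The largest `q` such that `T_i^{q l_i}` divides the monomial `T^e`. -/
def quot (e : D.Var →₀ ℕ) (i : Fin (D.r + 1)) : ℕ :=
  Finset.univ.inf' (D.univ_size_nonempty i) fun j => e (Sum.inl ⟨i, j⟩) / D.l i j

variable {D}

theorem quot_mul_le (e : D.Var →₀ ℕ) (i : Fin (D.r + 1)) (j : Fin (D.size i)) :
    D.quot e i * D.l i j ≤ e (Sum.inl ⟨i, j⟩) :=
  (Nat.le_div_iff_mul_le (D.l_pos i j)).1 (Finset.inf'_le _ (Finset.mem_univ j))

theorem exists_lt_quot_succ_mul (e : D.Var →₀ ℕ) (i : Fin (D.r + 1)) :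
    ∃ j, e (Sum.inl ⟨i, j⟩) < (D.quot e i + 1) * D.l i j := by
  obtain ⟨j, -, hj⟩ := Finset.exists_mem_eq_inf' (D.univ_size_nonempty i)
    fun j => e (Sum.inl ⟨i, j⟩) / D.l i j
  refine ⟨j, ?_⟩
  rw [quot, hj]
  exact (Nat.div_lt_iff_lt_mul (D.l_pos i j)).1 (Nat.lt_succ_self _)

theorem quot_eq {e : D.Var →₀ ℕ} {i : Fin (D.r + 1)} {q : ℕ}
    (h₁ : ∀ j, q * D.l i j ≤ e (Sum.inl ⟨i, j⟩))
    (h₂ : ∃ j, e (Sum.inl ⟨i, j⟩) < (q + 1) * D.l i j) : D.quot e i = q := by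
  obtain ⟨j, hj⟩ := h₂
  obtain ⟨k, hk⟩ := exists_lt_quot_succ_mul e i
  refine le_antisymm ?_ ?_
  · exact Nat.lt_succ_iff.1 (lt_of_mul_lt_mul_right ((quot_mul_le e i j).trans_lt hj) (Nat.zero_le _))
  · exact Nat.lt_succ_iff.1 (lt_of_mul_lt_mul_right ((h₁ k).trans_lt hk) (Nat.zero_le _))

/-- The exponent of the monomial in the `U_i` and `S_k` that splits off from `T^e`. -/
noncomputable def blockPart (e : D.Var →₀ ℕ) : D.BlockVar →₀ ℕ :=
  Finsupp.equivFunOnFinite.symm (Sum.elim (D.quot e) fun k => e (Sum.inr k))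

/-- The exponent of what remains of `T^e` after splitting off powers of the `T_i^{l_i}` and
the `S_k`. -/
noncomputable def residue (e : D.Var →₀ ℕ) : D.Var →₀ ℕ :=
  Finsupp.equivFunOnFinite.symm
    (Sum.elim (fun p => e (Sum.inl p) - D.quot e p.1 * D.l p.1 p.2) fun _ => 0)

/-- The exponent in the variables `T_{ij}`, `S_k` of a monomial in the `T_i^{l_i}`, `S_k`. -/
noncomputable def expand (κ : D.BlockVar →₀ ℕ) : D.Var →₀ ℕ :=
  Finsupp.equivFunOnFinite.symm
    (Sum.elim (fun p => κ (Sum.inl p.1) * D.l p.1 p.2) fun k => κ (Sum.inr k))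

@[simp] theorem blockPart_inl (e : D.Var →₀ ℕ) (i) : blockPart e (Sum.inl i) = D.quot e i := rfl

@[simp] theorem blockPart_inr (e : D.Var →₀ ℕ) (k) : blockPart e (Sum.inr k) = e (Sum.inr k) := rfl

@[simp] theorem residue_inl (e : D.Var →₀ ℕ) (p) :
    residue e (Sum.inl p) = e (Sum.inl p) - D.quot e p.1 * D.l p.1 p.2 := rfl

@[simp] theorem residue_inr (e : D.Var →₀ ℕ) (k) : residue e (Sum.inr k) = 0 := rfl

@[simp] theorem expand_inl (κ : D.BlockVar →₀ ℕ) (p) :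
    expand κ (Sum.inl p) = κ (Sum.inl p.1) * D.l p.1 p.2 := rfl

@[simp] theorem expand_inr (κ : D.BlockVar →₀ ℕ) (k) :
    expand κ (Sum.inr k) = κ (Sum.inr k) := rfl

@[simp] theorem expand_zero : expand (0 : D.BlockVar →₀ ℕ) = 0 := by
  ext (p | k) <;> simp

theorem expand_add (κ κ' : D.BlockVar →₀ ℕ) : expand (κ + κ') = expand κ + expand κ' := by
  ext (p | k) <;> simp [add_mul]

/-- Exponents of monomials without `S_k` that are divisible by none of the `T_i^{l_i}`. -/
def IsReducedExponent (ρ : D.Var →₀ ℕ) : Prop :=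
  (∀ k, ρ (Sum.inr k) = 0) ∧ ∀ i, ∃ j, ρ (Sum.inl ⟨i, j⟩) < D.l i j

theorem isReducedExponent_residue (e : D.Var →₀ ℕ) : IsReducedExponent (residue e) := by
  refine ⟨fun k => rfl, fun i => ?_⟩
  obtain ⟨j, hj⟩ := exists_lt_quot_succ_mul e i
  refine ⟨j, ?_⟩
  have := quot_mul_le e i j
  rw [add_mul, one_mul] at hj
  simp only [residue_inl]
  omega

theorem isReducedExponent_zero : IsReducedExponent (0 : D.Var →₀ ℕ) :=
  ⟨fun _ => rfl, fun i => ⟨⟨0, D.size_pos i⟩, D.l_pos _ _⟩⟩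

/-- Existence of the decomposition. `IsReducedExponent.blockPart_add_expand` and
`IsReducedExponent.residue_add_expand` give its uniqueness, so that exponents correspond to pairs of
a reduced exponent and a monomial in the `U_i`, `S_k`. -/
theorem residue_add_expand (e : D.Var →₀ ℕ) : residue e + expand (blockPart e) = e := by
  ext (p | k)
  · simpa using Nat.sub_add_cancel (quot_mul_le e p.1 p.2)
  · simp

theorem IsReducedExponent.blockPart_add_expand {ρ : D.Var →₀ ℕ} (hρ : IsReducedExponent ρ)
    (κ : D.BlockVar →₀ ℕ) : blockPart (ρ + expand κ) = κ := by
  ext (i | k)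
  · refine quot_eq (fun j => by simp) ?_
    obtain ⟨j, hj⟩ := hρ.2 i
    exact ⟨j, by simp [add_mul]; omega⟩
  · simp [hρ.1]

theorem IsReducedExponent.residue_add_expand {ρ : D.Var →₀ ℕ} (hρ : IsReducedExponent ρ)
    (κ : D.BlockVar →₀ ℕ) : residue (ρ + expand κ) = ρ := by
  have h := ArrangementData.residue_add_expand (ρ + expand κ)
  rw [hρ.blockPart_add_expand] at h
  exact add_right_cancel h

theorem IsReducedExponent.residue_eq {ρ : D.Var →₀ ℕ} (hρ : IsReducedExponent ρ) :
    residue ρ = ρ := by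
  simpa using hρ.residue_add_expand 0

theorem IsReducedExponent.blockPart_eq {ρ : D.Var →₀ ℕ} (hρ : IsReducedExponent ρ) :
    blockPart ρ = 0 := by
  simpa using hρ.blockPart_add_expand 0

theorem residue_expand_add (e : D.Var →₀ ℕ) (κ : D.BlockVar →₀ ℕ) :
    residue (expand κ + e) = residue e := by
  conv_lhs => rw [← residue_add_expand e, add_left_comm, ← expand_add]
  exact (isReducedExponent_residue e).residue_add_expand _

theorem blockPart_expand_add (e : D.Var →₀ ℕ) (κ : D.BlockVar →₀ ℕ) :
    blockPart (expand κ + e) = κ + blockPart e := by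
  conv_lhs => rw [← residue_add_expand e, add_left_comm, ← expand_add]
  exact (isReducedExponent_residue e).blockPart_add_expand _

end Exponents

/-! ### The polynomial ring as a free module over `𝕜[U_i, S_k]` -/

section Coefficients

variable {𝕜 : Type*} [Field 𝕜] {D : ArrangementData 𝕜}

open MvPolynomial

/-- The homomorphism `𝕜[U_i, S_k] → 𝕜[T_{ij}, S_k]` with `U_i ↦ T_i^{l_i}`. -/
noncomputable def blockHom : D.BlockPoly →ₐ[𝕜] D.Poly :=
  aeval (Sum.elim D.monomial fun k => X (Sum.inr k))

@[simp] theorem blockHom_X_inl (i : Fin (D.r + 1)) :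
    blockHom (X (Sum.inl i) : D.BlockPoly) = D.monomial i := by simp [blockHom]

@[simp] theorem blockHom_X_inr (k : Fin D.m) :
    blockHom (X (Sum.inr k) : D.BlockPoly) = X (Sum.inr k) := by simp [blockHom]

theorem blockHom_monomial (κ : D.BlockVar →₀ ℕ) (a : 𝕜) :
    blockHom (MvPolynomial.monomial κ a) = MvPolynomial.monomial (expand κ) a := by
  rw [blockHom, aeval_monomial, MvPolynomial.monomial_eq (s := expand κ),
    Finsupp.prod_fintype _ _ (by simp), Finsupp.prod_fintype _ _ (by simp),
    Fintype.prod_sum_type, Fintype.prod_sum_type, Fintype.prod_sigma]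
  simp [ArrangementData.monomial, algebraMap_eq, ← Finset.prod_pow, ← pow_mul, mul_comm]

/-- The coefficients of a polynomial with respect to the basis of `𝕜[T_{ij}, S_k]` as a
`𝕜[U_i, S_k]`-module that consists of the monomials with reduced exponent. -/
noncomputable def coef : D.Poly →ₗ[𝕜] ((D.Var →₀ ℕ) →₀ D.BlockPoly) :=
  (basisMonomials D.Var 𝕜).constr 𝕜 fun e =>
    Finsupp.single (residue e) (MvPolynomial.monomial (blockPart e) 1)

theorem coef_monomial (e : D.Var →₀ ℕ) (a : 𝕜) :
    coef (MvPolynomial.monomial e a) =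
      Finsupp.single (residue e) (MvPolynomial.monomial (blockPart e) a) := by
  have h : MvPolynomial.monomial e a = a • basisMonomials D.Var 𝕜 e := by
    simp [MvPolynomial.smul_monomial]
  rw [h, map_smul, coef, Module.Basis.constr_basis]
  simp [MvPolynomial.smul_monomial]

/-- Multiplying a monomial by a power product of the `T_i^{l_i}` and `S_k` shifts its block part and
keeps its residue. Linearity reduces everything to this case. -/
theorem coef_blockHom_mul (a : D.BlockPoly) (F : D.Poly) :
    coef (blockHom a * F) = a • coef F := by
  induction a using MvPolynomial.induction_on'' with
  | C a =>
    rw [← algebraMap_eq, AlgHom.commutes, ← Algebra.smul_def, map_smul, algebraMap_smul]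
  | monomial_add κ a f _ _ h₁ h₂ => rw [map_add, add_mul, map_add, h₁, h₂, add_smul]
  | mul_X f i h =>
    rw [mul_comm f, map_mul blockHom, mul_assoc, mul_smul, ← h]
    generalize blockHom f * F = G
    induction G using MvPolynomial.induction_on' with
    | monomial e c =>
      rw [show (X i : D.BlockPoly) = MvPolynomial.monomial (Finsupp.single i 1) 1 from rfl,
        blockHom_monomial, MvPolynomial.monomial_mul, coef_monomial, coef_monomial,
        residue_expand_add, blockPart_expand_add]
      simp [MvPolynomial.monomial_mul]
    | add p q hp hq => rw [mul_add, map_add, hp, hq, map_add, smul_add]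

theorem sum_coef (F : D.Poly) :
    ((coef F).sum fun ρ a => MvPolynomial.monomial ρ 1 * blockHom a) = F := by
  induction F using MvPolynomial.induction_on' with
  | monomial e c =>
    rw [coef_monomial, Finsupp.sum_single_index (by simp), blockHom_monomial,
      MvPolynomial.monomial_mul, residue_add_expand, one_mul]
  | add p q hp hq =>
    rw [map_add, Finsupp.sum_add_index' (by simp) (by intros; rw [map_add, mul_add]), hp, hq]

theorem isReducedExponent_of_mem_support_coef {F : D.Poly} {ρ : D.Var →₀ ℕ}
    (h : coef F ρ ≠ 0) : IsReducedExponent ρ := by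
  contrapose! h
  induction F using MvPolynomial.induction_on' with
  | monomial e c =>
    rw [coef_monomial, Finsupp.single_apply, if_neg]
    rintro rfl
    exact h (isReducedExponent_residue e)
  | add p q hp hq => rw [map_add, Finsupp.add_apply, hp, hq, add_zero]

end Coefficients

end ArrangementData

namespace ArrangementData

/-! ### The relations as linear relations, and the map from `𝕜[Y_p, S_k]` to `R(A, P₀)` -/

section LinearForms

open MvPolynomial

variable {𝕜 : Type*} [Field 𝕜] (D : ArrangementData 𝕜)

/-- The index of one of the first `c + 1` columns of `A`. -/
def firstIndex (q : Fin (D.c + 1)) : Fin (D.r + 1) := Fin.castLE (Nat.succ_le_succ D.c_le_r) q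

/-- The index of the column of `A` that `g_t` expresses in terms of the first `c + 1` columns. -/
def lastIndex (t : Fin (D.r - D.c)) : Fin (D.r + 1) :=
  ⟨D.c + 1 + t, by have := t.isLt; omega⟩

/-- The square matrix formed by the first `c + 1` columns of `A`. -/
def firstMatrix : Matrix (Fin (D.c + 1)) (Fin (D.c + 1)) 𝕜 := D.A.submatrix id D.firstIndex

/-- The coordinates of the column `a_i` with respect to the first `c + 1` columns. -/
noncomputable def coord (i : Fin (D.r + 1)) : Fin (D.c + 1) → 𝕜 :=
  (D.firstMatrix⁻¹).mulVec fun p => D.A p i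

theorem isUnit_det_submatrix (e : Fin (D.c + 1) ↪ Fin (D.r + 1)) :
    IsUnit (D.A.submatrix id e).det :=
  (Matrix.isUnit_iff_isUnit_det _).1
    (Matrix.linearIndependent_cols_iff_isUnit.1 (D.linearIndependent_columns e))

theorem isUnit_det_firstMatrix : IsUnit D.firstMatrix.det :=
  D.isUnit_det_submatrix (Fin.castLEEmb (Nat.succ_le_succ D.c_le_r))

variable {D}

theorem exists_eq_firstIndex_or_lastIndex (i : Fin (D.r + 1)) :
    (∃ q, i = D.firstIndex q) ∨ ∃ t, i = D.lastIndex t := by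
  by_cases h : (i : ℕ) < D.c + 1
  · exact Or.inl ⟨⟨i, h⟩, rfl⟩
  · have := i.isLt
    refine Or.inr ⟨⟨i - (D.c + 1), by omega⟩, Fin.ext ?_⟩
    simp only [lastIndex]
    omega

theorem firstIndex_ne_lastIndex (q : Fin (D.c + 1)) (t : Fin (D.r - D.c)) :
    D.firstIndex q ≠ D.lastIndex t := by
  intro h
  have h := congrArg Fin.val h
  have := q.isLt
  simp only [firstIndex, lastIndex, Fin.val_castLE] at h
  omega

theorem sum_coord (i : Fin (D.r + 1)) (p : Fin (D.c + 1)) :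
    ∑ q, D.A p (D.firstIndex q) * D.coord i q = D.A p i := by
  have h : D.firstMatrix.mulVec (D.coord i) = fun p => D.A p i := by
    rw [coord, Matrix.mulVec_mulVec, Matrix.mul_nonsing_inv _ D.isUnit_det_firstMatrix,
      Matrix.one_mulVec]
  exact congrFun h p

theorem coord_firstIndex (q : Fin (D.c + 1)) : D.coord (D.firstIndex q) = Pi.single q 1 := by
  have h : (fun p => D.A p (D.firstIndex q)) = D.firstMatrix.mulVec (Pi.single q 1) := by
    ext p
    simp [firstMatrix]
  rw [coord, h, Matrix.mulVec_mulVec, Matrix.nonsing_inv_mul _ D.isUnit_det_firstMatrix,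
    Matrix.one_mulVec]

theorem columnIndex_castSucc (t : Fin (D.r - D.c)) (q : Fin (D.c + 1)) :
    D.columnIndex t q.castSucc = D.firstIndex q := by
  simp [columnIndex, firstIndex]

theorem columnIndex_last (t : Fin (D.r - D.c)) :
    D.columnIndex t (Fin.last _) = D.lastIndex t := by
  simp [columnIndex, lastIndex]

/-- The vector `v` cancels the constant entries of the last column, so that `M v = (0, …, 0, δ)`.
Since `adj(M) M v = det(M) v` and the last entry of `v` is `1`, the determinant is `δ` times the
last diagonal cofactor, which is the determinant of the first `c + 1` columns. -/
theorem g_eq (t : Fin (D.r - D.c)) :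
    D.g t = C D.firstMatrix.det *
      (D.monomial (D.lastIndex t) -
        ∑ q, C (D.coord (D.lastIndex t) q) * D.monomial (D.firstIndex q)) := by
  set M := D.relationMatrix t with hM
  set δ := D.monomial (D.lastIndex t) -
        ∑ q, C (D.coord (D.lastIndex t) q) * D.monomial (D.firstIndex q) with hδ
  let v : Fin (D.c + 2) → D.Poly :=
    Fin.snoc (α := fun _ => D.Poly) (fun q => - C (D.coord (D.lastIndex t) q)) 1
  have hv : M.mulVec v = Fin.snoc (α := fun _ => D.Poly) (fun _ => 0) δ := by
    ext1 p
    refine Fin.lastCases ?_ (fun p => ?_) p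
    · rw [Matrix.mulVec, dotProduct, Fin.sum_univ_castSucc]
      simp [hM, relationMatrix, v, columnIndex_castSucc, columnIndex_last, hδ, mul_comm]
      ring
    · rw [Matrix.mulVec, dotProduct, Fin.sum_univ_castSucc]
      have := congrArg (C (σ := D.Var)) (sum_coord (D.lastIndex t) p)
      rw [map_sum] at this
      simp only [map_mul] at this
      simp [hM, relationMatrix, v, columnIndex_castSucc, columnIndex_last, this]
  have h : (M.adjugate.mulVec (M.mulVec v)) (Fin.last _) = M.det := by
    rw [Matrix.mulVec_mulVec, Matrix.adjugate_mul, Matrix.smul_mulVec, Matrix.one_mulVec]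
    simp [v]
  have hsub : M.submatrix Fin.castSucc Fin.castSucc = D.firstMatrix.map C := by
    ext1 p q
    simp [hM, relationMatrix, columnIndex_castSucc, firstMatrix]
  rw [hv, Matrix.mulVec, dotProduct, Fin.sum_univ_castSucc] at h
  simp only [Fin.snoc_castSucc, Fin.snoc_last, mul_zero, Finset.sum_const_zero, zero_add] at h
  rw [Matrix.adjugate_fin_succ_eq_det_submatrix, Fin.succAbove_last, hsub, ← RingHom.mapMatrix_apply,
    ← RingHom.map_det, ← two_mul, pow_mul, neg_one_sq, one_pow, one_mul] at h
  exact h.symm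

variable (D) in
/-- The linear relation between the `U_i` that `g_t` is obtained from. -/
noncomputable def linRel (t : Fin (D.r - D.c)) : D.BlockPoly :=
  C D.firstMatrix.det *
    (X (Sum.inl (D.lastIndex t)) - ∑ q, C (D.coord (D.lastIndex t) q) * X (Sum.inl (D.firstIndex q)))

theorem blockHom_C (a : 𝕜) : blockHom (C a : D.BlockPoly) = C a := by
  rw [← algebraMap_eq, AlgHom.commutes, algebraMap_eq]

theorem blockHom_linRel (t : Fin (D.r - D.c)) : blockHom (D.linRel t) = D.g t := by
  simp [linRel, g_eq]

variable (D) in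
/-- Index set of the variables `Y_0, …, Y_c` and `S_k`. -/
abbrev FormVar : Type := Fin (D.c + 1) ⊕ Fin D.m

variable (D) in
/-- The polynomial ring `𝕜[Y_0, …, Y_c, S_k]`. -/
abbrev FormPoly : Type _ := MvPolynomial D.FormVar 𝕜

variable (D) in
/-- The linear form in `Y_0, …, Y_c` with coefficient vector `a_i`. -/
noncomputable def form (i : Fin (D.r + 1)) : D.FormPoly := ∑ p, C (D.A p i) * X (Sum.inl p)

/-- The homomorphism `𝕜[U_i, S_k] → 𝕜[Y_p, S_k]` that sends `U_i` to the `i`-th linear form. -/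
noncomputable def formHom : D.BlockPoly →ₐ[𝕜] D.FormPoly :=
  aeval (Sum.elim D.form fun k => X (Sum.inr k))

@[simp] theorem formHom_X_inl (i : Fin (D.r + 1)) :
    formHom (X (Sum.inl i) : D.BlockPoly) = D.form i := by simp [formHom]

@[simp] theorem formHom_X_inr (k : Fin D.m) :
    formHom (X (Sum.inr k) : D.BlockPoly) = X (Sum.inr k) := by simp [formHom]

theorem formHom_C (a : 𝕜) : formHom (C a : D.BlockPoly) = C a := by
  rw [← algebraMap_eq, AlgHom.commutes, algebraMap_eq]

theorem form_eq_sum (i : Fin (D.r + 1)) :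
    D.form i = ∑ q, C (D.coord i q) * D.form (D.firstIndex q) := by
  simp only [form, Finset.mul_sum]
  rw [Finset.sum_comm]
  refine Finset.sum_congr rfl fun p _ => ?_
  rw [← sum_coord, map_sum, Finset.sum_mul]
  refine Finset.sum_congr rfl fun q _ => ?_
  rw [C_mul]
  ring

theorem formHom_linRel (t : Fin (D.r - D.c)) : formHom (D.linRel t) = 0 := by
  rw [linRel, map_mul, map_sub, map_sum]
  simp only [map_mul, formHom_C, formHom_X_inl]
  rw [form_eq_sum (D.lastIndex t), sub_self, mul_zero]

/-- A section of `formHom`. -/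
noncomputable def formSection : D.FormPoly →ₐ[𝕜] D.BlockPoly :=
  aeval (Sum.elim (fun p => ∑ q, C (D.firstMatrix⁻¹ q p) * X (Sum.inl (D.firstIndex q)))
    fun k => X (Sum.inr k))

/-- The section uses only `U_0, …, U_c`: composed with `formHom` it replaces each `U_i` by the
combination that the relations prescribe. -/
theorem formSection_form (i : Fin (D.r + 1)) :
    formSection (D.form i) = ∑ q, C (D.coord i q) * X (Sum.inl (D.firstIndex q)) := by
  simp only [form, formSection, map_sum, map_mul, aeval_X, Sum.elim_inl, algHom_C, algebraMap_eq,
    Finset.mul_sum, coord, Matrix.mulVec, dotProduct, Finset.sum_mul]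
  rw [Finset.sum_comm]
  refine Finset.sum_congr rfl fun q _ => Finset.sum_congr rfl fun p _ => ?_
  ring

theorem formHom_formSection (b : D.FormPoly) : formHom (formSection b) = b := by
  suffices h : (formHom.comp formSection : D.FormPoly →ₐ[𝕜] D.FormPoly) = AlgHom.id 𝕜 _ from
    DFunLike.congr_fun h b
  refine MvPolynomial.algHom_ext fun v => ?_
  rcases v with p | k
  · have h (p' : Fin (D.c + 1)) :
        ∑ q, D.A p' (D.firstIndex q) * D.firstMatrix⁻¹ q p = if p' = p then 1 else 0 := by
      have := congrFun (congrFun (Matrix.mul_nonsing_inv _ D.isUnit_det_firstMatrix) p') p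
      simpa [Matrix.mul_apply, Matrix.one_apply, firstMatrix] using this
    simp only [AlgHom.comp_apply, formSection, aeval_X, Sum.elim_inl, map_sum, map_mul, formHom_C,
      formHom_X_inl, form, Finset.mul_sum, AlgHom.id_apply]
    rw [Finset.sum_comm]
    calc _ = ∑ p', C (∑ q, D.A p' (D.firstIndex q) * D.firstMatrix⁻¹ q p) *
          (X (Sum.inl p') : D.FormPoly) := by
            refine Finset.sum_congr rfl fun p' _ => ?_
            rw [map_sum, Finset.sum_mul]
            refine Finset.sum_congr rfl fun q _ => ?_
            rw [C_mul]
            ring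
      _ = _ := by simp [h]
  · simp [formSection]

variable (D) in
/-- The canonical projection onto `R(A, P₀)`. -/
noncomputable abbrev proj : D.Poly →ₐ[𝕜] D.R := Ideal.Quotient.mkₐ 𝕜 _

theorem proj_surjective : Function.Surjective D.proj := Ideal.Quotient.mk_surjective

theorem proj_g (t : Fin (D.r - D.c)) : D.proj (D.g t) = 0 :=
  Ideal.Quotient.eq_zero_iff_mem.2 (Ideal.subset_span ⟨t, rfl⟩)

/-- The embedding of `𝕜[Y_p, S_k]` into `R(A, P₀)` that sends the `i`-th linear form to the class
of `T_i^{l_i}`. -/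
noncomputable def base : D.FormPoly →ₐ[𝕜] D.R := D.proj.comp (blockHom.comp formSection)

/-- For one of the first `c + 1` indices the coordinates are a unit vector. For the others this is
the relation `g_t`, divided by the invertible determinant. -/
theorem base_form (i : Fin (D.r + 1)) : base (D.form i) = D.proj (D.monomial i) := by
  simp only [base, AlgHom.comp_apply, formSection_form, map_sum, map_mul, blockHom_C,
    blockHom_X_inl]
  rcases exists_eq_firstIndex_or_lastIndex i with ⟨q, rfl⟩ | ⟨t, rfl⟩
  · rw [coord_firstIndex, Finset.sum_eq_single q]
    · simp
    · intro q' _ h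
      simp [Pi.single_eq_of_ne h]
    · simp
  · have h := proj_g t
    rw [g_eq, map_mul, map_sub, map_sum] at h
    have hu : IsUnit (D.proj (C D.firstMatrix.det)) :=
      (D.isUnit_det_firstMatrix.map C).map D.proj
    have h := (hu.mul_right_eq_zero).1 h
    simp only [map_mul] at h
    exact (sub_eq_zero.1 h).symm

theorem base_X_inr (k : Fin D.m) : base (X (Sum.inr k)) = D.x (Sum.inr k) := by
  simp [base, formSection, x]

theorem base_formHom (a : D.BlockPoly) : base (formHom a) = D.proj (blockHom a) := by
  suffices h : base.comp formHom = D.proj.comp blockHom from DFunLike.congr_fun h a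
  refine MvPolynomial.algHom_ext fun v => ?_
  rcases v with i | k
  · simp [base_form]
  · simp [base_X_inr, x]

end LinearForms

/-! ### `R(A, P₀)` as a free module over `𝕜[Y_p, S_k]` -/

section Coefficients

open MvPolynomial

variable {𝕜 : Type*} [Field 𝕜] {D : ArrangementData 𝕜}

/-- The coefficients of a polynomial over `𝕜[Y_p, S_k]`. -/
noncomputable def formCoef : D.Poly →ₗ[𝕜] ((D.Var →₀ ℕ) →₀ D.FormPoly) :=
  (Finsupp.mapRange.linearMap formHom.toLinearMap).comp coef

theorem formCoef_apply (F : D.Poly) (ρ : D.Var →₀ ℕ) : formCoef F ρ = formHom (coef F ρ) := rfl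

theorem formCoef_blockHom_mul (a : D.BlockPoly) (F : D.Poly) :
    formCoef (blockHom a * F) = formHom a • formCoef F := by
  ext1 ρ
  simp [formCoef_apply, coef_blockHom_mul]

theorem formCoef_eq_zero_of_mem {F : D.Poly} (hF : F ∈ Ideal.span (Set.range D.g)) :
    formCoef F = 0 := by
  -- `formCoef` is linear only over the image of `blockHom`. Quantifying over all multiples makes
  -- the claim stable under multiplication by arbitrary polynomials.
  suffices h : ∀ G, formCoef (G * F) = 0 by simpa using h 1
  refine Submodule.span_induction (p := fun F _ => ∀ G, formCoef (G * F) = 0) ?_ (by simp)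
    (fun _ _ _ _ h h' G => by rw [mul_add, map_add, h, h', add_zero])
    (fun a F _ h G => by rw [smul_eq_mul, ← mul_assoc, h]) hF
  rintro _ ⟨t, rfl⟩ G
  rw [mul_comm, ← blockHom_linRel, formCoef_blockHom_mul, formHom_linRel, zero_smul]

/-- The coefficients of an element of `R(A, P₀)` with respect to the basis over `𝕜[Y_p, S_k]`
that consists of the monomials with reduced exponent. -/
noncomputable def coords : D.R →ₗ[𝕜] ((D.Var →₀ ℕ) →₀ D.FormPoly) :=
  (Submodule.liftQ ((Ideal.span (Set.range D.g)).restrictScalars 𝕜) formCoef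
    fun _ hF => formCoef_eq_zero_of_mem hF).comp
  (Submodule.Quotient.restrictScalarsEquiv 𝕜 (Ideal.span (Set.range D.g))).symm.toLinearMap

theorem coords_proj (F : D.Poly) : coords (D.proj F) = formCoef F := rfl

variable (D) in
/-- The class of a monomial in `R(A, P₀)`. -/
noncomputable def mono (e : D.Var →₀ ℕ) : D.R := D.proj (MvPolynomial.monomial e 1)

@[simp] theorem mono_zero : D.mono 0 = 1 := by
  simp [mono]

theorem mono_add (e e' : D.Var →₀ ℕ) : D.mono (e + e') = D.mono e * D.mono e' := by
  rw [mono, mono, mono, ← map_mul, MvPolynomial.monomial_mul, one_mul]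

theorem mono_single (v : D.Var) : D.mono (Finsupp.single v 1) = D.x v := rfl

theorem mono_nsmul (k : ℕ) (e : D.Var →₀ ℕ) : D.mono (k • e) = D.mono e ^ k := by
  induction k with
  | zero => simp
  | succ k ih => rw [add_smul, one_smul, mono_add, ih, pow_succ]

variable (D) in
/-- The monomial `∏ ℓ_i^{κ_i} ∏ S_k^{κ_k}` in the linear forms. -/
noncomputable def formMono (κ : D.BlockVar →₀ ℕ) : D.FormPoly :=
  formHom (MvPolynomial.monomial κ 1)

theorem formMono_eq (κ : D.BlockVar →₀ ℕ) :
    D.formMono κ = (∏ i, D.form i ^ κ (Sum.inl i)) * ∏ k, X (Sum.inr k) ^ κ (Sum.inr k) := by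
  rw [formMono, formHom, aeval_monomial, Finsupp.prod_fintype _ _ (by simp),
    Fintype.prod_sum_type]
  simp

theorem base_formMono (κ : D.BlockVar →₀ ℕ) : base (D.formMono κ) = D.mono (expand κ) := by
  rw [formMono, base_formHom, blockHom_monomial, mono]

theorem mono_eq (e : D.Var →₀ ℕ) :
    D.mono e = D.mono (residue e) * base (D.formMono (blockPart e)) := by
  rw [base_formMono, ← mono_add, residue_add_expand]

theorem coords_base_mul (b : D.FormPoly) (f : D.R) : coords (base b * f) = b • coords f := by
  obtain ⟨F, rfl⟩ := proj_surjective f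
  rw [← formHom_formSection b, base_formHom, ← map_mul, coords_proj, coords_proj,
    formCoef_blockHom_mul]

theorem coords_mono {ρ : D.Var →₀ ℕ} (hρ : IsReducedExponent ρ) :
    coords (D.mono ρ) = Finsupp.single ρ 1 := by
  ext1 σ
  rw [mono, coords_proj, formCoef_apply, coef_monomial, hρ.residue_eq, hρ.blockPart_eq,
    Finsupp.single_apply, Finsupp.single_apply]
  split_ifs <;> simp

theorem coords_mono_mul_base {ρ : D.Var →₀ ℕ} (hρ : IsReducedExponent ρ) (b : D.FormPoly) :
    coords (D.mono ρ * base b) = Finsupp.single ρ b := by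
  rw [mul_comm, coords_base_mul, coords_mono hρ, Finsupp.smul_single, smul_eq_mul, mul_one]

theorem coords_mono_mul_base' (e : D.Var →₀ ℕ) (b : D.FormPoly) :
    coords (D.mono e * base b) = Finsupp.single (residue e) (D.formMono (blockPart e) * b) := by
  rw [mono_eq, mul_assoc, ← map_mul, coords_mono_mul_base (isReducedExponent_residue e)]

/-- The reduced monomials generate `R` over `𝕜[Y_p, S_k]`. With `coords_mono_mul_base`, which gives
their independence, this is the freeness of `R`. -/
theorem sum_coords (f : D.R) : ((coords f).sum fun ρ b => D.mono ρ * base b) = f := by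
  obtain ⟨F, rfl⟩ := proj_surjective f
  rw [coords_proj, formCoef, LinearMap.comp_apply, Finsupp.mapRange.linearMap_apply,
    Finsupp.sum_mapRange_index (by simp)]
  conv_rhs => rw [← sum_coef F, Finsupp.sum, map_sum]
  refine Finset.sum_congr rfl fun ρ _ => ?_
  rw [map_mul, ← base_formHom]
  rfl

theorem coords_injective : Function.Injective (coords : D.R → _) := fun f f' h => by
  rw [← sum_coords f, h, sum_coords]

theorem isReducedExponent_of_coords_ne_zero {f : D.R} {ρ : D.Var →₀ ℕ} (h : coords f ρ ≠ 0) :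
    IsReducedExponent ρ := by
  obtain ⟨F, rfl⟩ := proj_surjective f
  refine isReducedExponent_of_mem_support_coef (F := F) fun h' => h ?_
  rw [coords_proj, formCoef_apply, h', map_zero]

theorem base_injective : Function.Injective (base : D.FormPoly → D.R) := fun b b' h => by
  have := congrArg coords (congrArg (D.mono 0 * ·) h)
  simp only [coords_mono_mul_base isReducedExponent_zero] at this
  exact Finsupp.single_injective _ this

instance : Nontrivial D.R := base_injective.nontrivial

end Coefficients

end ArrangementData

/-! ### Independence of characters and Kummer theory -/

section Independence

/-- If `∑ χ_i(g) v_i` lies in a subspace for all `g`, where the characters `χ_i` are pairwise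
different, then so do all `v_i`. -/
theorem Submodule.mem_of_forall_sum_monoidHom_smul_mem {G k V ι : Type*} [Monoid G] [Field k]
    [AddCommGroup V] [Module k V] [Fintype ι] (W : Submodule k V) {χ : ι → G →* k}
    (hχ : Function.Injective χ) {v : ι → V} (h : ∀ g, ∑ i, χ i g • v i ∈ W) (i : ι) : v i ∈ W := by
  rw [← Submodule.Quotient.mk_eq_zero, ← Module.forall_dual_apply_eq_zero_iff k]
  intro f
  have hlin := Fintype.linearIndependent_iff.1 ((linearIndependent_monoidHom G k).comp χ hχ)
  refine hlin (fun i => f (W.mkQ (v i))) ?_ i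
  ext g
  have := congrArg f ((Submodule.Quotient.mk_eq_zero W).2 (h g))
  rw [← Submodule.mkQ_apply, map_sum, map_sum, map_zero] at this
  simpa [mul_comm] using this

/-- Kummer theory: radicals of elements of `K` that represent pairwise different classes modulo `K`
are linearly independent over `K`. -/
theorem eq_zero_of_sum_radicals_eq_zero {𝕜 K Ω ι : Type*} [Field 𝕜] [IsAlgClosed 𝕜] [Field K]
    [Field Ω] [Algebra 𝕜 K] [Algebra K Ω] [Algebra 𝕜 Ω] [IsScalarTower 𝕜 K Ω] [IsGalois K Ω]
    [CharZero 𝕜] [Fintype ι] {z : ι → Ω} (hz : ∀ i, z i ≠ 0) {N : ℕ} (hN : N ≠ 0)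
    (hpow : ∀ i, z i ^ N ∈ (algebraMap K Ω).range)
    (hne : ∀ i j, z i / z j ∈ (algebraMap K Ω).range → i = j) {a : ι → K}
    (h : ∑ i, algebraMap K Ω (a i) * z i = 0) (i : ι) : a i = 0 := by
  -- `τ z / z` is an `N`-th root of unity, hence lies in the algebraically closed field `𝕜` and is
  -- fixed by `σ`. This is what makes `σ ↦ σ z / z` multiplicative.
  have hfix (i : ι) (σ τ : Ω ≃ₐ[K] Ω) : σ (τ (z i) / z i) = τ (z i) / z i := by
    obtain ⟨y, hy⟩ := hpow i
    have h1 : (τ (z i) / z i) ^ N = 1 := by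
      rw [div_pow, ← map_pow, ← hy, AlgEquiv.commutes, hy, div_self (pow_ne_zero _ (hz i))]
    have hroot : τ (z i) / z i ∈ (algebraMap 𝕜 Ω).range := by
      have hspl : (Polynomial.X ^ N - 1 : Polynomial 𝕜).Splits := IsAlgClosed.splits _
      have hmem : τ (z i) / z i ∈ ((Polynomial.X ^ N - 1 : Polynomial 𝕜).map
          (algebraMap 𝕜 Ω)).roots := by
        rw [Polynomial.mem_roots]
        · simp [h1]
        · simpa using Polynomial.X_pow_sub_C_ne_zero (Nat.pos_of_ne_zero hN) (1 : Ω)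
      rw [hspl.roots_map] at hmem
      obtain ⟨w, -, hw⟩ := Multiset.mem_map.1 hmem
      exact ⟨w, hw⟩
    obtain ⟨w, hw⟩ := hroot
    rw [← hw, IsScalarTower.algebraMap_apply 𝕜 K Ω, AlgEquiv.commutes]
  let χ (i : ι) : (Ω ≃ₐ[K] Ω) →* Ω :=
    { toFun := fun σ => σ (z i) / z i
      map_one' := by simp [hz i]
      map_mul' := fun σ τ => by
        have h := hfix i σ τ
        rw [map_div₀, div_eq_iff ((map_ne_zero _).2 (hz i))] at h
        rw [AlgEquiv.mul_apply, h]
        field_simp }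
  -- If two characters agree, then `z i / z j` is fixed by the Galois group and lies in `K`.
  have hχ : Function.Injective χ := fun i j hij => by
    refine hne i j ?_
    rw [← Set.mem_range.trans (RingHom.mem_range).symm, ← IntermediateField.mem_bot,
      InfiniteGalois.mem_bot_iff_fixed]
    intro σ
    have : σ (z i) / z i = σ (z j) / z j := DFunLike.congr_fun hij σ
    rw [div_eq_div_iff (hz i) (hz j)] at this
    rw [map_div₀, div_eq_div_iff ((map_ne_zero _).2 (hz j)) (hz j), this, mul_comm]
  have := Submodule.mem_of_forall_sum_monoidHom_smul_mem (⊥ : Submodule Ω Ω) hχ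
    (v := fun i => algebraMap K Ω (a i) * z i) (fun σ => ?_) i
  · simpa [hz i] using this
  · have h := congrArg σ h
    rw [map_zero, map_sum] at h
    rw [Submodule.mem_bot, ← h]
    refine Finset.sum_congr rfl fun i _ => ?_
    have := hz i
    simp only [χ, MonoidHom.coe_mk, OneHom.coe_mk, smul_eq_mul, map_mul, AlgEquiv.commutes]
    field_simp

theorem Prime.pow_mul_eq_pow_mul {M : Type*} [CommRing M] [IsDomain M] {p : M} (hp : Prime p)
    {m n : ℕ} {w w' : M} (hw : ¬ p ∣ w) (hw' : ¬ p ∣ w') (h : p ^ m * w = p ^ n * w') : m = n := by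
  rcases lt_trichotomy m n with hmn | rfl | hmn
  · obtain ⟨d, rfl⟩ := Nat.exists_eq_add_of_lt hmn
    rw [add_assoc, pow_add, mul_assoc] at h
    refine absurd ?_ hw
    rw [mul_left_cancel₀ (pow_ne_zero _ hp.ne_zero) h, pow_succ', mul_assoc]
    exact dvd_mul_right _ _
  · rfl
  · obtain ⟨d, rfl⟩ := Nat.exists_eq_add_of_lt hmn
    rw [add_assoc, pow_add, mul_assoc] at h
    refine absurd ?_ hw'
    rw [← mul_left_cancel₀ (pow_ne_zero _ hp.ne_zero) h, pow_succ', mul_assoc]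
    exact dvd_mul_right _ _

end Independence

/-! ### Ideals generated by variables -/

section VariableIdeals

open MvPolynomial

variable {𝕜 σ : Type*} [Field 𝕜]

/-- The ideal is the kernel of the substitution that kills the variables in `s` and fixes the
others, and this substitution has values in a domain. -/
theorem MvPolynomial.isPrime_span_X_image (s : Set σ) :
    (Ideal.span (X '' s) : Ideal (MvPolynomial σ 𝕜)).IsPrime ∧
      ∀ v, (X v : MvPolynomial σ 𝕜) ∈ Ideal.span (X '' s) ↔ v ∈ s := by
  classical
  let π : MvPolynomial σ 𝕜 →ₐ[𝕜] MvPolynomial σ 𝕜 := aeval fun v => if v ∈ s then 0 else X v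
  have hle : Ideal.span (X '' s) ≤ RingHom.ker π := by
    rw [Ideal.span_le]
    rintro _ ⟨v, hv, rfl⟩
    simp [π, hv]
  have h : Ideal.span (X '' s) = RingHom.ker π := by
    refine le_antisymm hle fun F hF => ?_
    have hcomp : (Ideal.Quotient.mkₐ 𝕜 (Ideal.span (X '' s))).comp π =
        Ideal.Quotient.mkₐ 𝕜 (Ideal.span (X '' s)) := by
      refine MvPolynomial.algHom_ext fun v => ?_
      by_cases hv : v ∈ s
      · simp only [AlgHom.comp_apply, π, aeval_X, if_pos hv, map_zero]
        exact (Ideal.Quotient.eq_zero_iff_mem.2 (Ideal.subset_span (Set.mem_image_of_mem _ hv))).symm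
      · simp [π, hv]
    have := DFunLike.congr_fun hcomp F
    rw [AlgHom.comp_apply, (RingHom.mem_ker).1 hF, map_zero] at this
    exact Ideal.Quotient.eq_zero_iff_mem.1 this.symm
  rw [h]
  refine ⟨RingHom.ker_isPrime _, fun v => ?_⟩
  rw [RingHom.mem_ker]
  by_cases hv : v ∈ s <;> simp [π, hv, X_ne_zero]

theorem MvPolynomial.isPrime_span_image_of_algEquiv
    (α : MvPolynomial σ 𝕜 ≃ₐ[𝕜] MvPolynomial σ 𝕜) (s : Set σ) :
    (Ideal.span ((fun v => α (X v)) '' s)).IsPrime ∧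
      ∀ v, α (X v) ∈ Ideal.span ((fun v => α (X v)) '' s) ↔ v ∈ s := by
  obtain ⟨h₁, h₂⟩ := MvPolynomial.isPrime_span_X_image (𝕜 := 𝕜) s
  have h : Ideal.span ((fun v => α (X v)) '' s) =
      (Ideal.span (X '' s)).comap (α.symm : MvPolynomial σ 𝕜 →+* MvPolynomial σ 𝕜) := by
    have := Ideal.map_comap_of_equiv (I := Ideal.span (X '' s)) α.toRingEquiv
    rw [Ideal.map_span, ← Set.image_comp] at this
    exact this
  rw [h]
  refine ⟨Ideal.comap_isPrime _ _, fun v => ?_⟩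
  rw [Ideal.mem_comap, ← h₂ v]
  simp

end VariableIdeals

namespace ArrangementData

/-! ### General position of the linear forms -/

section Forms

open MvPolynomial

variable {𝕜 : Type*} [Field 𝕜] {D : ArrangementData 𝕜}

variable (D) in
/-- The linear substitution of the variables `Y_p` by means of a matrix. -/
noncomputable def linSubst (M : Matrix (Fin (D.c + 1)) (Fin (D.c + 1)) 𝕜) :
    D.FormPoly →ₐ[𝕜] D.FormPoly :=
  aeval (Sum.elim (fun q => ∑ p, C (M p q) * X (Sum.inl p)) fun k => X (Sum.inr k))

theorem linSubst_comp (M N : Matrix (Fin (D.c + 1)) (Fin (D.c + 1)) 𝕜) :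
    (D.linSubst M).comp (D.linSubst N) = D.linSubst (M * N) := by
  refine MvPolynomial.algHom_ext fun v => ?_
  rcases v with q | k
  · simp only [linSubst, AlgHom.comp_apply, aeval_X, Sum.elim_inl, map_sum, map_mul, algHom_C,
      algebraMap_eq, Matrix.mul_apply, Finset.mul_sum, Finset.sum_mul]
    rw [Finset.sum_comm]
    refine Finset.sum_congr rfl fun p _ => Finset.sum_congr rfl fun q _ => ?_
    ring
  · simp [linSubst]

theorem linSubst_one : D.linSubst 1 = AlgHom.id 𝕜 _ := by
  refine MvPolynomial.algHom_ext fun v => ?_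
  rcases v with q | k
  · simp [linSubst, Matrix.one_apply]
  · simp [linSubst]

/-- The automorphism that sends the variables `Y_q` to the linear forms with indices `e q`. -/
noncomputable def formEquiv (e : Fin (D.c + 1) ↪ Fin (D.r + 1)) : D.FormPoly ≃ₐ[𝕜] D.FormPoly :=
  AlgEquiv.ofAlgHom (D.linSubst (D.A.submatrix id e)) (D.linSubst (D.A.submatrix id e)⁻¹)
    (by rw [linSubst_comp, Matrix.mul_nonsing_inv _ (D.isUnit_det_submatrix e), linSubst_one])
    (by rw [linSubst_comp, Matrix.nonsing_inv_mul _ (D.isUnit_det_submatrix e), linSubst_one])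

theorem formEquiv_X_inl (e : Fin (D.c + 1) ↪ Fin (D.r + 1)) (q : Fin (D.c + 1)) :
    formEquiv e (X (Sum.inl q)) = D.form (e q) := by
  change D.linSubst _ _ = _
  simp [linSubst, form]

theorem formEquiv_X_inr (e : Fin (D.c + 1) ↪ Fin (D.r + 1)) (k : Fin D.m) :
    formEquiv e (X (Sum.inr k)) = X (Sum.inr k) := by
  change D.linSubst _ _ = _
  simp [linSubst]

theorem exists_embedding (T : Finset (Fin (D.r + 1))) (hT : T.card ≤ D.c + 1) :
    ∃ e : Fin (D.c + 1) ↪ Fin (D.r + 1), ∀ i ∈ T, ∃ q, e q = i := by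
  obtain ⟨T', hTT', hcard⟩ := Finset.exists_superset_card_eq hT
    (by simpa using D.c_le_r)
  refine ⟨(T'.orderEmbOfFin hcard).toEmbedding, fun i hi => ?_⟩
  have : i ∈ Set.range (T'.orderEmbOfFin hcard) := by
    rw [Finset.range_orderEmbOfFin]
    exact hTT' hi
  exact this

variable (D) in
/-- The linear forms and the variables `S_k`. -/
noncomputable def blockForm (v : D.BlockVar) : D.FormPoly := formHom (X v)

@[simp] theorem blockForm_inl (i) : D.blockForm (Sum.inl i) = D.form i := by simp [blockForm]

@[simp] theorem blockForm_inr (k) : D.blockForm (Sum.inr k) = X (Sum.inr k) := by simp [blockForm]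

/-- This is where the rank condition on `A` enters: at most `c + 1` of the forms extend to a linear
coordinate system, and an automorphism turns the generators into variables. -/
theorem isPrime_span_blockForm (T : Finset (Fin (D.r + 1))) (hT : T.card ≤ D.c + 1)
    (W : Set D.BlockVar) (hW : ∀ i, Sum.inl i ∈ W → i ∈ T) :
    (Ideal.span (D.blockForm '' W)).IsPrime ∧
      (∀ i ∈ T, D.form i ∈ Ideal.span (D.blockForm '' W) ↔ Sum.inl i ∈ W) ∧
      ∀ k, (X (Sum.inr k) : D.FormPoly) ∈ Ideal.span (D.blockForm '' W) ↔ Sum.inr k ∈ W := by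
  obtain ⟨e, he⟩ := exists_embedding T hT
  let s : Set D.FormVar := Sum.map e id ⁻¹' W
  have hs : D.blockForm '' W = (fun v => formEquiv e (X v)) '' s := by
    ext F
    constructor
    · rintro ⟨i | k, hv, rfl⟩
      · obtain ⟨q, rfl⟩ := he i (hW i hv)
        exact ⟨Sum.inl q, hv, by simp [formEquiv_X_inl]⟩
      · exact ⟨Sum.inr k, hv, by simp [formEquiv_X_inr]⟩
    · rintro ⟨q | k, hv, rfl⟩
      · exact ⟨Sum.inl (e q), hv, by simp [formEquiv_X_inl]⟩
      · exact ⟨Sum.inr k, hv, by simp [formEquiv_X_inr]⟩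
  obtain ⟨h₁, h₂⟩ := MvPolynomial.isPrime_span_image_of_algEquiv (D.formEquiv e) s
  rw [hs]
  refine ⟨h₁, fun i hi => ?_, fun k => ?_⟩
  · obtain ⟨q, rfl⟩ := he i hi
    rw [← formEquiv_X_inl, h₂]
    rfl
  · rw [← formEquiv_X_inr e, h₂]
    rfl

theorem form_ne_zero (i : Fin (D.r + 1)) : D.form i ≠ 0 := by
  obtain ⟨-, h, -⟩ := isPrime_span_blockForm (D := D) {i} (by simp) ∅ (by simp)
  simpa using h i (by simp)

theorem prime_form (i : Fin (D.r + 1)) : Prime (D.form i) := by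
  obtain ⟨h, -⟩ := isPrime_span_blockForm (D := D) {i} (by simp) {Sum.inl i} (by simp)
  rw [Set.image_singleton, blockForm_inl] at h
  exact (Ideal.span_singleton_prime (form_ne_zero i)).1 h

theorem form_dvd_form {i k : Fin (D.r + 1)} (h : D.form i ∣ D.form k) : i = k := by
  classical
  -- Two forms belong to a common coordinate system because `c + 1 ≥ 2`.
  have hc := D.c_pos
  obtain ⟨-, h', -⟩ := isPrime_span_blockForm (D := D) {i, k}
    (Finset.card_le_two.trans (by omega)) {Sum.inl i} (by simp)
  rw [Set.image_singleton, blockForm_inl] at h'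
  have := (h' k (by simp)).1 (Ideal.mem_span_singleton.2 h)
  simpa [eq_comm] using this

theorem prime_X_inr (k : Fin D.m) : Prime (X (Sum.inr k) : D.FormPoly) := X_prime

theorem not_form_dvd_X (i : Fin (D.r + 1)) (k : Fin D.m) :
    ¬ D.form i ∣ X (Sum.inr k) := by
  obtain ⟨-, -, h⟩ := isPrime_span_blockForm (D := D) {i} (by simp) {Sum.inl i} (by simp)
  rw [Set.image_singleton, blockForm_inl] at h
  simpa [Ideal.mem_span_singleton] using h k

theorem not_X_dvd_form (i : Fin (D.r + 1)) (k : Fin D.m) :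
    ¬ X (Sum.inr k) ∣ D.form i := by
  obtain ⟨-, h, -⟩ := isPrime_span_blockForm (D := D) {i} (by simp) {Sum.inr k} (by simp)
  rw [Set.image_singleton, blockForm_inr] at h
  simpa [Ideal.mem_span_singleton] using h i (by simp)

end Forms

end ArrangementData

namespace ArrangementData

/-! ### The deviation of an exponent from being proportional to `l_i` -/

section Twist

variable {𝕜 : Type*} [Field 𝕜] {D : ArrangementData 𝕜}

variable (D) in
/-- The additive map on exponents that measures, in each block, the deviation from being
proportional to `l_i`, with the variable of index `s i` as reference. -/
def deviation (s : ∀ i, Fin (D.size i)) :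
    (D.Var →₀ ℕ) →+ ((Σ i : Fin (D.r + 1), Fin (D.size i)) → ℤ) where
  toFun e := fun p => D.l p.1 (s p.1) * (e (Sum.inl p) : ℤ) -
    D.l p.1 p.2 * (e (Sum.inl ⟨p.1, s p.1⟩) : ℤ)
  map_zero' := by ext; simp
  map_add' e e' := by ext; simp; ring

theorem deviation_apply (s : ∀ i, Fin (D.size i)) (e : D.Var →₀ ℕ) (p) :
    D.deviation s e p = D.l p.1 (s p.1) * (e (Sum.inl p) : ℤ) -
      D.l p.1 p.2 * (e (Sum.inl ⟨p.1, s p.1⟩) : ℤ) := rfl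

/-- Within a block the expanded exponent is proportional to `l_i`. Hence the deviation ignores the
factors that come from `𝕜[Y_p, S_k]`. -/
theorem deviation_expand (s : ∀ i, Fin (D.size i)) (κ : D.BlockVar →₀ ℕ) :
    D.deviation s (expand κ) = 0 := by
  ext p
  simp [deviation_apply]
  ring

/-- Reduced exponents with the same deviation differ by less than `l_{i, s i}` in the entries of
index `s i`. -/
theorem lt_of_deviation_eq {s : ∀ i, Fin (D.size i)} {ρ ρ' : D.Var →₀ ℕ}
    (hρ : IsReducedExponent ρ) (h : D.deviation s ρ = D.deviation s ρ') (i : Fin (D.r + 1)) :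
    ρ (Sum.inl ⟨i, s i⟩) < ρ' (Sum.inl ⟨i, s i⟩) + D.l i (s i) := by
  obtain ⟨j, hj⟩ := hρ.2 i
  have hd := congrFun h ⟨i, j⟩
  simp only [deviation_apply] at hd
  by_contra! hcon
  have hl := D.l_pos i (s i)
  have h1 : (D.l i (s i) : ℤ) * ρ (Sum.inl ⟨i, j⟩) < D.l i (s i) * D.l i j := by
    exact_mod_cast Nat.mul_lt_mul_of_pos_left hj hl
  have h2 : (D.l i j : ℤ) * (ρ' (Sum.inl ⟨i, s i⟩) + D.l i (s i)) ≤
      D.l i j * ρ (Sum.inl ⟨i, s i⟩) := by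
    exact_mod_cast Nat.mul_le_mul_left _ hcon
  have h3 : (0 : ℤ) ≤ D.l i (s i) * ρ' (Sum.inl ⟨i, j⟩) := by positivity
  linarith

theorem eq_of_deviation_eq {s : ∀ i, Fin (D.size i)} {ρ ρ' : D.Var →₀ ℕ}
    (hρ : IsReducedExponent ρ) (hρ' : IsReducedExponent ρ')
    (h : D.deviation s ρ = D.deviation s ρ')
    (hs : ∀ i, ρ (Sum.inl ⟨i, s i⟩) = ρ' (Sum.inl ⟨i, s i⟩)) : ρ = ρ' := by
  ext (p | k)
  · have hd := congrFun h p
    simp only [deviation_apply, hs] at hd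
    have hl := D.l_pos p.1 (s p.1)
    have : (D.l p.1 (s p.1) : ℤ) * ρ (Sum.inl p) = D.l p.1 (s p.1) * ρ' (Sum.inl p) := by linarith
    exact_mod_cast mul_left_cancel₀ (by exact_mod_cast hl.ne') this
  · rw [hρ.1, hρ'.1]

end Twist

/-! ### Classes of products of radicals modulo the fraction field -/

section Radicals

variable {𝕜 : Type*} [Field 𝕜] {D : ArrangementData 𝕜}

/-- Products of radicals of pairwise non-associated primes are in different classes modulo the
fraction field if their exponents are small and different. -/
theorem exponents_eq_of_radical_quotient {B Ω I : Type*} [CommRing B] [IsDomain B]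
    [IsNoetherianRing B] [Field Ω] [Algebra B Ω] [Fintype I]
    (hinj : Function.Injective (algebraMap B Ω)) {f : I → B}
    (h₁ : ∀ i, f i ≠ 0 → Prime (f i)) (h₂ : ∀ i k, f i ≠ 0 → f k ≠ 0 → f i ∣ f k → i = k)
    {d : I → ℕ} (hd : ∀ i, 0 < d i) {θ : I → Ω} (hθ : ∀ i, θ i ^ d i = algebraMap B Ω (f i))
    {u u' : I → ℕ} (hu : ∏ i, θ i ^ u i ≠ 0) (hu' : ∏ i, θ i ^ u' i ≠ 0) {a b : B} (hb : b ≠ 0)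
    (hab : algebraMap B Ω b * ∏ i, θ i ^ u i = algebraMap B Ω a * ∏ i, θ i ^ u' i)
    (hlt : ∀ i, u i < u' i + d i) (hlt' : ∀ i, u' i < u i + d i) : u = u' := by
  classical
  funext i
  by_contra hne
  -- Some `f k` may be zero; then `θ k = 0`, and a nonzero product does not involve `θ k`.
  have hnz (v : I → ℕ) (hv : ∏ i, θ i ^ v i ≠ 0) (k : I) (hk : v k ≠ 0) : f k ≠ 0 := by
    intro h0
    have h1 := hθ k
    rw [h0, map_zero] at h1
    refine Finset.prod_ne_zero_iff.1 hv k (Finset.mem_univ k) ?_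
    rw [eq_zero_of_pow_eq_zero h1, zero_pow hk]
  have hfi : f i ≠ 0 := by
    by_cases h0 : u i = 0
    · exact hnz u' hu' i (by omega)
    · exact hnz u hu i h0
  have ha : a ≠ 0 := by
    rintro rfl
    rw [map_zero, zero_mul] at hab
    exact mul_ne_zero ((map_ne_zero_iff _ hinj).2 hb) hu hab
  -- The `N`-th power clears all radicals at once and moves the equation into `B`, where the
  -- multiplicities of the prime `f i` are compared.
  set N := ∏ k, d k with hN
  choose c hc using fun k => Finset.dvd_prod_of_mem d (Finset.mem_univ k)
  have hN0 : 0 < N := Finset.prod_pos fun k _ => hd k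
  have hpow (v : I → ℕ) : (∏ k, θ k ^ v k) ^ N = algebraMap B Ω (∏ k, f k ^ (v k * c k)) := by
    rw [map_prod, ← Finset.prod_pow]
    refine Finset.prod_congr rfl fun k _ => ?_
    rw [map_pow, ← hθ, ← pow_mul, ← pow_mul, hN, hc k]
    ring_nf
  have hsplit (v : I → ℕ) (hv : ∏ i, θ i ^ v i ≠ 0) : ∃ w, ¬ f i ∣ w ∧
      ∏ k, f k ^ (v k * c k) = f i ^ (v i * c i) * w := by
    refine ⟨∏ k ∈ Finset.univ.erase i, f k ^ (v k * c k), fun hdvd => ?_,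
      (Finset.mul_prod_erase _ _ (Finset.mem_univ i)).symm⟩
    obtain ⟨k, hk, hdk⟩ := (h₁ i hfi).exists_mem_finset_dvd hdvd
    by_cases h0 : v k = 0
    · rw [h0, zero_mul, pow_zero] at hdk
      exact (h₁ i hfi).not_isUnit (isUnit_of_dvd_one hdk)
    · exact (Finset.ne_of_mem_erase hk)
        (h₂ i k hfi (hnz v hv k h0) ((h₁ i hfi).dvd_of_dvd_pow hdk)).symm
  have key := congrArg (· ^ N) hab
  simp only [mul_pow, hpow, ← map_pow, ← map_mul] at key
  have key := hinj key
  obtain ⟨w, hw, hw2⟩ := hsplit u hu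
  obtain ⟨w', hw', hw2'⟩ := hsplit u' hu'
  obtain ⟨a', ha'1, ha'⟩ := (FiniteMultiplicity.of_not_isUnit (h₁ i hfi).not_isUnit ha).exists_eq_pow_mul_and_not_dvd
  obtain ⟨b', hb'1, hb'⟩ := (FiniteMultiplicity.of_not_isUnit (h₁ i hfi).not_isUnit hb).exists_eq_pow_mul_and_not_dvd
  set α := multiplicity (f i) a
  set γ := multiplicity (f i) b
  have hexp := (h₁ i hfi).pow_mul_eq_pow_mul (m := γ * N + u i * c i) (n := α * N + u' i * c i)
    (w := b' ^ N * w) (w' := a' ^ N * w')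
    (fun h => ((h₁ i hfi).dvd_or_dvd h).elim (fun h => hb' ((h₁ i hfi).dvd_of_dvd_pow h)) hw)
    (fun h => ((h₁ i hfi).dvd_or_dvd h).elim (fun h => ha' ((h₁ i hfi).dvd_of_dvd_pow h)) hw')
    (by
      rw [hw2, hw2', ha'1, hb'1] at key
      rw [pow_add, pow_add, pow_mul, pow_mul]
      linear_combination key)
  have hci : 0 < c i := Nat.pos_of_ne_zero fun h0 => by
    have := hc i
    rw [h0, mul_zero] at this
    omega
  rw [hN, hc i, ← mul_assoc, ← mul_assoc, ← add_mul, ← add_mul] at hexp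
  -- What remains is `γ * d i + u i = α * d i + u' i`. As `u i` and `u' i` differ by less than `d
  -- i`, this forces `α = γ` and then `u i = u' i`.
  have hexp := Nat.eq_of_mul_eq_mul_right hci hexp
  have h3 := hlt i
  have h4 := hlt' i
  rcases lt_trichotomy α γ with h | h | h
  · have : α * d i + d i ≤ γ * d i := by
      rw [← Nat.succ_mul]; exact Nat.mul_le_mul_right _ h
    omega
  · rw [h] at hexp
    omega
  · have : γ * d i + d i ≤ α * d i := by
      rw [← Nat.succ_mul]; exact Nat.mul_le_mul_right _ h
    omega

end Radicals

/-! ### Homomorphisms from `R(A, P₀)` to Laurent polynomial rings -/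

section TwistHom

open MvPolynomial

variable {𝕜 Ω : Type*} [Field 𝕜] [Field Ω] [Algebra 𝕜 Ω] {D : ArrangementData 𝕜}

/-- The homomorphism to a Laurent polynomial ring defined by a choice of roots of the values of the
linear forms. -/
noncomputable def polyTwist (s : ∀ i, Fin (D.size i)) (β : D.FormPoly →ₐ[𝕜] Ω)
    (θ : Fin (D.r + 1) → Ω) :
    D.Poly →ₐ[𝕜] AddMonoidAlgebra Ω ((Σ i : Fin (D.r + 1), Fin (D.size i)) → ℤ) :=
  aeval (Sum.elim
    (fun p => AddMonoidAlgebra.single (D.deviation s (Finsupp.single (Sum.inl p) 1))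
      (if p.2 = s p.1 then θ p.1 else 1))
    fun k => AddMonoidAlgebra.single 0 (β (X (Sum.inr k))))

theorem polyTwist_monomial (s : ∀ i, Fin (D.size i)) (β : D.FormPoly →ₐ[𝕜] Ω)
    (θ : Fin (D.r + 1) → Ω) (e : D.Var →₀ ℕ) :
    polyTwist s β θ (MvPolynomial.monomial e 1) = AddMonoidAlgebra.single (D.deviation s e)
      ((∏ i, θ i ^ e (Sum.inl ⟨i, s i⟩)) * ∏ k, β (X (Sum.inr k)) ^ e (Sum.inr k)) := by
  classical
  induction e using Finsupp.induction_linear with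
  | zero =>
    change polyTwist s β θ (C 1) = _
    rw [C_1, map_one]
    simp [AddMonoidAlgebra.one_def]
  | add e e' h h' =>
    rw [show (MvPolynomial.monomial (e + e') (1 : 𝕜)) =
      MvPolynomial.monomial e 1 * MvPolynomial.monomial e' 1 by simp [MvPolynomial.monomial_mul],
      map_mul, h, h', AddMonoidAlgebra.single_mul_single, map_add]
    simp only [Finsupp.add_apply, pow_add, Finset.prod_mul_distrib]
    congr 1
    ring
  | single v n =>
    rw [← mul_one n, ← smul_eq_mul, ← Finsupp.smul_single, map_nsmul,
      show (MvPolynomial.monomial (n • Finsupp.single v 1) (1 : 𝕜)) = X v ^ n by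
        rw [X, MvPolynomial.monomial_pow, one_pow], map_pow, polyTwist, aeval_X]
    rcases v with p | k
    · rw [Sum.elim_inl, AddMonoidAlgebra.single_pow, Finset.prod_eq_single p.1]
      · by_cases hp : p.2 = s p.1
        · obtain ⟨i, j⟩ := p
          simp only at hp
          subst hp
          simp
        · have : (Sum.inl p : D.Var) ≠ Sum.inl ⟨p.1, s p.1⟩ := by
            rintro h
            rw [Sum.inl.injEq, Sigma.ext_iff] at h
            exact hp (eq_of_heq h.2)
          simp [hp, this]
      · intro i _ hi
        have : (Sum.inl p : D.Var) ≠ Sum.inl ⟨i, s i⟩ := by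
          rintro h
          rw [Sum.inl.injEq] at h
          exact hi (congrArg Sigma.fst h).symm
        simp [this]
      · simp
    · have h0 : D.deviation s (Finsupp.single (Sum.inr k) 1) = 0 := by
        ext p
        simp [deviation_apply]
      rw [Sum.elim_inr, AddMonoidAlgebra.single_pow, h0, Finset.prod_eq_single k]
      · simp
      · intro k' _ hk'
        simp [hk'.symm]
      · simp

/-- `T_i^{l_i}` has deviation zero, and only its factor of index `s i` contributes to the
coefficient, namely `θ_i` to the power `l_{i, s i}`. So the twist restricts to `β`, which is why it
respects the relations. -/
theorem polyTwist_blockHom {s : ∀ i, Fin (D.size i)} {β : D.FormPoly →ₐ[𝕜] Ω}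
    {θ : Fin (D.r + 1) → Ω} (hθ : ∀ i, θ i ^ D.l i (s i) = β (D.form i)) (a : D.BlockPoly) :
    polyTwist s β θ (blockHom a) = AddMonoidAlgebra.single 0 (β (formHom a)) := by
  classical
  suffices h : (polyTwist s β θ).comp blockHom =
      (AddMonoidAlgebra.singleZeroAlgHom : Ω →ₐ[𝕜] _).comp (β.comp formHom) from
    DFunLike.congr_fun h a
  refine MvPolynomial.algHom_ext fun v => ?_
  rcases v with i | k
  · rw [AlgHom.comp_apply, X, blockHom_monomial, polyTwist_monomial, deviation_expand,
      Finset.prod_eq_single i]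
    · rw [← MvPolynomial.X, AlgHom.comp_apply, AlgHom.comp_apply, formHom_X_inl, ← hθ]
      simp
    · intro k _ hk
      simp [hk.symm]
    · simp
  · simp [polyTwist]

/-- The homomorphism from `R(A, P₀)` to a Laurent polynomial ring defined by a choice of roots of
the values of the linear forms. -/
noncomputable def twist {s : ∀ i, Fin (D.size i)} {β : D.FormPoly →ₐ[𝕜] Ω}
    {θ : Fin (D.r + 1) → Ω} (hθ : ∀ i, θ i ^ D.l i (s i) = β (D.form i)) :
    D.R →ₐ[𝕜] AddMonoidAlgebra Ω ((Σ i : Fin (D.r + 1), Fin (D.size i)) → ℤ) :=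
  Ideal.Quotient.liftₐ _ (polyTwist s β θ) fun F hF => by
    rw [← RingHom.mem_ker]
    refine (Ideal.span_le.2 ?_ : Ideal.span (Set.range D.g) ≤ RingHom.ker (polyTwist s β θ)) hF
    rintro _ ⟨t, rfl⟩
    rw [SetLike.mem_coe, RingHom.mem_ker, ← blockHom_linRel, polyTwist_blockHom hθ, formHom_linRel]
    simp

theorem twist_mono_mul_base {s : ∀ i, Fin (D.size i)} {β : D.FormPoly →ₐ[𝕜] Ω}
    {θ : Fin (D.r + 1) → Ω} (hθ : ∀ i, θ i ^ D.l i (s i) = β (D.form i)) {ρ : D.Var →₀ ℕ}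
    (hρ : IsReducedExponent ρ) (b : D.FormPoly) :
    twist hθ (D.mono ρ * base b) =
      AddMonoidAlgebra.single (D.deviation s ρ) ((∏ i, θ i ^ ρ (Sum.inl ⟨i, s i⟩)) * β b) := by
  have h (F : D.Poly) : twist hθ (D.proj F) = polyTwist s β θ F := rfl
  rw [map_mul, mono, base, AlgHom.comp_apply, AlgHom.comp_apply, h, h, polyTwist_blockHom hθ,
    formHom_formSection, polyTwist_monomial, AddMonoidAlgebra.single_mul_single, add_zero]
  simp [hρ.1]

theorem coeff_twist {s : ∀ i, Fin (D.size i)} {β : D.FormPoly →ₐ[𝕜] Ω}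
    {θ : Fin (D.r + 1) → Ω} (hθ : ∀ i, θ i ^ D.l i (s i) = β (D.form i)) (f : D.R)
    (u : (Σ i : Fin (D.r + 1), Fin (D.size i)) → ℤ) :
    (twist hθ f).coeff u = ∑ ρ ∈ (coords f).support,
      if D.deviation s ρ = u then (∏ i, θ i ^ ρ (Sum.inl ⟨i, s i⟩)) * β (coords f ρ) else 0 := by
  conv_lhs => rw [← sum_coords f, Finsupp.sum, map_sum]
  rw [AddMonoidAlgebra.coeff_sum, Finsupp.finsetSum_apply]
  refine Finset.sum_congr rfl fun ρ hρ => ?_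
  rw [twist_mono_mul_base hθ
    (isReducedExponent_of_coords_ne_zero (Finsupp.mem_support_iff.1 hρ)),
    AddMonoidAlgebra.coeff_single, Finsupp.single_apply]

end TwistHom

/-! ### Prime ideals obtained by specialization -/

section Kernel

variable {𝕜 : Type*} [Field 𝕜] [IsAlgClosed 𝕜] [CharZero 𝕜] {D : ArrangementData 𝕜}

/-- Specializing the coefficients of `R(A, P₀)` over `𝕜[Y_p, S_k]` in such a way that the linear
forms become zero or pairwise non-associated primes defines a prime ideal of `R(A, P₀)`. -/
theorem exists_isPrime_of_algHom {B : Type*} [CommRing B] [IsDomain B] [IsNoetherianRing B]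
    [Algebra 𝕜 B] (β : D.FormPoly →ₐ[𝕜] B) (s : ∀ i, Fin (D.size i))
    (h₁ : ∀ i, β (D.form i) ≠ 0 → Prime (β (D.form i)))
    (h₂ : ∀ i k, β (D.form i) ≠ 0 → β (D.form k) ≠ 0 → β (D.form i) ∣ β (D.form k) → i = k) :
    ∃ P : Ideal D.R, P.IsPrime ∧ ∀ f, f ∈ P ↔
      ∀ ρ, (∃ i, β (D.form i) = 0 ∧ ρ (Sum.inl ⟨i, s i⟩) ≠ 0) ∨ β (coords f ρ) = 0 := by
  classical
  let L := FractionRing B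
  let Ω := AlgebraicClosure L
  have : CharZero L := charZero_of_injective_algebraMap (algebraMap 𝕜 L).injective
  have hinj : Function.Injective (algebraMap B Ω) := by
    rw [IsScalarTower.algebraMap_eq B L Ω]
    exact (algebraMap L Ω).injective.comp (IsFractionRing.injective B L)
  let βΩ : D.FormPoly →ₐ[𝕜] Ω := (IsScalarTower.toAlgHom 𝕜 B Ω).comp β
  have hβΩ (b : D.FormPoly) : βΩ b = algebraMap B Ω (β b) := rfl
  choose θ hθ using fun i => IsAlgClosed.exists_pow_nat_eq (βΩ (D.form i)) (D.l_pos i (s i))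
  have hθ0 (i) : θ i = 0 ↔ β (D.form i) = 0 := by
    rw [← map_eq_zero_iff _ hinj, ← hβΩ, ← hθ, pow_eq_zero_iff (D.l_pos i (s i)).ne']
  have hprod (ρ : D.Var →₀ ℕ) : ∏ i, θ i ^ ρ (Sum.inl ⟨i, s i⟩) = 0 ↔
      ∃ i, β (D.form i) = 0 ∧ ρ (Sum.inl ⟨i, s i⟩) ≠ 0 := by
    rw [Finset.prod_eq_zero_iff]
    refine exists_congr fun i => ?_
    rw [pow_eq_zero_iff', hθ0]
    simp
  -- The kernel is prime because Laurent polynomials over a field form a domain. The rest of the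
  -- proof shows that no cancellation occurs between different reduced exponents.
  refine ⟨RingHom.ker (twist hθ), RingHom.ker_isPrime _, fun f => ?_⟩
  simp_rw [← hprod, ← map_eq_zero_iff _ hinj, ← hβΩ, ← mul_eq_zero]
  rw [RingHom.mem_ker]
  constructor
  · intro hf ρ₀
    by_contra hne
    have hmem : ρ₀ ∈ (coords f).support := by
      rw [Finsupp.mem_support_iff]
      rintro h0
      rw [h0, map_zero, mul_zero] at hne
      exact hne rfl
    -- These are the terms that contribute to the same Laurent monomial as `ρ₀` and whose product of
    -- roots does not vanish.
    let T := (coords f).support.filter fun ρ =>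
      D.deviation s ρ = D.deviation s ρ₀ ∧ ∏ i, θ i ^ ρ (Sum.inl ⟨i, s i⟩) ≠ 0
    have hT₀ : ρ₀ ∈ T := Finset.mem_filter.2 ⟨hmem, rfl, left_ne_zero_of_mul hne⟩
    have hred (ρ : T) : IsReducedExponent ρ.1 := isReducedExponent_of_coords_ne_zero
      (Finsupp.mem_support_iff.1 (Finset.mem_filter.1 ρ.2).1)
    have hdev (ρ : T) : D.deviation s ρ.1 = D.deviation s ρ₀ := (Finset.mem_filter.1 ρ.2).2.1
    have hnz (ρ : T) : ∏ i, θ i ^ ρ.1 (Sum.inl ⟨i, s i⟩) ≠ 0 := (Finset.mem_filter.1 ρ.2).2.2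
    have hsum := coeff_twist hθ f (D.deviation s ρ₀)
    rw [hf, AddMonoidAlgebra.coeff_zero, Finsupp.zero_apply, ← Finset.sum_filter] at hsum
    have hsum' : ∑ ρ ∈ T, (∏ i, θ i ^ ρ (Sum.inl ⟨i, s i⟩)) * βΩ (coords f ρ) = 0 := by
      rw [hsum]
      refine Finset.sum_subset ?_ ?_
      · exact Finset.monotone_filter_right _ fun ρ _ h => h.1
      · intro ρ hρ hρT
        rw [Finset.mem_filter] at hρ
        by_contra hne'
        exact hρT (Finset.mem_filter.2 ⟨hρ.1, hρ.2, left_ne_zero_of_mul hne'⟩)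
    rw [← Finset.sum_coe_sort] at hsum'
    have hzero := eq_zero_of_sum_radicals_eq_zero (𝕜 := 𝕜) (K := L) (Ω := Ω)
      (z := fun ρ : T => ∏ i, θ i ^ ρ.1 (Sum.inl ⟨i, s i⟩)) hnz
      (N := ∏ i, D.l i (s i)) (Finset.prod_pos fun i _ => D.l_pos i (s i)).ne' ?_ ?_
      (a := fun ρ => algebraMap B L (β (coords f ρ.1))) ?_ ⟨ρ₀, hT₀⟩
    · rw [map_eq_zero_iff _ (IsFractionRing.injective B L)] at hzero
      rw [hβΩ, hzero, map_zero, mul_zero] at hne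
      exact hne rfl
    · intro ρ
      rw [← Finset.prod_pow]
      refine Subring.prod_mem _ fun i _ => ?_
      obtain ⟨d, hd⟩ := Finset.dvd_prod_of_mem (fun i => D.l i (s i)) (Finset.mem_univ i)
      rw [hd, ← pow_mul, mul_left_comm, pow_mul, hθ]
      exact Subring.pow_mem _ (RingHom.mem_range.2 ⟨algebraMap B L (β (D.form i)), rfl⟩) _
    -- If two products of roots agree modulo `L`, comparing multiplicities identifies the exponents
    -- at the reference indices. Together with the equal deviations these determine the reduced
    -- exponent.
    · rintro ρ ρ' ⟨y, hy⟩
      obtain ⟨a, b, hb, rfl⟩ := IsFractionRing.div_surjective (A := B) y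
      have hb := nonZeroDivisors.ne_zero hb
      rw [map_div₀, ← IsScalarTower.algebraMap_apply, ← IsScalarTower.algebraMap_apply,
        div_eq_div_iff ((map_ne_zero_iff _ hinj).2 hb) (hnz ρ')] at hy
      refine Subtype.ext (eq_of_deviation_eq (hred ρ) (hred ρ') ((hdev ρ).trans (hdev ρ').symm) ?_)
      refine congrFun (exponents_eq_of_radical_quotient hinj h₁ h₂ (fun i => D.l_pos i (s i)) hθ
        (u := fun i => ρ.1 (Sum.inl ⟨i, s i⟩)) (u' := fun i => ρ'.1 (Sum.inl ⟨i, s i⟩))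
        (hnz ρ) (hnz ρ') hb (by rw [hy, mul_comm]) ?_ ?_)
      · exact lt_of_deviation_eq (hred ρ) ((hdev ρ).trans (hdev ρ').symm)
      · exact lt_of_deviation_eq (hred ρ') ((hdev ρ').trans (hdev ρ).symm)
    · rw [← hsum']
      refine Finset.sum_congr rfl fun ρ _ => ?_
      rw [hβΩ, mul_comm, ← IsScalarTower.algebraMap_apply]
  · intro hf
    refine AddMonoidAlgebra.ext (Finsupp.ext fun u => ?_)
    rw [coeff_twist]
    simp [hf]

end Kernel

end ArrangementData

section PrimeQuotient

theorem Ideal.Quotient.prime_mk_of_isPrime_span_pair {A : Type*} [CommRing A] {x y : A}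
    (h : (Ideal.span {x, y}).IsPrime) (hy : Ideal.Quotient.mk (Ideal.span {x}) y ≠ 0) :
    Prime (Ideal.Quotient.mk (Ideal.span {x}) y) := by
  rw [← Ideal.span_singleton_prime hy]
  have h' := Ideal.isPrime_map_quotientMk_of_isPrime (I := Ideal.span {x}) (p := Ideal.span {x, y})
    (Ideal.span_mono (by simp))
  rw [Ideal.map_span, Set.image_pair, (Ideal.Quotient.eq_zero_iff_mem (I := Ideal.span {x})).2
    (Ideal.mem_span_singleton_self x), Ideal.span_insert_zero] at h'
  exact h'

theorem Ideal.Quotient.mem_span_pair_of_mk_dvd_mk {A : Type*} [CommRing A] {x y z : A}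
    (h : Ideal.Quotient.mk (Ideal.span {x}) y ∣ Ideal.Quotient.mk (Ideal.span {x}) z) :
    z ∈ Ideal.span {x, y} := by
  obtain ⟨c, hc⟩ := h
  obtain ⟨c, rfl⟩ := Ideal.Quotient.mk_surjective c
  rw [← map_mul, Ideal.Quotient.eq, Ideal.mem_span_singleton] at hc
  obtain ⟨d, hd⟩ := hc
  rw [Ideal.mem_span_pair]
  exact ⟨d, c, by linear_combination -hd⟩

end PrimeQuotient

namespace ArrangementData

/-! ### Divisibility in `R(A, P₀)` by means of coordinates -/

section Divisibility

open MvPolynomial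

variable {𝕜 : Type*} [Field 𝕜] {D : ArrangementData 𝕜}

theorem base_dvd_iff (b : D.FormPoly) (f : D.R) : base b ∣ f ↔ ∀ ρ, b ∣ coords f ρ := by
  constructor
  · rintro ⟨g, rfl⟩ ρ
    rw [coords_base_mul]
    exact dvd_mul_right _ _
  · intro h
    rw [← sum_coords f]
    refine Finset.dvd_sum fun ρ _ => Dvd.dvd.mul_left (map_dvd _ (h ρ)) _

theorem base_dvd_mono_mul_base_iff {ρ : D.Var →₀ ℕ} (hρ : IsReducedExponent ρ)
    (q b : D.FormPoly) : base q ∣ D.mono ρ * base b ↔ q ∣ b := by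
  classical
  rw [base_dvd_iff, coords_mono_mul_base hρ]
  refine ⟨fun h => by simpa using h ρ, fun h σ => ?_⟩
  rw [Finsupp.single_apply]
  split_ifs
  · exact h
  · exact dvd_zero _

theorem x_dvd_mono {e : D.Var →₀ ℕ} {v : D.Var} (h : e v ≠ 0) : D.x v ∣ D.mono e := by
  classical
  rw [← mono_single, ← Finsupp.sub_add_single_one_cancel h, mono_add]
  exact dvd_mul_left _ _

theorem base_form_eq_mono (i : Fin (D.r + 1)) :
    base (D.form i) = D.mono (expand (Finsupp.single (Sum.inl i) 1)) := by
  rw [← base_formMono]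
  congr 1
  exact (formHom_X_inl i).symm

theorem x_dvd_base_form (i : Fin (D.r + 1)) (j : Fin (D.size i)) :
    D.x (Sum.inl ⟨i, j⟩) ∣ base (D.form i) := by
  rw [base_form_eq_mono]
  refine x_dvd_mono ?_
  simpa using (D.l_pos i j).ne'

theorem form_dvd_formMono {κ : D.BlockVar →₀ ℕ} {i : Fin (D.r + 1)} (h : κ (Sum.inl i) ≠ 0) :
    D.form i ∣ D.formMono κ := by
  rw [formMono_eq]
  exact Dvd.dvd.mul_right (dvd_trans (dvd_pow_self (D.form i) h)
    (Finset.dvd_prod_of_mem (fun i => D.form i ^ κ (Sum.inl i)) (Finset.mem_univ i))) _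

theorem dvd_formMono {κ : D.BlockVar →₀ ℕ} {q : D.FormPoly} (hq : Prime q)
    (h : q ∣ D.formMono κ) :
    (∃ i, κ (Sum.inl i) ≠ 0 ∧ q ∣ D.form i) ∨ ∃ k, κ (Sum.inr k) ≠ 0 ∧ q ∣ X (Sum.inr k) := by
  rw [formMono_eq] at h
  have key {a : D.FormPoly} {n : ℕ} (h : q ∣ a ^ n) : n ≠ 0 ∧ q ∣ a := by
    refine ⟨?_, hq.dvd_of_dvd_pow h⟩
    rintro rfl
    exact hq.not_isUnit (isUnit_of_dvd_one (by simpa using h))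
  rcases hq.dvd_or_dvd h with h | h
  · obtain ⟨i, -, hi⟩ := hq.exists_mem_finset_dvd h
    exact Or.inl ⟨i, key hi⟩
  · obtain ⟨k, -, hk⟩ := hq.exists_mem_finset_dvd h
    exact Or.inr ⟨k, key hk⟩

/-- In a multiple of `T_{ij}`, a term whose residue does not involve `T_{ij}` has lost it by
splitting off `T_i^{l_i}`, so its coefficient is divisible by the form. Conversely `T_{ij}` divides
`T_i^{l_i}`, the image of the form. -/
theorem x_inl_dvd_iff (i : Fin (D.r + 1)) (j : Fin (D.size i)) (f : D.R) :
    D.x (Sum.inl ⟨i, j⟩) ∣ f ↔ ∀ ρ, ρ (Sum.inl ⟨i, j⟩) ≠ 0 ∨ D.form i ∣ coords f ρ := by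
  classical
  constructor
  · rintro ⟨g, rfl⟩ ρ
    by_cases h0 : ρ (Sum.inl ⟨i, j⟩) = 0
    · right
      rw [← sum_coords g, Finsupp.sum, Finset.mul_sum, map_sum, Finsupp.finsetSum_apply]
      refine Finset.dvd_sum fun σ _ => ?_
      rw [← mono_single, ← mul_assoc, ← mono_add, coords_mono_mul_base', Finsupp.single_apply]
      split_ifs with h
      · refine (form_dvd_formMono ?_).mul_right _
        rw [← h, residue_inl] at h0
        intro h1
        rw [blockPart_inl] at h1
        simp [h1] at h0
      · exact dvd_zero _
    · exact Or.inl h0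
  · intro h
    rw [← sum_coords f]
    refine Finset.dvd_sum fun ρ _ => ?_
    rcases h ρ with h | h
    · exact (x_dvd_mono h).mul_right _
    · exact ((x_dvd_base_form i j).trans (map_dvd _ h)).mul_left _

theorem x_inl_dvd_mono_mul_base_iff (i : Fin (D.r + 1)) (j : Fin (D.size i)) {ρ : D.Var →₀ ℕ}
    (hρ : IsReducedExponent ρ) (b : D.FormPoly) :
    D.x (Sum.inl ⟨i, j⟩) ∣ D.mono ρ * base b ↔ ρ (Sum.inl ⟨i, j⟩) ≠ 0 ∨ D.form i ∣ b := by
  classical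
  rw [x_inl_dvd_iff, coords_mono_mul_base hρ]
  refine ⟨fun h => by simpa using h ρ, fun h σ => ?_⟩
  rw [Finsupp.single_apply]
  split_ifs with hσ
  · rwa [← hσ]
  · exact Or.inr (dvd_zero _)

theorem mono_mul_base_ne_zero {ρ : D.Var →₀ ℕ} (hρ : IsReducedExponent ρ) {b : D.FormPoly}
    (hb : b ≠ 0) : D.mono ρ * base b ≠ 0 := by
  intro h
  have := coords_mono_mul_base hρ b
  rw [h, map_zero, eq_comm, Finsupp.single_eq_zero] at this
  exact hb this

theorem mono_ne_zero (e : D.Var →₀ ℕ) : D.mono e ≠ 0 := by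
  rw [mono_eq]
  refine mono_mul_base_ne_zero (isReducedExponent_residue e) ?_
  rw [formMono_eq]
  exact mul_ne_zero (Finset.prod_ne_zero_iff.2 fun i _ => pow_ne_zero _ (form_ne_zero i))
    (Finset.prod_ne_zero_iff.2 fun k _ => pow_ne_zero _ (X_ne_zero _))

theorem x_ne_zero (v : D.Var) : D.x v ≠ 0 := mono_ne_zero (Finsupp.single v 1)

theorem x_dvd_x {v v' : D.Var} (h : D.x v ∣ D.x v') : v = v' := by
  classical
  rcases v' with ⟨i', j'⟩ | k'
  · rw [← mono_single (Sum.inl ⟨i', j'⟩), mono_eq] at h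
    have hres (v : D.Var) (hv : v ≠ Sum.inl ⟨i', j'⟩) :
        residue (Finsupp.single (Sum.inl ⟨i', j'⟩) 1) v = 0 := by
      rcases v with p | k
      · simp [hv.symm]
      · rfl
    have hblock (i) (h : blockPart (Finsupp.single (Sum.inl ⟨i', j'⟩) 1 : D.Var →₀ ℕ)
        -- A single variable can be a multiple of `T_i^{l_i}` only if it is the sole variable of its
        -- block. Then it is not reduced, and divisibility has to be tested on the forms.
        (Sum.inl i) ≠ 0) : i = i' ∧ ∀ j : Fin (D.size i), (⟨i, j⟩ : Σ i, Fin (D.size i)) = ⟨i', j'⟩ := by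
      have h1 (j) : (Finsupp.single (Sum.inl ⟨i', j'⟩) 1 : D.Var →₀ ℕ) (Sum.inl ⟨i, j⟩) ≠ 0 := by
        have h2 := quot_mul_le (Finsupp.single (Sum.inl ⟨i', j'⟩) 1 : D.Var →₀ ℕ) i j
        have h3 := Nat.mul_pos (Nat.pos_of_ne_zero h) (D.l_pos i j)
        rw [blockPart_inl] at h3
        omega
      have h4 (j : Fin (D.size i)) : (⟨i, j⟩ : Σ i, Fin (D.size i)) = ⟨i', j'⟩ := by
        by_contra hne
        exact h1 j (Finsupp.single_eq_of_ne (by simpa using hne))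
      exact ⟨congrArg Sigma.fst (h4 ⟨0, D.size_pos i⟩), h4⟩
    rcases v with ⟨i, j⟩ | k
    · rw [x_inl_dvd_mono_mul_base_iff _ _ (isReducedExponent_residue _)] at h
      rcases h with h | h
      · by_contra hne
        exact h (hres _ hne)
      · rcases dvd_formMono (prime_form i) h with ⟨i'', h1, h2⟩ | ⟨k, -, h2⟩
        · obtain rfl := form_dvd_form h2
          rw [(hblock _ h1).2 j]
        · exact absurd h2 (not_form_dvd_X _ _)
    · rw [← base_X_inr, base_dvd_mono_mul_base_iff (isReducedExponent_residue _)] at h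
      rcases dvd_formMono (prime_X_inr k) h with ⟨i'', -, h2⟩ | ⟨k', h1, -⟩
      · exact absurd h2 (not_X_dvd_form _ _)
      · simp at h1
  · rw [← base_X_inr, ← one_mul (base _), ← mono_zero] at h
    rcases v with ⟨i, j⟩ | k
    · rw [x_inl_dvd_mono_mul_base_iff _ _ isReducedExponent_zero] at h
      rcases h with h | h
      · exact absurd rfl h
      · exact absurd h (not_form_dvd_X _ _)
    · rw [← base_X_inr, base_dvd_mono_mul_base_iff isReducedExponent_zero, X_dvd_X] at h
      simpa using h

theorem not_isUnit_x (v : D.Var) : ¬ IsUnit (D.x v) := by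
  intro h
  have h1 : D.x v ∣ D.mono 0 * base 1 := by simpa using h.dvd
  rcases v with ⟨i, j⟩ | k
  · rw [x_inl_dvd_mono_mul_base_iff _ _ isReducedExponent_zero] at h1
    exact h1.elim (fun h => h rfl) fun h => (prime_form i).not_isUnit (isUnit_of_dvd_one h)
  · rw [← base_X_inr, base_dvd_mono_mul_base_iff isReducedExponent_zero] at h1
    exact (prime_X_inr k).not_isUnit (isUnit_of_dvd_one h1)

theorem prime_of_forall_dvd_iff_mem {y : D.R} (hy : y ≠ 0) {P : Ideal D.R} (hP : P.IsPrime)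
    (h : ∀ f, y ∣ f ↔ f ∈ P) : Prime y := by
  have hspan : Ideal.span {y} = P := Ideal.ext fun f => by rw [Ideal.mem_span_singleton, h]
  rwa [← Ideal.span_singleton_prime hy, hspan]

end Divisibility

/-! ### Integrality of `R(A, P₀)` and primality of the variables -/

section Primes

open MvPolynomial

variable {𝕜 : Type*} [Field 𝕜] [IsAlgClosed 𝕜] [CharZero 𝕜] {D : ArrangementData 𝕜}

/-- Under the identity specialization no form vanishes, so the prime ideal consists of the elements
with zero coordinates. -/
instance isDomain_R : IsDomain D.R := by
  obtain ⟨P, hP, h⟩ := exists_isPrime_of_algHom (AlgHom.id 𝕜 D.FormPoly)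
    (fun i => ⟨0, D.size_pos i⟩) (fun i _ => prime_form i) fun i k _ _ => form_dvd_form
  have hbot : P = ⊥ := by
    refine (Submodule.eq_bot_iff P).2 fun f hf => coords_injective ?_
    rw [map_zero]
    ext1 ρ
    exact ((h f).1 hf ρ).resolve_left fun ⟨i, hi, _⟩ => form_ne_zero i hi
  subst hbot
  exact IsDomain.of_bot_isPrime _

/-- Specialization to the quotient by `y`, with the conditions on the remaining forms written as
conditions on ideals with two generators. -/
theorem exists_isPrime_of_span_singleton {y : D.FormPoly} (hy : (Ideal.span {y}).IsPrime)
    (s : ∀ i, Fin (D.size i)) (h₁ : ∀ i, ¬ y ∣ D.form i → (Ideal.span {y, D.form i}).IsPrime)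
    (h₂ : ∀ i k, ¬ y ∣ D.form i → ¬ y ∣ D.form k →
      D.form k ∈ Ideal.span {y, D.form i} → i = k) :
    ∃ P : Ideal D.R, P.IsPrime ∧ ∀ f, f ∈ P ↔
      ∀ ρ, (∃ i, y ∣ D.form i ∧ ρ (Sum.inl ⟨i, s i⟩) ≠ 0) ∨ y ∣ coords f ρ := by
  have hzero (b : D.FormPoly) : Ideal.Quotient.mkₐ 𝕜 (Ideal.span {y}) b = 0 ↔ y ∣ b := by
    rw [Ideal.Quotient.mkₐ_eq_mk, Ideal.Quotient.eq_zero_iff_mem, Ideal.mem_span_singleton]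
  have := exists_isPrime_of_algHom (Ideal.Quotient.mkₐ 𝕜 (Ideal.span {y})) s
    (fun i hi => Ideal.Quotient.prime_mk_of_isPrime_span_pair
      (h₁ i fun h => hi ((hzero _).2 h)) hi)
    (fun i k hi hk h => h₂ i k (fun h => hi ((hzero _).2 h)) (fun h => hk ((hzero _).2 h))
      (Ideal.Quotient.mem_span_pair_of_mk_dvd_mk h))
  simpa only [hzero] using this

theorem prime_x_inr (k : Fin D.m) : Prime (D.x (Sum.inr k)) := by
  classical
  have hc := D.c_pos
  obtain ⟨P, hP, h⟩ := exists_isPrime_of_span_singleton (y := (X (Sum.inr k) : D.FormPoly))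
    ((Ideal.span_singleton_prime (X_ne_zero _)).2 (prime_X_inr k)) (fun i => ⟨0, D.size_pos i⟩)
    (fun i _ => by
      have := (isPrime_span_blockForm (D := D) {i} (by simp) {Sum.inr k, Sum.inl i} (by simp)).1
      rwa [Set.image_pair, blockForm_inl, blockForm_inr] at this)
    (fun i i' _ _ hmem => by
      have := (isPrime_span_blockForm (D := D) {i, i'} (Finset.card_le_two.trans (by omega))
        {Sum.inr k, Sum.inl i} (by simp)).2.1 i' (by simp)
      rw [Set.image_pair, blockForm_inl, blockForm_inr] at this
      simpa [eq_comm] using this.1 hmem)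
  refine prime_of_forall_dvd_iff_mem (x_ne_zero _) hP fun f => ?_
  rw [← base_X_inr, base_dvd_iff, h]
  simp [not_X_dvd_form]

/-- Modulo the form of index `i` the other forms must remain pairwise non-associated, which uses the
independence of three forms and hence `c + 1 ≥ 3`. For `c = 1` the other forms all become
associated. -/
theorem prime_x_inl (hc : 2 ≤ D.c) (i : Fin (D.r + 1)) (j : Fin (D.size i)) :
    Prime (D.x (Sum.inl ⟨i, j⟩)) := by
  classical
  have hdvd (i') : D.form i ∣ D.form i' ↔ i = i' := ⟨form_dvd_form, fun h => h ▸ dvd_rfl⟩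
  obtain ⟨P, hP, h⟩ := exists_isPrime_of_span_singleton (y := D.form i)
    ((Ideal.span_singleton_prime (form_ne_zero i)).2 (prime_form i))
    -- With reference index `j` in block `i`, the prime ideal is described by the condition that
    -- characterizes divisibility by `T_{ij}`.
    (Function.update (fun i => ⟨0, D.size_pos i⟩) i j)
    (fun i' _ => by
      have := (isPrime_span_blockForm (D := D) {i, i'} (Finset.card_le_two.trans (by omega))
        {Sum.inl i, Sum.inl i'} (by simp)).1
      rwa [Set.image_pair, blockForm_inl, blockForm_inl] at this)
    (fun i' k hi' hk hmem => by
      have := (isPrime_span_blockForm (D := D) {i, i', k} (Finset.card_le_three.trans (by omega))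
        {Sum.inl i, Sum.inl i'} (by simp)).2.1 k (by simp)
      rw [Set.image_pair, blockForm_inl, blockForm_inl] at this
      rw [hdvd] at hk
      simpa [eq_comm, hk] using this.1 hmem)
  refine prime_of_forall_dvd_iff_mem (x_ne_zero _) hP fun f => ?_
  rw [x_inl_dvd_iff, h]
  simp [hdvd]

end Primes

end ArrangementData

/-! ### Common denominators for the integral closure -/

section Conductor

open nonZeroDivisors

/-- The integral closure of a finitely generated domain over a field of characteristic zero has a
common denominator. -/
theorem exists_ne_zero_forall_isIntegral_mul_mem {𝕜 R : Type*} [Field 𝕜] [CharZero 𝕜] [CommRing R]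
    [IsDomain R] [Algebra 𝕜 R] [Algebra.FiniteType 𝕜 R] :
    ∃ h : R, h ≠ 0 ∧ ∀ f : FractionRing R, IsIntegral R f →
      ∃ g, algebraMap R (FractionRing R) h * f = algebraMap R (FractionRing R) g := by
  classical
  obtain ⟨n, φ, hinj, hfin⟩ := exists_finite_inj_algHom_of_fg 𝕜 R
  let A := MvPolynomial (Fin n) 𝕜
  let K := FractionRing R
  let _ : Algebra A R := φ.toRingHom.toAlgebra
  have hmap : (algebraMap A R : A → R) = φ := rfl
  have : Module.Finite A R := hfin
  have : FaithfulSMul A R := (faithfulSMul_iff_algebraMap_injective A R).2 hinj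
  let _ : Algebra (FractionRing A) K := FractionRing.liftAlgebra A K
  have : FiniteDimensional (FractionRing A) K := .of_isLocalization A R A⁰
  have : CharZero (FractionRing A) :=
    charZero_of_injective_algebraMap (algebraMap 𝕜 (FractionRing A)).injective
  -- By Noether normalization `R` is finite over a polynomial ring `A`. The extension of fraction
  -- fields is separable in characteristic zero, so the integral closure of `A` is a finite module.
  have hC : Module.Finite A (integralClosure A K) :=
    IsIntegralClosure.finite A (FractionRing A) K (integralClosure A K)
  obtain ⟨s, hs⟩ := hC.fg_top
  obtain ⟨b, hb⟩ := IsLocalization.exist_integer_multiples_of_finset R⁰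
    (s.image (Subtype.val : integralClosure A K → K))
  refine ⟨b, nonZeroDivisors.ne_zero b.2, fun f hf => ?_⟩
  have hfA : IsIntegral A f := isIntegral_trans f hf
  suffices h : ∀ c : integralClosure A K, ∃ g, algebraMap R K b * (c : K) = algebraMap R K g from
    h ⟨f, hfA⟩
  intro c
  have hc : c ∈ Submodule.span A (s : Set (integralClosure A K)) := hs ▸ Submodule.mem_top
  induction hc using Submodule.span_induction with
  | mem c hc =>
    obtain ⟨g, hg⟩ := hb c (Finset.mem_image_of_mem _ hc)
    exact ⟨g, by rw [hg, Algebra.smul_def]⟩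
  | zero => exact ⟨0, by simp⟩
  | add c c' _ _ h h' =>
    obtain ⟨g, hg⟩ := h
    obtain ⟨g', hg'⟩ := h'
    exact ⟨g + g', by rw [map_add, ← hg, ← hg', ← mul_add]; rfl⟩
  | smul a c _ h =>
    obtain ⟨g, hg⟩ := h
    refine ⟨algebraMap A R a * g, ?_⟩
    have hac : ((a • c : integralClosure A K) : K) = algebraMap A K a * c :=
      Algebra.smul_def a (c : K)
    rw [map_mul, ← hg, ← IsScalarTower.algebraMap_apply A R K, hac, mul_left_comm]

end Conductor

/-! ### Characters separate reduced exponents -/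

section TorusCharacters

variable {𝕜 ι : Type*} [Field 𝕜] [CharZero 𝕜] [Fintype ι]

/-- Thus `u - u'` is a rational multiple of `l`. The test point has entries `2 ^ l k` at `j` and `2
^ (- l j)` at `k`; in characteristic zero `2` has infinite multiplicative order. -/
theorem mul_add_mul_eq_of_forall_prod_pow_eq {l u u' : ι → ℕ}
    (h : ∀ t : ι → 𝕜ˣ, ∏ j, t j ^ l j = 1 → ∏ j, t j ^ u j = ∏ j, t j ^ u' j) (j k : ι) :
    u j * l k + u' k * l j = u' j * l k + u k * l j := by
  classical
  by_cases hjk : j = k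
  · subst hjk
    ring
  let z : 𝕜ˣ := Units.mk0 2 two_ne_zero
  let t : ι → 𝕜ˣ := Pi.mulSingle j (z ^ l k) * Pi.mulSingle k (z ^ l j)⁻¹
  have ht (v : ι → ℕ) : ∏ i, t i ^ v i = z ^ (l k * v j) * (z ^ (l j * v k))⁻¹ := by
    simp only [t, Pi.mul_apply, mul_pow, Finset.prod_mul_distrib]
    congr 1
    · rw [Finset.prod_eq_single j (fun i _ hi => by simp [Pi.mulSingle_eq_of_ne hi]) (by simp),
        Pi.mulSingle_eq_same, pow_mul]
    · rw [Finset.prod_eq_single k (fun i _ hi => by simp [Pi.mulSingle_eq_of_ne hi]) (by simp),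
        Pi.mulSingle_eq_same, pow_mul, inv_pow]
  have h1 := h t (by rw [ht, mul_comm (l k), mul_inv_cancel])
  rw [ht, ht, mul_inv_eq_iff_eq_mul, mul_assoc, mul_comm (z ^ (l j * u' k))⁻¹, ← mul_assoc,
    eq_mul_inv_iff_mul_eq, ← pow_add, ← pow_add] at h1
  have h2 : (2 : 𝕜) ^ (l k * u j + l j * u' k) = 2 ^ (l k * u' j + l j * u k) := by
    simpa [z] using congrArg Units.val h1
  have h3 : 2 ^ (l k * u j + l j * u' k) = 2 ^ (l k * u' j + l j * u k) := by exact_mod_cast h2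
  have h4 := Nat.pow_right_injective le_rfl h3
  linarith

/-- By the preceding lemma `u - u' = a l` with `a` rational. For the gcd `d = ∑ x j * l j` and a
primitive `d`-th root of unity `ζ`, the point with entries `ζ ^ x j` shows that `a` is an integer. A
nonzero `a` would make all entries of `u` or all entries of `u'` at least those of `l`. -/
theorem eq_of_forall_prod_pow_eq [IsAlgClosed 𝕜] {l u u' : ι → ℕ} (hl : ∀ j, 0 < l j)
    (hu : ∃ j, u j < l j) (hu' : ∃ j, u' j < l j)
    (h : ∀ t : ι → 𝕜ˣ, ∏ j, t j ^ l j = 1 → ∏ j, t j ^ u j = ∏ j, t j ^ u' j) : u = u' := by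
  obtain ⟨d, hd⟩ := (IsPrincipalIdealRing.principal
    (Ideal.span (Set.range fun j => (l j : ℤ)))).principal
  have hdvd (j) : d ∣ l j := by
    rw [← Ideal.mem_span_singleton, Ideal.span, ← hd]
    exact Ideal.subset_span ⟨j, rfl⟩
  obtain ⟨x, hx⟩ : ∃ x : ι → ℤ, ∑ j, x j * l j = d := by
    rw [← Ideal.mem_span_range_iff_exists_fun, hd]
    exact Submodule.mem_span_singleton_self d
  obtain ⟨j₀, hj₀⟩ := hu
  obtain ⟨j₁, hj₁⟩ := hu'
  have hd0 : d ≠ 0 := by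
    rintro rfl
    have := hl j₀
    have := zero_dvd_iff.1 (hdvd j₀)
    omega
  have : NeZero (d.natAbs : 𝕜) := ⟨by exact_mod_cast Int.natAbs_ne_zero.2 hd0⟩
  have : NeZero d.natAbs := ⟨Int.natAbs_ne_zero.2 hd0⟩
  obtain ⟨ζ', hζ'⟩ := HasEnoughRootsOfUnity.exists_primitiveRoot 𝕜 d.natAbs
  obtain ⟨ζ, rfl⟩ := hζ'.isUnit (NeZero.ne _)
  have hζ := IsPrimitiveRoot.coe_units_iff.1 hζ'
  have hpow (v : ι → ℕ) : ∏ j, (ζ ^ x j) ^ v j = ζ ^ ∑ j, x j * v j := by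
    have hsum (s : Finset ι) : ∏ j ∈ s, (ζ ^ x j) ^ v j = ζ ^ ∑ j ∈ s, x j * v j := by
      induction s using Finset.cons_induction with
      | empty => simp
      | cons a s ha ih =>
        rw [Finset.prod_cons, Finset.sum_cons, zpow_add, ih, zpow_mul, zpow_natCast]
    exact hsum _
  have h1 := h (fun j => ζ ^ x j) (by
    rw [hpow, hx, hζ.zpow_eq_one_iff_dvd, Int.natAbs_dvd])
  rw [hpow, hpow, ← div_eq_one, div_eq_mul_inv, ← zpow_sub, hζ.zpow_eq_one_iff_dvd, Int.natAbs_dvd,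
    ← Finset.sum_sub_distrib] at h1
  have key (k) : (∑ j, (x j * u j - x j * u' j)) * l k = d * (u k - u' k) := by
    rw [← hx, Finset.sum_mul, Finset.sum_mul]
    refine Finset.sum_congr rfl fun j _ => ?_
    have := mul_add_mul_eq_of_forall_prod_pow_eq h j k
    zify at this
    linear_combination x j * this
  obtain ⟨a, ha⟩ := h1
  rw [ha] at key
  have key' (k) : a * l k = u k - u' k := by
    refine mul_left_cancel₀ hd0 ?_
    rw [← key, mul_assoc]
  have ha0 : a = 0 := by
    have h2 := key' j₀
    have h3 := key' j₁
    by_contra hne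
    rcases lt_or_gt_of_ne hne with h4 | h4
    · nlinarith [hl j₁]
    · nlinarith [hl j₀]
  funext k
  have := key' k
  rw [ha0, zero_mul] at this
  omega

end TorusCharacters

namespace ArrangementData

/-! ### The action of the diagonal group on `R(A, P₀)` -/

section TorusAction

open MvPolynomial

variable {𝕜 : Type*} [Field 𝕜] {D : ArrangementData 𝕜}

variable (D) in
/-- The diagonal group that fixes all monomials `T_i^{l_i}`. -/
def torus : Subgroup ((Σ i : Fin (D.r + 1), Fin (D.size i)) → 𝕜ˣ) where
  carrier := {t | ∀ i, ∏ j, t ⟨i, j⟩ ^ D.l i j = 1}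
  one_mem' := fun i => by simp
  mul_mem' := fun {t t'} h h' i => by
    simp only [Pi.mul_apply, mul_pow, Finset.prod_mul_distrib, h i, h' i, mul_one]
  inv_mem' := fun {t} h i => by
    simp only [Pi.inv_apply, inv_pow, Finset.prod_inv_distrib, h i, inv_one]

/-- The character of the diagonal group by which it acts on a monomial. -/
noncomputable def character (e : D.Var →₀ ℕ) : D.torus →* 𝕜 where
  toFun t := ∏ p, ((t.1 p : 𝕜ˣ) : 𝕜) ^ e (Sum.inl p)
  map_one' := by simp
  map_mul' t t' := by simp [mul_pow, Finset.prod_mul_distrib]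

theorem character_apply (e : D.Var →₀ ℕ) (t : D.torus) :
    character e t = ∏ p, ((t.1 p : 𝕜ˣ) : 𝕜) ^ e (Sum.inl p) := rfl

theorem eq_of_character_eq [IsAlgClosed 𝕜] [CharZero 𝕜] {ρ ρ' : D.Var →₀ ℕ}
    (hρ : IsReducedExponent ρ) (hρ' : IsReducedExponent ρ') (h : character ρ = character ρ') :
    ρ = ρ' := by
  classical
  ext (⟨i, j⟩ | k)
  · refine congrFun (eq_of_forall_prod_pow_eq (𝕜 := 𝕜) (l := D.l i)
      (u := fun j => ρ (Sum.inl ⟨i, j⟩)) (u' := fun j => ρ' (Sum.inl ⟨i, j⟩))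
      (D.l_pos i) (hρ.2 i) (hρ'.2 i) fun t ht => ?_) j
    -- Extension of `t` by `1` to the other blocks, so that the blocks can be treated separately.
    let τ : (Σ i : Fin (D.r + 1), Fin (D.size i)) → 𝕜ˣ :=
      fun p => if hp : p.1 = i then t (hp ▸ p.2) else 1
    have hτ (v : (Σ i : Fin (D.r + 1), Fin (D.size i)) → ℕ) (i' : Fin (D.r + 1)) :
        ∏ j, τ ⟨i', j⟩ ^ v ⟨i', j⟩ = if i' = i then ∏ j, t j ^ v ⟨i, j⟩ else 1 := by
      split_ifs with h
      · subst h
        simp [τ]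
      · simp [τ, h]
    have h1 := DFunLike.congr_fun h ⟨τ, fun i' => by
      rw [hτ fun p => D.l p.1 p.2]
      split_ifs
      · exact ht
      · rfl⟩
    simp only [character_apply] at h1
    have h2 : ∏ p, τ p ^ ρ (Sum.inl p) = ∏ p, τ p ^ ρ' (Sum.inl p) := by
      ext
      push_cast
      exact h1
    rw [Fintype.prod_sigma, Fintype.prod_sigma] at h2
    simp only [hτ fun p => ρ (Sum.inl p), hτ fun p => ρ' (Sum.inl p)] at h2
    simpa using h2
  · rw [hρ.1, hρ'.1]

/-- The action of the diagonal group on `𝕜[T_{ij}, S_k]`. -/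
noncomputable def polyScale (t : D.torus) : D.Poly →ₐ[𝕜] D.Poly :=
  aeval (Sum.elim (fun p => C ((t.1 p : 𝕜ˣ) : 𝕜) * X (Sum.inl p)) fun k => X (Sum.inr k))

theorem polyScale_monomial (t : D.torus) (e : D.Var →₀ ℕ) :
    polyScale t (MvPolynomial.monomial e 1) = character e t • MvPolynomial.monomial e 1 := by
  rw [polyScale, aeval_monomial, map_one, one_mul, MvPolynomial.monomial_eq,
    Finsupp.prod_fintype _ _ (by simp), Finsupp.prod_fintype _ _ (by simp),
    Fintype.prod_sum_type, Fintype.prod_sum_type]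
  simp [mul_pow, Finset.prod_mul_distrib, character_apply, MvPolynomial.smul_eq_C_mul, map_prod,
    mul_assoc]

theorem character_expand (t : D.torus) (κ : D.BlockVar →₀ ℕ) : character (expand κ) t = 1 := by
  rw [character_apply, Fintype.prod_sigma]
  refine Finset.prod_eq_one fun i _ => ?_
  have h : ∏ j, ((t.1 ⟨i, j⟩ : 𝕜ˣ) : 𝕜) ^ D.l i j = 1 := by
    have := congrArg Units.val (t.2 i)
    simpa using this
  simp only [expand_inl, mul_comm (κ _), pow_mul, Finset.prod_pow, h, one_pow]

theorem polyScale_blockHom (t : D.torus) (a : D.BlockPoly) :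
    polyScale t (blockHom a) = blockHom a := by
  suffices h : (polyScale t).comp blockHom = blockHom from DFunLike.congr_fun h a
  refine MvPolynomial.algHom_ext fun v => ?_
  rw [AlgHom.comp_apply, X, blockHom_monomial, polyScale_monomial, character_expand, one_smul]

/-- The action of the diagonal group on `R(A, P₀)`. -/
noncomputable def scale (t : D.torus) : D.R →ₐ[𝕜] D.R :=
  Ideal.Quotient.liftₐ _ (D.proj.comp (polyScale t)) fun F hF => by
    rw [← RingHom.mem_ker]
    refine (Ideal.span_le.2 ?_ :
      Ideal.span (Set.range D.g) ≤ RingHom.ker (D.proj.comp (polyScale t))) hF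
    rintro _ ⟨s, rfl⟩
    rw [SetLike.mem_coe, RingHom.mem_ker, ← blockHom_linRel, AlgHom.comp_apply, polyScale_blockHom,
      blockHom_linRel, proj_g]

theorem scale_proj (t : D.torus) (F : D.Poly) : scale t (D.proj F) = D.proj (polyScale t F) := rfl

theorem scale_mono (t : D.torus) (e : D.Var →₀ ℕ) :
    scale t (D.mono e) = character e t • D.mono e := by
  rw [mono, scale_proj, polyScale_monomial, map_smul]

theorem scale_base (t : D.torus) (b : D.FormPoly) : scale t (base b) = base b := by
  rw [base, AlgHom.comp_apply, AlgHom.comp_apply, scale_proj, polyScale_blockHom]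

theorem scale_mono_mul_base (t : D.torus) (e : D.Var →₀ ℕ) (b : D.FormPoly) :
    scale t (D.mono e * base b) = character e t • (D.mono e * base b) := by
  rw [map_mul, scale_mono, scale_base, smul_mul_assoc]

theorem algHom_ext_mono {f f' : D.R →ₐ[𝕜] D.R} (h : ∀ e, f (D.mono e) = f' (D.mono e)) :
    f = f' := by
  refine Ideal.Quotient.algHom_ext _ (MvPolynomial.algHom_ext fun v => ?_)
  exact h (Finsupp.single v 1)

theorem scale_comp_scale (t t' : D.torus) : (scale t).comp (scale t') = scale (t * t') := by
  refine algHom_ext_mono fun e => ?_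
  rw [AlgHom.comp_apply, scale_mono, map_smul, scale_mono, scale_mono, smul_smul, map_mul, mul_comm]

theorem scale_one : scale (1 : D.torus) = AlgHom.id 𝕜 D.R := by
  refine algHom_ext_mono fun e => ?_
  rw [scale_mono, map_one, one_smul, AlgHom.id_apply]

/-- The action of an element of the diagonal group as an automorphism of `R(A, P₀)`. -/
noncomputable def scaleEquiv (t : D.torus) : D.R ≃ₐ[𝕜] D.R :=
  AlgEquiv.ofAlgHom (scale t) (scale t⁻¹)
    (by rw [scale_comp_scale, mul_inv_cancel, scale_one])
    (by rw [scale_comp_scale, inv_mul_cancel, scale_one])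

end TorusAction

end ArrangementData

namespace ArrangementData

/-! ### Normality of `R(A, P₀)` -/

section Normality

open MvPolynomial

variable {𝕜 : Type*} [Field 𝕜] {D : ArrangementData 𝕜}

theorem formMono_add (κ κ' : D.BlockVar →₀ ℕ) :
    D.formMono (κ + κ') = D.formMono κ * D.formMono κ' := by
  rw [formMono, formMono, formMono, ← map_mul, MvPolynomial.monomial_mul, one_mul]

theorem formMono_single_inl (i : Fin (D.r + 1)) (q : ℕ) :
    D.formMono (Finsupp.single (Sum.inl i) q) = D.form i ^ q := by
  rw [formMono, ← formHom_X_inl, ← map_pow, X_pow_eq_monomial]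

theorem formMono_ne_zero (κ : D.BlockVar →₀ ℕ) : D.formMono κ ≠ 0 := by
  rw [formMono_eq]
  exact mul_ne_zero (Finset.prod_ne_zero_iff.2 fun i _ => pow_ne_zero _ (form_ne_zero i))
    (Finset.prod_ne_zero_iff.2 fun k _ => pow_ne_zero _ (X_ne_zero _))

theorem _root_.Prime.pow_dvd_of_pow_dvd_mul_mul_pow {A : Type*} [CommRing A] [IsDomain A]
    {p f b y : A} (hp : Prime p) (hf : Associated p f) (hy : ¬ p ∣ y) {q n N : ℕ}
    (hN : q + n ≤ N) (h : p ^ N ∣ b * (f ^ q * y)) : p ^ n ∣ b := by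
  rw [← mul_assoc] at h
  have h1 : p ^ (q + n) ∣ b * f ^ q := hp.pow_dvd_of_dvd_mul_right _ hy ((pow_dvd_pow p hN).trans h)
  have h2 : p ^ q * p ^ n ∣ p ^ q * b := by
    rw [← pow_add, mul_comm]
    exact h1.trans ((Associated.mul_left b hf.symm.pow_pow).dvd)
  exact (mul_dvd_mul_iff_left (pow_ne_zero q hp.ne_zero)).1 h2

/-- If all powers of a prime divide `b` up to the factors that split off from the powers of a
reduced monomial, then they divide `b`. -/
theorem exists_pow_dvd_of_forall_pow_dvd {ρ : D.Var →₀ ℕ} (hρ : IsReducedExponent ρ)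
    {p b : D.FormPoly} (hp : Prime p)
    (h : ∀ k : ℕ, p ^ k ∣ b * D.formMono (blockPart (k • ρ))) (n : ℕ) : p ^ n ∣ b := by
  classical
  by_cases hex : ∃ i, p ∣ D.form i
  · obtain ⟨i, hi⟩ := hex
    have hass : Associated p (D.form i) := (hp.dvd_prime_iff_associated (prime_form i)).1 hi
    obtain ⟨j, hj⟩ := hρ.2 i
    -- For `k = l_{ij} n` at most `n ρ_{ij} ≤ n (l_{ij} - 1)` factors `ℓ_i` split off from `T^{kρ}`.
    -- At least `n` of the `l_{ij} n` factors `p` are left for `b`.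
    have h1 := h (D.l i j * n)
    set κ := blockPart ((D.l i j * n) • ρ) with hκ
    have hq : κ (Sum.inl i) + n ≤ D.l i j * n := by
      have h2 := quot_mul_le ((D.l i j * n) • ρ) i j
      rw [Finsupp.smul_apply, smul_eq_mul] at h2
      have h3 : κ (Sum.inl i) ≤ n * ρ (Sum.inl ⟨i, j⟩) := by
        refine Nat.le_of_mul_le_mul_right (c := D.l i j) ?_ (D.l_pos i j)
        calc _ ≤ D.l i j * n * ρ (Sum.inl ⟨i, j⟩) := h2
          _ = _ := by ring
      calc _ ≤ n * ρ (Sum.inl ⟨i, j⟩) + n := by omega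
        _ = n * (ρ (Sum.inl ⟨i, j⟩) + 1) := by ring
        _ ≤ n * D.l i j := Nat.mul_le_mul_left _ hj
        _ = _ := mul_comm _ _
    rw [← Finsupp.single_add_erase (Sum.inl i) κ, formMono_add, formMono_single_inl] at h1
    refine hp.pow_dvd_of_pow_dvd_mul_mul_pow hass (fun hdvd => ?_) hq h1
    rcases dvd_formMono hp hdvd with ⟨i', h5, h6⟩ | ⟨k, -, h6⟩
    · obtain rfl := form_dvd_form (hass.symm.dvd.trans h6)
      simp at h5
    · exact not_form_dvd_X _ _ (hass.symm.dvd.trans h6)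
  · refine hp.pow_dvd_of_dvd_mul_right _ (fun hdvd => ?_) (h n)
    rcases dvd_formMono hp hdvd with ⟨i', -, h6⟩ | ⟨k, h5, -⟩
    · exact hex ⟨i', h6⟩
    · simp [hρ.1] at h5

/-- The hypothesis says that `a` is a common denominator for all powers of `T^ρ b / a`. After
cancelling the gcd, a prime factor of the denominator would divide the fixed nonzero element `a` to
every order. -/
theorem dvd_of_forall_pow_dvd {ρ : D.Var →₀ ℕ} (hρ : IsReducedExponent ρ) {a b : D.FormPoly}
    (ha : a ≠ 0) (h : ∀ k : ℕ, a ^ k ∣ a * D.formMono (blockPart (k • ρ)) * b ^ k) : a ∣ b := by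
  obtain ⟨a', b', d, hrel, rfl, rfl⟩ := UniqueFactorizationMonoid.exists_reduced_factors a ha b
  have hd : d ≠ 0 := left_ne_zero_of_mul ha
  by_cases hu : IsUnit a'
  · exact mul_dvd_mul_left _ hu.dvd
  obtain ⟨p, hp, hpa⟩ := WfDvdMonoid.exists_irreducible_factor hu (right_ne_zero_of_mul ha)
  have hp := hp.prime
  have hpb : ¬ p ∣ b' := fun hpb => hp.not_isUnit (hrel hpa hpb)
  refine absurd (exists_pow_dvd_of_forall_pow_dvd hρ hp (b := d * a') (fun k => ?_)) ?_
  · have h1 := h k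
    rw [mul_pow, mul_pow, mul_left_comm, mul_dvd_mul_iff_left (pow_ne_zero _ hd)] at h1
    exact hp.pow_dvd_of_dvd_mul_right _ (fun h => hpb (hp.dvd_of_dvd_pow h))
      ((pow_dvd_pow_of_dvd hpa k).trans h1)
  · have := FiniteMultiplicity.of_not_isUnit hp.not_isUnit ha
    obtain ⟨n, hn⟩ := this
    exact fun h => hn (h (n + 1))

variable [IsAlgClosed 𝕜] [CharZero 𝕜]

/-- `J` is the conductor of the normalization. It contains the whole orbit of `h₀` under the
diagonal group, hence each term of `h₀` by independence of characters. A term `T^ρ b` can be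
multiplied into the image of `𝕜[Y_p, S_k]`. -/
theorem exists_base_mul_mem : ∃ b : D.FormPoly, b ≠ 0 ∧ ∀ f : FractionRing D.R, IsIntegral D.R f →
    ∃ g, algebraMap D.R (FractionRing D.R) (base b) * f = algebraMap D.R (FractionRing D.R) g := by
  classical
  obtain ⟨h₀, hh₀, hmem⟩ := exists_ne_zero_forall_isIntegral_mul_mem (𝕜 := 𝕜) (R := D.R)
  let J : Ideal D.R :=
    { carrier := {h | ∀ f : FractionRing D.R, IsIntegral D.R f →
        ∃ g, algebraMap D.R (FractionRing D.R) h * f = algebraMap D.R (FractionRing D.R) g}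
      zero_mem' := fun f _ => ⟨0, by simp⟩
      add_mem' := fun {h h'} hh hh' f hf => by
        obtain ⟨g, hg⟩ := hh f hf
        obtain ⟨g', hg'⟩ := hh' f hf
        exact ⟨g + g', by rw [map_add, map_add, add_mul, hg, hg']⟩
      smul_mem' := fun c h hh f hf => by
        obtain ⟨g, hg⟩ := hh f hf
        exact ⟨c * g, by rw [smul_eq_mul, map_mul, map_mul, mul_assoc, hg]⟩ }
  have hJ (h : D.R) : h ∈ J ↔ ∀ f : FractionRing D.R, IsIntegral D.R f →
      ∃ g, algebraMap D.R (FractionRing D.R) h * f = algebraMap D.R (FractionRing D.R) g := Iff.rfl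
  have hstable (t : D.torus) : scale t h₀ ∈ J := by
    rw [hJ]
    intro f hf
    let e := IsFractionRing.ringEquivOfRingEquiv (K := FractionRing D.R) (L := FractionRing D.R)
      (scaleEquiv t).toRingEquiv
    have he (a : D.R) : e (algebraMap _ _ a) = algebraMap _ _ (scale t a) :=
      IsFractionRing.ringEquivOfRingEquiv_algebraMap _ _
    have he' (a : D.R) : e.symm (algebraMap _ _ (scale t a)) = algebraMap _ _ a := by
      rw [← he, RingEquiv.symm_apply_apply]
    have hf' : IsIntegral D.R (e.symm f) := by
      refine IsIntegral.map_of_comp_eq ((scaleEquiv t).symm : D.R →+* D.R)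
        (e.symm : FractionRing D.R →+* FractionRing D.R) ?_ hf
      refine RingHom.ext fun a => ?_
      obtain ⟨a, rfl⟩ := (scaleEquiv t).surjective a
      simp only [RingHom.comp_apply, RingHom.coe_coe, AlgEquiv.symm_apply_apply]
      exact (he' a).symm
    obtain ⟨g, hg⟩ := hmem _ hf'
    refine ⟨scale t g, ?_⟩
    rw [← he, ← he, ← hg, map_mul, RingEquiv.apply_symm_apply]
  obtain ⟨ρ, hρ⟩ : ∃ ρ, coords h₀ ρ ≠ 0 := by
    by_contra! h
    exact hh₀ (coords_injective (by ext1 ρ; rw [h, map_zero, Finsupp.zero_apply]))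
  have hred := isReducedExponent_of_coords_ne_zero hρ
  have hmono : D.mono ρ * base (coords h₀ ρ) ∈ J := by
    refine Submodule.mem_of_forall_sum_monoidHom_smul_mem (G := D.torus) (ι := (coords h₀).support)
      (J.restrictScalars 𝕜) (χ := fun σ => character σ.1) ?_
      (v := fun σ => D.mono σ.1 * base (coords h₀ σ.1)) (fun t => ?_)
      ⟨ρ, Finsupp.mem_support_iff.2 hρ⟩
    · intro σ σ' hσ
      exact Subtype.ext (eq_of_character_eq
        (isReducedExponent_of_coords_ne_zero (Finsupp.mem_support_iff.1 σ.2))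
        (isReducedExponent_of_coords_ne_zero (Finsupp.mem_support_iff.1 σ'.2)) hσ)
    · rw [Submodule.restrictScalars_mem]
      convert hstable t
      conv_rhs => rw [← sum_coords h₀, Finsupp.sum, map_sum]
      rw [Finset.sum_coe_sort _ fun σ => character σ t • (D.mono σ * base (coords h₀ σ))]
      exact Finset.sum_congr rfl fun σ _ => (scale_mono_mul_base t σ _).symm
  -- Any `κ` with `κ_i l_{ij} ≥ ρ_{ij}` serves; the sum of the entries of `ρ` over the block is
  -- large enough.
  let κ : D.BlockVar →₀ ℕ :=
    Finsupp.equivFunOnFinite.symm (Sum.elim (fun i => ∑ j, ρ (Sum.inl ⟨i, j⟩)) fun _ => 0)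
  have hle : ρ ≤ expand κ := by
    rintro (⟨i, j⟩ | k)
    · rw [expand_inl]
      have h1 : ρ (Sum.inl ⟨i, j⟩) ≤ κ (Sum.inl i) :=
        Finset.single_le_sum (f := fun j => ρ (Sum.inl ⟨i, j⟩)) (fun _ _ => Nat.zero_le _)
          (Finset.mem_univ j)
      exact h1.trans (Nat.le_mul_of_pos_right _ (D.l_pos i j))
    · rw [hred.1]
      exact Nat.zero_le _
  refine ⟨D.formMono κ * coords h₀ ρ, mul_ne_zero (formMono_ne_zero κ) hρ, (hJ _).1 ?_⟩
  rw [map_mul, base_formMono, ← tsub_add_cancel_of_le hle, mono_add, mul_assoc]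
  exact J.mul_mem_left _ hmono

/-- An integral fraction is `g / a` with `a ∈ 𝕜[Y_p, S_k]`. The diagonal group fixes `a` and
preserves integrality, so every term `T^ρ b / a` of the fraction is integral. So are its powers,
which gives the hypothesis of `dvd_of_forall_pow_dvd`. -/
instance : IsIntegrallyClosed D.R := by
  classical
  rw [isIntegrallyClosed_iff (FractionRing D.R)]
  intro f hf
  obtain ⟨a, ha, hmem⟩ := exists_base_mul_mem (D := D)
  obtain ⟨g, hg⟩ := hmem f hf
  let ι := algebraMap D.R (FractionRing D.R)
  have hι : Function.Injective ι := IsFractionRing.injective D.R (FractionRing D.R)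
  have hab : ι (base a) ≠ 0 := by
    rw [map_ne_zero_iff _ hι, map_ne_zero_iff _ base_injective]
    exact ha
  have hfg : f = ι g / ι (base a) := by
    rw [eq_div_iff hab, mul_comm]
    exact hg
  let y (ρ : D.Var →₀ ℕ) : FractionRing D.R := ι (D.mono ρ * base (coords g ρ)) / ι (base a)
  have hscale (t : D.torus) : IsIntegral D.R (ι (scale t g) / ι (base a)) := by
    let e := IsFractionRing.ringEquivOfRingEquiv (K := FractionRing D.R) (L := FractionRing D.R)
      (scaleEquiv t).toRingEquiv
    have he (a : D.R) : e (ι a) = ι (scale t a) :=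
      IsFractionRing.ringEquivOfRingEquiv_algebraMap _ _
    have h1 : ι (scale t g) / ι (base a) = (e : FractionRing D.R →+* FractionRing D.R) f := by
      rw [hfg, RingHom.coe_coe, map_div₀, he, he, scale_base]
    rw [h1]
    refine IsIntegral.map_of_comp_eq (scale t : D.R →+* D.R) _ ?_ hf
    refine RingHom.ext fun a => ?_
    exact (he a).symm
  have hy (ρ : D.Var →₀ ℕ) (hρ : coords g ρ ≠ 0) : IsIntegral D.R (y ρ) := by
    let W : Submodule 𝕜 (FractionRing D.R) :=
      (Subalgebra.toSubmodule (integralClosure D.R (FractionRing D.R))).restrictScalars 𝕜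
    refine Submodule.mem_of_forall_sum_monoidHom_smul_mem (G := D.torus) (ι := (coords g).support)
      W (χ := fun σ => character σ.1) ?_ (v := fun σ => y σ.1) (fun t => ?_)
      ⟨ρ, Finsupp.mem_support_iff.2 hρ⟩
    · intro σ σ' hσ
      exact Subtype.ext (eq_of_character_eq
        (isReducedExponent_of_coords_ne_zero (Finsupp.mem_support_iff.1 σ.2))
        (isReducedExponent_of_coords_ne_zero (Finsupp.mem_support_iff.1 σ'.2)) hσ)
    · change IsIntegral D.R _
      convert hscale t
      conv_rhs => rw [← sum_coords g, Finsupp.sum, map_sum, map_sum, Finset.sum_div]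
      rw [Finset.sum_coe_sort _ fun σ => character σ t • y σ]
      refine Finset.sum_congr rfl fun σ _ => ?_
      have h1 : ι (character σ t • (D.mono σ * base (coords g σ))) =
          character σ t • ι (D.mono σ * base (coords g σ)) :=
        map_smul (Algebra.linearMap D.R (FractionRing D.R) |>.restrictScalars 𝕜) _ _
      rw [scale_mono_mul_base, h1, smul_div_assoc]
  have hdvd : base a ∣ g := by
    rw [base_dvd_iff]
    intro ρ
    by_cases hρ : coords g ρ = 0
    · rw [hρ]
      exact dvd_zero a
    have hred := isReducedExponent_of_coords_ne_zero hρ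
    refine dvd_of_forall_pow_dvd hred ha fun k => ?_
    obtain ⟨s, hs⟩ := hmem _ ((hy ρ hρ).pow k)
    have h1 : base a * (D.mono ρ * base (coords g ρ)) ^ k = base (a ^ k) * s := by
      apply hι
      change _ * (ι _ / ι _) ^ k = ι s at hs
      rw [div_pow, mul_div_assoc', div_eq_iff (pow_ne_zero k hab)] at hs
      rw [map_mul ι, map_pow ι, map_mul ι (base (a ^ k)), map_pow base, map_pow ι, mul_comm _ (ι s)]
      exact hs
    have h2 : base (a ^ k) ∣ D.mono (k • ρ) * base (a * coords g ρ ^ k) :=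
      ⟨s, by rw [← h1, mono_nsmul, map_mul, map_pow]; ring⟩
    rw [base_dvd_iff] at h2
    have h3 := h2 (residue (k • ρ))
    rw [coords_mono_mul_base', Finsupp.single_eq_same] at h3
    convert h3 using 1
    ring
  obtain ⟨s, rfl⟩ := hdvd
  refine ⟨s, ?_⟩
  rw [hfg, map_mul, mul_div_cancel_left₀ _ hab]

end Normality

end ArrangementData

/-! ### Dimension and regular sequences -/

section KrullDimension

open RingTheory.Sequence

/-- Dividing out a weakly regular sequence of length `n` drops the dimension by at least `n`. -/
theorem Module.supportDim_add_length_le_of_isWeaklyRegular {R : Type*} [CommRing R]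
    [IsNoetherianRing R] (rs : List R) {M : Type*} [AddCommGroup M] [Module R M] [Module.Finite R M]
    (h : IsWeaklyRegular M rs) :
    Module.supportDim R (M ⧸ Ideal.ofList rs • (⊤ : Submodule R M)) + rs.length ≤
      Module.supportDim R M := by
  induction rs generalizing M with
  | nil =>
    rw [Ideal.ofList_nil, Submodule.bot_smul]
    simpa using (Module.supportDim_eq_of_equiv (Submodule.quotEquivOfEqBot ⊥ rfl)).le
  | cons x rs ih =>
    obtain ⟨hx, hrs⟩ := (isWeaklyRegular_cons_iff M _ _).1 h
    rw [Module.supportDim_eq_of_equiv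
      (Submodule.quotOfListConsSMulTopEquivQuotSMulTopInner M x rs), List.length_cons,
      Nat.cast_add, Nat.cast_one, ← add_assoc]
    exact (add_le_add_left (ih hrs) 1).trans
      (Module.supportDim_quotSMulTop_succ_le_of_notMem_minimalPrimes
        fun _ => hx.notMem_of_mem_minimalPrimes)

theorem ringKrullDim_quotient_add_length_le_of_isRegular {R : Type*} [CommRing R]
    [IsNoetherianRing R] {rs : List R} (h : IsRegular R rs) :
    ringKrullDim (R ⧸ Ideal.ofList rs) + rs.length ≤ ringKrullDim R := by
  have heq : Ideal.ofList rs = Ideal.ofList rs • (⊤ : Ideal R) := by simp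
  rw [ringKrullDim_eq_of_ringEquiv (Ideal.quotientEquivAlgOfEq R heq).toRingEquiv,
    ← Module.supportDim_quotient_eq_ringKrullDim, ← Module.supportDim_self_eq_ringKrullDim]
  exact Module.supportDim_add_length_le_of_isWeaklyRegular rs h.toIsWeaklyRegular

/-- The ideal generated by a set of variables has height at least the number of variables. -/
theorem MvPolynomial.card_le_height_span_X_image {σ k : Type*} [Field k] (s : Finset σ) :
    (s.card : ℕ∞) ≤ (Ideal.span (X (R := k) '' (s : Set σ))).height := by
  classical
  induction s using Finset.induction_on with
  | empty => simp
  | insert a s ha ih =>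
    have h := isPrime_span_X_image (𝕜 := k) (s : Set σ)
    have h' := isPrime_span_X_image (𝕜 := k) ((insert a s : Finset σ) : Set σ)
    have := h.1
    have := h'.1
    rw [Finset.card_insert_of_notMem ha, Nat.cast_add, Nat.cast_one]
    refine (add_le_add_left ih 1).trans (Ideal.height_add_one_le_of_lt_of_isPrime
      (lt_of_le_of_ne (Ideal.span_mono (Set.image_mono (by simp))) fun heq => ?_))
    have h1 : (X a : MvPolynomial σ k) ∈ Ideal.span (X '' (s : Set σ)) := by
      rw [heq, h'.2]
      simp
    exact ha ((h.2 a).1 h1)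

end KrullDimension

namespace ArrangementData

/-! ### Complete intersection and dimension -/

section CompleteIntersection

open MvPolynomial

variable {𝕜 : Type*} [Field 𝕜] {D : ArrangementData 𝕜}

/-- The substitution that eliminates the variables belonging to the first `t` relations. -/
noncomputable def eliminate (t : Fin (D.r - D.c)) : D.BlockPoly →ₐ[𝕜] D.BlockPoly :=
  aeval (Sum.elim
    (fun i => if i < D.lastIndex t then ∑ q, C (D.coord i q) * X (Sum.inl (D.firstIndex q))
      else X (Sum.inl i))
    fun k => X (Sum.inr k))

theorem lastIndex_lt_lastIndex_iff {s t : Fin (D.r - D.c)} :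
    D.lastIndex s < D.lastIndex t ↔ s < t := by
  rw [lastIndex, lastIndex, Fin.mk_lt_mk, Nat.add_lt_add_iff_left, Fin.lt_def]

theorem firstIndex_lt_lastIndex (q : Fin (D.c + 1)) (t : Fin (D.r - D.c)) :
    D.firstIndex q < D.lastIndex t := by
  have := q.isLt
  simp only [firstIndex, lastIndex, Fin.lt_def, Fin.val_castLE]
  omega

theorem sum_coord_firstIndex (q : Fin (D.c + 1)) :
    ∑ q', C (D.coord (D.firstIndex q) q') * (X (Sum.inl (D.firstIndex q')) : D.BlockPoly) =
      X (Sum.inl (D.firstIndex q)) := by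
  rw [coord_firstIndex, Finset.sum_eq_single q]
  · simp
  · intro q' _ h
    simp [Pi.single_eq_of_ne h]
  · simp

theorem eliminate_X_firstIndex (t : Fin (D.r - D.c)) (q : Fin (D.c + 1)) :
    eliminate t (X (Sum.inl (D.firstIndex q))) = X (Sum.inl (D.firstIndex q)) := by
  rw [eliminate, aeval_X, Sum.elim_inl, if_pos (firstIndex_lt_lastIndex q t),
    sum_coord_firstIndex]

theorem eliminate_C (t : Fin (D.r - D.c)) (a : 𝕜) : eliminate t (C a) = C a := by
  rw [← algebraMap_eq, AlgHom.commutes]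

theorem eliminate_linRel_of_lt {s t : Fin (D.r - D.c)} (h : s < t) :
    eliminate t (D.linRel s) = 0 := by
  simp only [linRel, map_mul, map_sub, map_sum, eliminate_C, eliminate_X_firstIndex]
  rw [eliminate, aeval_X, Sum.elim_inl, if_pos (lastIndex_lt_lastIndex_iff.2 h), sub_self, mul_zero]

theorem eliminate_linRel_self (t : Fin (D.r - D.c)) : eliminate t (D.linRel t) = D.linRel t := by
  simp only [linRel, map_mul, map_sub, map_sum, eliminate_C, eliminate_X_firstIndex]
  rw [eliminate, aeval_X, Sum.elim_inl, if_neg (lt_irrefl _)]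

theorem linRel_ne_zero (t : Fin (D.r - D.c)) : D.linRel t ≠ 0 := by
  intro h
  have h1 := congrArg (eval (Pi.single (Sum.inl (D.lastIndex t)) 1)) h
  simp only [linRel, map_mul, map_sub, map_sum, eval_C, eval_X, map_zero, Pi.single_eq_same] at h1
  rw [Finset.sum_eq_zero fun q _ => ?_, sub_zero, mul_one] at h1
  · exact D.isUnit_det_firstMatrix.ne_zero h1
  · rw [Pi.single_eq_of_ne fun h => firstIndex_ne_lastIndex q t (Sum.inl.inj h), mul_zero]

theorem sub_eliminate_mem (t : Fin (D.r - D.c)) (a : D.BlockPoly) :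
    a - eliminate t a ∈ Ideal.span (D.linRel '' Set.Iio t) := by
  suffices h : Ideal.Quotient.mkₐ 𝕜 (Ideal.span (D.linRel '' Set.Iio t)) =
      (Ideal.Quotient.mkₐ 𝕜 _).comp (eliminate t) from
    Ideal.Quotient.eq.1 (DFunLike.congr_fun h a)
  refine MvPolynomial.algHom_ext ?_
  rintro (i | k)
  · rw [AlgHom.comp_apply]
    rcases exists_eq_firstIndex_or_lastIndex i with ⟨q, rfl⟩ | ⟨s, rfl⟩
    · rw [eliminate_X_firstIndex]
    · rw [eliminate, aeval_X, Sum.elim_inl]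
      split_ifs with h
      · refine Ideal.Quotient.eq.2 ?_
        have h1 : D.linRel s ∈ Ideal.span (D.linRel '' Set.Iio t) :=
          Ideal.subset_span ⟨s, lastIndex_lt_lastIndex_iff.1 h, rfl⟩
        rw [linRel] at h1
        exact (Ideal.unit_mul_mem_iff_mem _ (D.isUnit_det_firstMatrix.map C)).1 h1
      · rfl
  · rw [AlgHom.comp_apply, eliminate, aeval_X, Sum.elim_inr]

/-- The ideal of the relations before `t` is the kernel of a homomorphism to a domain. As `eliminate
t` fixes `linRel t`, which is nonzero, that relation is a non-zero-divisor modulo the earlier ones.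
-/
theorem mem_span_linRel_iff (t : Fin (D.r - D.c)) (a : D.BlockPoly) :
    a ∈ Ideal.span (D.linRel '' Set.Iio t) ↔ eliminate t a = 0 := by
  constructor
  · intro h
    rw [← RingHom.mem_ker]
    refine (Ideal.span_le.2 ?_ :
      Ideal.span (D.linRel '' Set.Iio t) ≤ RingHom.ker (eliminate t)) h
    rintro _ ⟨s, hs, rfl⟩
    exact eliminate_linRel_of_lt hs
  · intro h
    simpa [h] using sub_eliminate_mem t a

theorem mem_span_linRel_of_linRel_mul_mem {t : Fin (D.r - D.c)} {a : D.BlockPoly}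
    (h : D.linRel t * a ∈ Ideal.span (D.linRel '' Set.Iio t)) :
    a ∈ Ideal.span (D.linRel '' Set.Iio t) := by
  rw [mem_span_linRel_iff, map_mul, eliminate_linRel_self] at h
  exact (mem_span_linRel_iff t a).2 ((mul_eq_zero.1 h).resolve_left (linRel_ne_zero t))

/-- Since the polynomial ring is free over `𝕜[U_i, S_k]`, membership in an extended ideal is tested
on coefficients. This carries regularity from the linear relations to the `g_t`. -/
theorem mem_span_g_image_iff (s : Set (Fin (D.r - D.c))) (F : D.Poly) :
    F ∈ Ideal.span (D.g '' s) ↔ ∀ ρ, coef F ρ ∈ Ideal.span (D.linRel '' s) := by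
  constructor
  · intro hF
    suffices h : ∀ G ρ, coef (G * F) ρ ∈ Ideal.span (D.linRel '' s) by simpa using h 1
    refine Submodule.span_induction
      (p := fun F _ => ∀ G ρ, coef (G * F) ρ ∈ Ideal.span (D.linRel '' s)) ?_ (by simp)
      (fun _ _ _ _ h h' G ρ => ?_) (fun a F _ h G => by rw [smul_eq_mul, ← mul_assoc]; exact h _) hF
    · rintro _ ⟨t, ht, rfl⟩ G ρ
      rw [mul_comm, ← blockHom_linRel, coef_blockHom_mul, Finsupp.smul_apply, smul_eq_mul]
      exact Ideal.mul_mem_right _ _ (Ideal.subset_span ⟨t, ht, rfl⟩)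
    · rw [mul_add, map_add, Finsupp.add_apply]
      exact Ideal.add_mem _ (h G ρ) (h' G ρ)
  · intro h
    rw [← sum_coef F]
    refine Ideal.sum_mem _ fun ρ _ => Ideal.mul_mem_left _ _ ?_
    have h1 := Ideal.mem_map_of_mem (blockHom : D.BlockPoly →ₐ[𝕜] D.Poly) (h ρ)
    rw [Ideal.map_span, ← Set.image_comp] at h1
    simpa only [Function.comp_def, blockHom_linRel] using h1

theorem mem_span_g_of_g_mul_mem {t : Fin (D.r - D.c)} {F : D.Poly}
    (h : D.g t * F ∈ Ideal.span (D.g '' Set.Iio t)) : F ∈ Ideal.span (D.g '' Set.Iio t) := by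
  rw [mem_span_g_image_iff] at h ⊢
  intro ρ
  have h1 := h ρ
  rw [← blockHom_linRel, coef_blockHom_mul, Finsupp.smul_apply, smul_eq_mul] at h1
  exact mem_span_linRel_of_linRel_mul_mem h1

theorem ofList_ofFn_g : Ideal.ofList (List.ofFn D.g) = Ideal.span (Set.range D.g) := by
  rw [Ideal.ofList]
  congr 1
  ext
  simp

theorem isCompleteIntersectionPresentation_g : IsCompleteIntersectionPresentation D.g := by
  have hlen : (List.ofFn D.g).length = D.r - D.c := List.length_ofFn
  refine ⟨⟨fun i hi => ?_⟩, ?_⟩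
  · let t : Fin (D.r - D.c) := ⟨i, hlen ▸ hi⟩
    have hI : Ideal.ofList ((List.ofFn D.g).take i) • (⊤ : Ideal D.Poly) =
        Ideal.span (D.g '' Set.Iio t) := by
      rw [smul_eq_mul, Ideal.mul_top, Ideal.ofList]
      congr 1
      ext F
      simp only [Set.mem_ofPred_eq, List.mem_take_iff_getElem, Set.mem_image, Set.mem_Iio,
        List.getElem_ofFn]
      constructor
      · rintro ⟨j, hj, rfl⟩
        exact ⟨_, Fin.lt_def.2 (lt_of_lt_of_le hj (min_le_left _ _)), rfl⟩
      · rintro ⟨s, hs, rfl⟩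
        exact ⟨s, lt_min (Fin.lt_def.1 hs) (hlen.symm ▸ s.isLt), rfl⟩
    rw [hI, List.getElem_ofFn, isSMulRegular_iff_right_eq_zero_of_smul]
    intro F hF
    obtain ⟨F, rfl⟩ := Submodule.Quotient.mk_surjective _ F
    rw [← Submodule.Quotient.mk_smul, Submodule.Quotient.mk_eq_zero, smul_eq_mul] at hF
    rw [Submodule.Quotient.mk_eq_zero]
    exact mem_span_g_of_g_mul_mem hF
  · rw [smul_eq_mul, Ideal.mul_top, ofList_ofFn_g]
    exact (Ideal.Quotient.nontrivial_iff.1 (inferInstance : Nontrivial D.R)).symm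

theorem card_var : Fintype.card D.Var = D.n + D.m := by
  simp [n]

theorem g_mem_span_X (t : Fin (D.r - D.c)) :
    D.g t ∈ Ideal.span (X (R := 𝕜) '' ((Finset.univ : Finset D.Var) : Set D.Var)) := by
  have hX (v : D.Var) : (X v : D.Poly) ∈
      Ideal.span (X (R := 𝕜) '' ((Finset.univ : Finset D.Var) : Set D.Var)) :=
    Ideal.subset_span ⟨v, by simp, rfl⟩
  have h (i) : D.monomial i ∈
      Ideal.span (X (R := 𝕜) '' ((Finset.univ : Finset D.Var) : Set D.Var)) := by
    rw [monomial, ← Finset.mul_prod_erase _ _ (Finset.mem_univ (⟨0, D.size_pos i⟩ : Fin _))]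
    exact Ideal.mul_mem_right _ _ (Ideal.pow_mem_of_mem _ (hX _) _ (D.l_pos _ _))
  rw [g_eq]
  exact Ideal.mul_mem_left _ _ (Ideal.sub_mem _ (h _)
    (Ideal.sum_mem _ fun q _ => Ideal.mul_mem_left _ _ (h _)))

/-- The regular sequence bounds the dimension from above. All `g_t` lie in the ideal of the origin,
which has height at least `n + m`, and `r - c` elements lower a height by at most `r - c`; this is
the bound from below. -/
theorem ringKrullDim_R : ringKrullDim D.R = ((D.n + D.m - D.r + D.c : ℕ) : WithBot ℕ∞) := by
  -- Every block is nonempty, hence `n ≥ r + 1` and the truncated subtraction in the statement is a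
  -- true one.
  have hr : D.r < D.n := by
    have h : ∑ _i : Fin (D.r + 1), 1 ≤ D.n := Finset.sum_le_sum fun i _ => D.size_pos i
    simpa using h
  have hc := D.c_le_r
  have hdim : ringKrullDim D.Poly = ((D.n + D.m : ℕ) : WithBot ℕ∞) := by
    rw [MvPolynomial.ringKrullDim_of_isNoetherianRing, ringKrullDim_eq_zero_of_field, zero_add,
      Nat.card_eq_fintype_card, card_var]
  have hupper := ringKrullDim_quotient_add_length_le_of_isRegular
    (isCompleteIntersectionPresentation_g (D := D))
  rw [ofList_ofFn_g, List.length_ofFn, hdim] at hupper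
  have hp := (isPrime_span_X_image (𝕜 := 𝕜) ((Finset.univ : Finset D.Var) : Set D.Var)).1
  have hlower := Ideal.height_le_ringKrullDim_quotient_add_encard (Set.range D.g)
    (p := Ideal.span (X (R := 𝕜) '' ((Finset.univ : Finset D.Var) : Set D.Var)))
    (by rintro _ ⟨t, rfl⟩; exact g_mem_span_X t)
  have hheight := card_le_height_span_X_image (k := 𝕜) (Finset.univ : Finset D.Var)
  rw [Finset.card_univ, card_var] at hheight
  have hcard : (Set.range D.g).encard ≤ ((D.r - D.c : ℕ) : ℕ∞) := by
    rw [← Set.image_univ]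
    refine (Set.encard_image_le _ _).trans ?_
    simp
  have hlow : ((D.n + D.m : ℕ) : WithBot ℕ∞) ≤
      ringKrullDim D.R + ((D.r - D.c : ℕ) : WithBot ℕ∞) := by
    refine le_trans ?_ (hlower.trans (add_le_add_right ?_ _))
    · exact_mod_cast hheight
    · exact WithBot.coe_le_coe.2 hcard
  have heq := le_antisymm hupper hlow
  cases hd : ringKrullDim D.R with
  | bot => simp [hd] at hlow
  | coe d =>
    rw [hd] at heq
    have heq' : d + ((D.r - D.c : ℕ) : ℕ∞) = ((D.n + D.m : ℕ) : ℕ∞) := WithBot.coe_injective heq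
    have htop : d ≠ ⊤ := by
      rintro rfl
      rw [top_add] at heq'
      exact ENat.natCast_ne_top _ heq'.symm
    lift d to ℕ using htop
    have h1 : d + (D.r - D.c) = D.n + D.m := by exact_mod_cast heq'
    have h2 : d = D.n + D.m - D.r + D.c := by omega
    rw [h2]
    rfl

end CompleteIntersection

end ArrangementData

namespace ArrangementData

/-! ### Homomorphisms obtained by rescaling the variables -/

section Rescale

open MvPolynomial

variable {𝕜 : Type*} [Field 𝕜] {D : ArrangementData 𝕜} {B : Type*} [CommRing B] [Algebra 𝕜 B]

theorem proj_monomial_eq (i : Fin (D.r + 1)) :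
    D.proj (D.monomial i) = ∏ j, D.x (Sum.inl ⟨i, j⟩) ^ D.l i j := by
  rw [monomial, map_prod]
  simp only [map_pow]
  rfl

theorem aeval_monomial_eq (s : D.Var → B) (φ : D.R →ₐ[𝕜] B) (i : Fin (D.r + 1)) :
    aeval (fun v => s v * φ (D.x v)) (D.monomial i) =
      (∏ j, s (Sum.inl ⟨i, j⟩) ^ D.l i j) * φ (D.proj (D.monomial i)) := by
  rw [proj_monomial_eq]
  simp only [monomial, map_prod, map_pow, aeval_X, mul_pow, Finset.prod_mul_distrib]

/-- Rescaling a homomorphism on the variables by factors `s v` such that the `T_i^{l_i}` are all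
multiplied by the same element. -/
noncomputable def rescale (s : D.Var → B) (y : B) (hs : ∀ i, ∏ j, s (Sum.inl ⟨i, j⟩) ^ D.l i j = y)
    (φ : D.R →ₐ[𝕜] B) : D.R →ₐ[𝕜] B :=
  Ideal.Quotient.liftₐ _ (aeval fun v => s v * φ (D.x v)) fun F hF => by
    rw [← RingHom.mem_ker]
    refine (Ideal.span_le.2 ?_ : Ideal.span (Set.range D.g) ≤
      RingHom.ker (aeval (R := 𝕜) fun v => s v * φ (D.x v))) hF
    rintro _ ⟨t, rfl⟩
    have h : φ (D.proj (D.g t)) = 0 := by rw [proj_g, map_zero]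
    rw [SetLike.mem_coe, RingHom.mem_ker]
    rw [g_eq] at h ⊢
    -- `g_t` is linear in the `T_i^{l_i}`, so a common factor `y` of these factors out.
    simp only [map_mul, map_sub, map_sum, aeval_monomial_eq, hs, mul_left_comm _ y,
      ← Finset.mul_sum, ← mul_sub] at h ⊢
    simp only [algHom_C, AlgHom.commutes] at h ⊢
    rw [h, mul_zero]

theorem rescale_x (s : D.Var → B) (y : B) (hs : ∀ i, ∏ j, s (Sum.inl ⟨i, j⟩) ^ D.l i j = y)
    (φ : D.R →ₐ[𝕜] B) (v : D.Var) : rescale s y hs φ (D.x v) = s v * φ (D.x v) :=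
  aeval_X _ v

theorem mono_eq_prod (e : D.Var →₀ ℕ) : D.mono e = ∏ v, D.x v ^ e v := by
  rw [mono, MvPolynomial.monomial_eq, C_1, one_mul, Finsupp.prod_fintype _ _ (by simp), map_prod]
  simp only [map_pow]
  rfl

theorem rescale_mono (s : D.Var → B) (y : B) (hs : ∀ i, ∏ j, s (Sum.inl ⟨i, j⟩) ^ D.l i j = y)
    (φ : D.R →ₐ[𝕜] B) (e : D.Var →₀ ℕ) :
    rescale s y hs φ (D.mono e) = (∏ v, s v ^ e v) * φ (D.mono e) := by
  simp only [mono_eq_prod, map_prod, map_pow, rescale_x, mul_pow, Finset.prod_mul_distrib]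

end Rescale

/-! ### The degree of a monomial -/

section Degree

variable {𝕜 : Type*} [Field 𝕜] {D : ArrangementData 𝕜}

variable (D) in
/-- The degree of a monomial. -/
noncomputable def deg : (D.Var →₀ ℕ) →+ D.K₀ := Finsupp.weight D.degree

theorem deg_eq_Q₀ (e : D.Var →₀ ℕ) : D.deg e = D.Q₀ fun v => (e v : ℤ) := by
  rw [deg, Finsupp.weight_apply, Finsupp.sum_fintype _ _ (by simp)]
  simp only [degree, ← map_nsmul, ← map_sum]
  congr 1
  ext v
  simp [Finset.sum_apply, Pi.single_apply]

theorem transpose_P₀_mulVec_inl (y : Fin D.r → ℤ) (i : Fin (D.r + 1)) (j : Fin (D.size i)) :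
    D.P₀.transpose.mulVec y (Sum.inl ⟨i, j⟩) =
      (Fin.cons (-∑ p, y p) y : Fin (D.r + 1) → ℤ) i * D.l i j := by
  simp only [Matrix.mulVec, dotProduct, Matrix.transpose_apply, P₀, Matrix.of_apply]
  generalize D.l i j = a
  cases i using Fin.cases with
  | zero =>
    have h : ∑ x, y x * (a : ℤ) = (∑ p, y p) * a := (Finset.sum_mul ..).symm
    simpa [mul_comm] using h
  | succ p => simp [Fin.succ_ne_zero, mul_comm]

theorem transpose_P₀_mulVec_inr (y : Fin D.r → ℤ) (k : Fin D.m) :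
    D.P₀.transpose.mulVec y (Sum.inr k) = 0 := by
  simp [Matrix.mulVec, dotProduct, P₀]

/-- A combination of the rows with coefficients `y` multiplies `l_0` by `-∑ y` and the other `l_i`
by the entries of `y`. So the row lattice is parametrized by the integral vectors `z` of sum zero.
-/
theorem Q₀_eq_zero_iff (u : D.Var → ℤ) :
    D.Q₀ u = 0 ↔ ∃ z : Fin (D.r + 1) → ℤ, ∑ i, z i = 0 ∧
      (∀ i j, u (Sum.inl ⟨i, j⟩) = z i * D.l i j) ∧ ∀ k, u (Sum.inr k) = 0 := by
  rw [Q₀, Submodule.mkQ_apply, Submodule.Quotient.mk_eq_zero]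
  constructor
  · rintro ⟨y, rfl⟩
    exact ⟨Fin.cons (-∑ p, y p) y, by simp [Fin.sum_univ_succ],
      fun i j => transpose_P₀_mulVec_inl y i j, fun k => transpose_P₀_mulVec_inr y k⟩
  · rintro ⟨z, hz, hl, hr⟩
    refine ⟨fun p => z p.succ, ?_⟩
    have hz' : (Fin.cons (-∑ p : Fin D.r, z p.succ) fun p => z p.succ : Fin (D.r + 1) → ℤ) = z := by
      rw [Fin.sum_univ_succ] at hz
      rw [← eq_neg_of_add_eq_zero_left hz]
      exact Fin.cons_self_tail z
    ext (⟨i, j⟩ | k)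
    · rw [hl, Matrix.mulVecLin_apply, transpose_P₀_mulVec_inl, hz']
    · rw [hr, Matrix.mulVecLin_apply, transpose_P₀_mulVec_inr]

theorem deg_expand_single (i i' : Fin (D.r + 1)) :
    D.deg (expand (Finsupp.single (Sum.inl i) 1)) =
      D.deg (expand (Finsupp.single (Sum.inl i') 1)) := by
  classical
  rw [deg_eq_Q₀, deg_eq_Q₀, ← sub_eq_zero, ← map_sub, Q₀_eq_zero_iff]
  refine ⟨Pi.single i 1 - Pi.single i' 1, by simp, fun i₁ j => ?_, fun k => by simp⟩
  simp [Finsupp.single_apply, Pi.single_apply, eq_comm, sub_mul]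

/-- For a monomial all `z_i` are nonnegative, and their sum is zero. -/
theorem eq_zero_of_deg_eq_zero {e : D.Var →₀ ℕ} (h : D.deg e = 0) : e = 0 := by
  rw [deg_eq_Q₀, Q₀_eq_zero_iff] at h
  obtain ⟨z, hz, hl, hr⟩ := h
  have hnonneg (i) : 0 ≤ z i := by
    have h1 := hl i ⟨0, D.size_pos i⟩
    have h2 : (0 : ℤ) < D.l i ⟨0, D.size_pos i⟩ := by exact_mod_cast D.l_pos _ _
    by_contra! h3
    have := mul_neg_of_neg_of_pos h3 h2
    omega
  have hz0 := (Finset.sum_eq_zero_iff_of_nonneg fun i _ => hnonneg i).1 hz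
  ext (⟨i, j⟩ | k)
  · have := hl i j
    rw [hz0 i (Finset.mem_univ i), zero_mul] at this
    exact_mod_cast this
  · exact_mod_cast hr k

/-- Monomials of the same degree have the same residue, the same part in the `S_k`, and the same
total degree in the `T_i^{l_i}`. -/
theorem eq_of_deg_eq {e e' : D.Var →₀ ℕ} (h : D.deg e = D.deg e') :
    residue e = residue e' ∧ (∀ k, e (Sum.inr k) = e' (Sum.inr k)) ∧
      ∑ i, blockPart e (Sum.inl i) = ∑ i, blockPart e' (Sum.inl i) := by
  rw [deg_eq_Q₀, deg_eq_Q₀, ← sub_eq_zero, ← map_sub, Q₀_eq_zero_iff] at h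
  obtain ⟨z, hz, hl, hr⟩ := h
  -- Splitting `z` into positive and negative parts turns the relation into an equality of natural
  -- exponents, to which uniqueness of residue and block part applies.
  let a : D.BlockVar →₀ ℕ := Finsupp.equivFunOnFinite.symm (Sum.elim (fun i => (z i).toNat) 0)
  let b : D.BlockVar →₀ ℕ := Finsupp.equivFunOnFinite.symm (Sum.elim (fun i => (-z i).toNat) 0)
  have hab : expand b + e = expand a + e' := by
    ext (⟨i, j⟩ | k)
    · have h1 := hl i j
      have h2 : z i = (z i).toNat - (-z i).toNat := by omega
      simp only [Pi.sub_apply] at h1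
      rw [h2, sub_mul] at h1
      simp only [Finsupp.add_apply, expand_inl]
      change (-z i).toNat * D.l i j + _ = (z i).toNat * D.l i j + _
      zify
      linarith
    · have h1 := hr k
      simp only [Pi.sub_apply] at h1
      simp only [Finsupp.add_apply, expand_inr]
      change 0 + _ = 0 + _
      omega
  have hres := congrArg residue hab
  have hblock := congrArg blockPart hab
  rw [residue_expand_add, residue_expand_add] at hres
  rw [blockPart_expand_add, blockPart_expand_add] at hblock
  refine ⟨hres, fun k => ?_, ?_⟩
  · have := hr k
    simp only [Pi.sub_apply] at this
    omega
  · have h1 (i) : (blockPart e (Sum.inl i) : ℤ) = z i + blockPart e' (Sum.inl i) := by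
      have := DFunLike.congr_fun hblock (Sum.inl i)
      simp only [Finsupp.add_apply] at this
      change (-z i).toNat + _ = (z i).toNat + _ at this
      omega
    zify
    simp only [h1, Finset.sum_add_distrib, hz, zero_add]

end Degree

/-! ### The `K₀`-grading -/

section Component

open MvPolynomial

variable {𝕜 : Type*} [Field 𝕜] {D : ArrangementData 𝕜}

theorem mono_mem_component (e : D.Var →₀ ℕ) : D.mono e ∈ D.component (D.deg e) :=
  ⟨MvPolynomial.monomial e 1, isWeightedHomogeneous_monomial _ _ _ rfl, rfl⟩

theorem x_mem_component (v : D.Var) : D.x v ∈ D.component (D.degree v) :=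
  ⟨X v, isWeightedHomogeneous_X _ _ _, rfl⟩

instance gradedMonoid_component : SetLike.GradedMonoid D.component where
  one_mem := ⟨1, isWeightedHomogeneous_one _ _, map_one D.proj⟩
  mul_mem := by
    rintro w w' _ _ ⟨F, hF, rfl⟩ ⟨F', hF', rfl⟩
    exact ⟨F * F', hF.mul hF', map_mul D.proj _ _⟩

theorem component_induction {w : D.K₀} {p : D.R → Prop} (f : D.R) (hf : f ∈ D.component w)
    (mono : ∀ e, D.deg e = w → p (D.mono e)) (zero : p 0)
    (add : ∀ f f', p f → p f' → p (f + f')) (smul : ∀ (a : 𝕜) f, p f → p (a • f)) : p f := by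
  obtain ⟨F, hF, rfl⟩ := hf
  change p (D.proj F)
  rw [F.as_sum, map_sum]
  refine Finset.sum_induction _ p add zero fun e he => ?_
  have h1 : D.proj (MvPolynomial.monomial e (F.coeff e)) = F.coeff e • D.mono e := by
    rw [ArrangementData.mono, ← map_smul, MvPolynomial.smul_monomial, smul_eq_mul, mul_one]
  rw [h1]
  exact smul _ _ (mono e (hF (mem_support_iff.1 he)))

variable (D) in
/-- The common degree of the `T_i^{l_i}`. -/
noncomputable def blockDegree : D.K₀ := D.deg (expand (Finsupp.single (Sum.inl 0) 1))

theorem deg_expand_single_inl (i : Fin (D.r + 1)) :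
    D.deg (expand (Finsupp.single (Sum.inl i) 1)) = D.blockDegree := deg_expand_single i 0

theorem sum_l_smul_degree (i : Fin (D.r + 1)) :
    ∑ j, D.l i j • D.degree (Sum.inl ⟨i, j⟩) = D.blockDegree := by
  classical
  rw [← deg_expand_single_inl i, deg, Finsupp.weight_apply, Finsupp.sum_fintype _ _ (by simp),
    Fintype.sum_sum_type, Fintype.sum_sigma, Finset.sum_eq_single i]
  · simp
  · intro i' _ hi'
    simp [hi'.symm]
  · simp

theorem _root_.AddMonoidAlgebra.prod_single_one_pow {A M ι : Type*} [CommSemiring A]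
    [AddCommMonoid M] (s : Finset ι) (d : ι → M) (n : ι → ℕ) :
    ∏ v ∈ s, AddMonoidAlgebra.single (d v) (1 : A) ^ n v =
      AddMonoidAlgebra.single (∑ v ∈ s, n v • d v) 1 := by
  induction s using Finset.cons_induction with
  | empty => rfl
  | cons a s ha ih =>
    rw [Finset.prod_cons, Finset.sum_cons, ih, AddMonoidAlgebra.single_pow,
      AddMonoidAlgebra.single_mul_single, one_pow, one_mul]

/-- The coaction `R → R[K₀]` that belongs to the grading. -/
noncomputable def coaction : D.R →ₐ[𝕜] AddMonoidAlgebra D.R D.K₀ :=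
  rescale (fun v => AddMonoidAlgebra.single (D.degree v) (1 : D.R))
    (AddMonoidAlgebra.single D.blockDegree 1)
    (fun i => by rw [AddMonoidAlgebra.prod_single_one_pow, sum_l_smul_degree])
    AddMonoidAlgebra.singleZeroAlgHom

theorem coaction_of_mem {w : D.K₀} {f : D.R} (hf : f ∈ D.component w) :
    coaction f = AddMonoidAlgebra.single w f := by
  refine component_induction (p := fun f => coaction f = AddMonoidAlgebra.single w f) f hf
    (fun e he => ?_)
    (by rw [map_zero, AddMonoidAlgebra.single_zero])
    (fun f f' hf hf' => by rw [map_add, hf, hf', AddMonoidAlgebra.single_add])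
    (fun a f hf => by rw [map_smul, hf, AddMonoidAlgebra.smul_single])
  rw [coaction, rescale_mono, AddMonoidAlgebra.prod_single_one_pow, ← he, deg,
    Finsupp.weight_apply, Finsupp.sum_fintype _ _ (by simp)]
  change _ * AddMonoidAlgebra.single 0 _ = _
  rw [AddMonoidAlgebra.single_mul_single, add_zero, one_mul]

/-- The coefficient of the coaction at `w` is a linear map that is the identity on the component of
weight `w` and zero on all others. -/
theorem iSupIndep_component : iSupIndep D.component := by
  classical
  intro w
  rw [Submodule.disjoint_def]
  intro f hf hf'
  let L : D.R →ₗ[𝕜] D.R := (Finsupp.lapply w).comp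
    ((AddMonoidAlgebra.coeffLinearEquiv 𝕜).toLinearMap.comp coaction.toLinearMap)
  have hL {w' : D.K₀} {f : D.R} (hf : f ∈ D.component w') : L f = if w' = w then f else 0 := by
    change (coaction f).coeff w = _
    rw [coaction_of_mem hf, AddMonoidAlgebra.coeff_single, Finsupp.single_apply]
  have h : (⨆ (w') (_ : w' ≠ w), D.component w') ≤ LinearMap.ker L :=
    iSup₂_le fun w' hw' f' hf' => by rw [LinearMap.mem_ker, hL hf', if_neg hw']
  have h1 := LinearMap.mem_ker.1 (h hf')
  rwa [hL hf, if_pos rfl] at h1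

theorem iSup_component : ⨆ w, D.component w = ⊤ := by
  rw [eq_top_iff]
  intro f _
  obtain ⟨F, rfl⟩ := proj_surjective f
  rw [F.as_sum, map_sum]
  refine Submodule.sum_mem _ fun e _ => Submodule.mem_iSup_of_mem (D.deg e)
    ⟨_, isWeightedHomogeneous_monomial _ _ _ rfl, rfl⟩

theorem isGrading_component : IsGrading D.component :=
  ⟨gradedMonoid_component, iSupIndep_component, iSup_component⟩

end Component

end ArrangementData

namespace ArrangementData

/-! ### Pointedness, rank of `K₀`, units, complexity -/

section GradingProperties

open MvPolynomial

variable {𝕜 : Type*} [Field 𝕜] {D : ArrangementData 𝕜}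

theorem exists_deg_eq_of_component_ne_bot {w : D.K₀} (h : D.component w ≠ ⊥) :
    ∃ e, D.deg e = w := by
  contrapose! h
  exact (Submodule.eq_bot_iff _).2 fun f hf => component_induction (p := fun f => f = 0) f hf
    (fun e he => absurd he (h e)) rfl (fun f f' hf hf' => by rw [hf, hf', add_zero])
    (fun a f hf => by rw [hf, smul_zero])

theorem algebraMap_mem_component_zero (a : 𝕜) : algebraMap 𝕜 D.R a ∈ D.component 0 := by
  rw [Algebra.algebraMap_eq_smul_one]
  exact Submodule.smul_mem _ _ (SetLike.GradedOne.one_mem (A := D.component))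

theorem isPointedGrading_component : IsPointedGrading D.component := by
  refine ⟨le_antisymm (fun f hf => ?_) ?_, fun w hw hw' => ?_⟩
  · refine component_induction (p := (· ∈ LinearMap.range (Algebra.linearMap 𝕜 D.R))) f hf
      (fun e he => ?_) (Submodule.zero_mem _) (fun _ _ => Submodule.add_mem _)
      (fun a _ => Submodule.smul_mem _ a)
    rw [eq_zero_of_deg_eq_zero he, mono_zero]
    exact ⟨1, map_one (algebraMap 𝕜 D.R)⟩
  · rintro _ ⟨a, rfl⟩
    exact algebraMap_mem_component_zero a
  · obtain ⟨e, rfl⟩ := exists_deg_eq_of_component_ne_bot hw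
    obtain ⟨e', he'⟩ := exists_deg_eq_of_component_ne_bot hw'
    have h : e' + e = 0 := eq_zero_of_deg_eq_zero (by rw [map_add, he', neg_add_cancel])
    rw [(add_eq_zero.1 h).2, map_zero]
    exact IsOfFinAddOrder.zero

theorem transpose_P₀_mulVecLin_injective : Function.Injective D.P₀.transpose.mulVecLin := by
  rw [injective_iff_map_eq_zero]
  intro y hy
  ext p
  have h := congrFun hy (Sum.inl ⟨p.succ, ⟨0, D.size_pos _⟩⟩)
  rw [Matrix.mulVecLin_apply, transpose_P₀_mulVec_inl, Fin.cons_succ] at h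
  exact (mul_eq_zero.1 h).resolve_right (by exact_mod_cast (D.l_pos _ _).ne')

theorem finrank_K₀_add : Module.finrank ℤ D.K₀ + D.r = D.n + D.m := by
  have h := Submodule.finrank_quotient_add_finrank
    (LinearMap.range D.P₀.transpose.mulVecLin)
  rw [LinearMap.finrank_range_of_inj transpose_P₀_mulVecLin_injective, Module.finrank_fintype_fun_eq_card,
    Module.finrank_fintype_fun_eq_card, Fintype.card_fin, card_var] at h
  exact h

section Units

theorem _root_.Finset.prod_univ_div_mul_cancel {ι : Type*} [Fintype ι] (a : ι → ℕ) (i : ι) :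
    (∏ k, a k) / a i * a i = ∏ k, a k :=
  Nat.div_mul_cancel (Finset.dvd_prod_of_mem a (Finset.mem_univ i))

theorem _root_.Finset.prod_univ_div_ne_zero {ι : Type*} [Fintype ι] {a : ι → ℕ}
    (ha : ∀ i, 0 < a i) (i : ι) : (∏ k, a k) / a i ≠ 0 := by
  intro h
  have h1 := Finset.prod_univ_div_mul_cancel a i
  rw [h, zero_mul] at h1
  exact Finset.prod_ne_zero_iff.2 (fun k _ => (ha k).ne') h1.symm

variable (D) in
/-- The exponents `l_{ij}` as a function on the set of pairs `(i, j)`. -/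
def exponent (p : Σ i : Fin (D.r + 1), Fin (D.size i)) : ℕ := D.l p.1 p.2

variable (D) in
/-- Positive integral weights of the variables for which all `T_i^{l_i}` have the same weight. -/
def positiveWeight : D.Var → ℕ :=
  Sum.elim (fun p => (∏ p', D.exponent p') / D.exponent p * ((∏ i, D.size i) / D.size p.1))
    fun _ => 1

theorem positiveWeight_ne_zero (v : D.Var) : D.positiveWeight v ≠ 0 := by
  rcases v with p | k
  · exact mul_ne_zero (Finset.prod_univ_div_ne_zero (a := D.exponent) (fun p => D.l_pos p.1 p.2) p)
      (Finset.prod_univ_div_ne_zero D.size_pos p.1)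
  · exact Nat.one_ne_zero

/-- The factor `(∏ l) / l_{ij}` makes the summands of a block equal, and the factor `(∏ n) / n_i`
compensates for their number `n_i`. -/
theorem sum_positiveWeight (i : Fin (D.r + 1)) :
    ∑ j, D.positiveWeight (Sum.inl ⟨i, j⟩) * D.l i j = (∏ p', D.exponent p') * ∏ i, D.size i := by
  have h (j : Fin (D.size i)) : D.positiveWeight (Sum.inl ⟨i, j⟩) * D.l i j =
      (∏ p', D.exponent p') * ((∏ i, D.size i) / D.size i) := by
    rw [positiveWeight, Sum.elim_inl, mul_right_comm]
    congr 1
    exact Finset.prod_univ_div_mul_cancel D.exponent ⟨i, j⟩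
  rw [Finset.sum_congr rfl fun j _ => h j, Finset.sum_const, Finset.card_univ, Fintype.card_fin,
    smul_eq_mul, mul_left_comm, mul_comm (D.size i), Finset.prod_univ_div_mul_cancel]

/-- The coaction `R → R[z]` that belongs to the positive weights. -/
noncomputable def positiveCoaction : D.R →ₐ[𝕜] Polynomial D.R :=
  rescale (B := Polynomial D.R) (fun v => Polynomial.X ^ D.positiveWeight v)
    (Polynomial.X ^ ((∏ p', D.exponent p') * ∏ i, D.size i))
    (fun i => by
      simp only [← pow_mul]
      rw [Finset.prod_pow_eq_pow_sum, sum_positiveWeight])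
    ((Algebra.ofId D.R (Polynomial D.R)).restrictScalars 𝕜)

theorem positiveCoaction_x (v : D.Var) :
    positiveCoaction (D.x v) = Polynomial.X ^ D.positiveWeight v * Polynomial.C (D.x v) :=
  rescale_x _ _ _ _ _

theorem eval_one_positiveCoaction (f : D.R) : (positiveCoaction f).eval 1 = f := by
  suffices h : ((Polynomial.aeval (1 : D.R)).restrictScalars 𝕜).comp positiveCoaction =
      AlgHom.id 𝕜 D.R by
    have := DFunLike.congr_fun h f
    rwa [AlgHom.comp_apply, AlgHom.restrictScalars_apply, Polynomial.coe_aeval_eq_eval] at this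
  refine Ideal.Quotient.algHom_ext _ (MvPolynomial.algHom_ext fun v => ?_)
  change Polynomial.aeval (1 : D.R) (positiveCoaction (D.x v)) = D.x v
  simp [positiveCoaction_x]

theorem exists_eval_zero_positiveCoaction_eq (f : D.R) :
    ∃ a : 𝕜, (positiveCoaction f).eval 0 = algebraMap 𝕜 D.R a := by
  obtain ⟨F, rfl⟩ := proj_surjective f
  induction F using MvPolynomial.induction_on with
  | C a =>
    refine ⟨a, ?_⟩
    rw [algHom_C, AlgHom.commutes, IsScalarTower.algebraMap_apply 𝕜 D.R (Polynomial D.R),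
      Polynomial.algebraMap_apply, Algebra.algebraMap_self, RingHom.id_apply, Polynomial.eval_C]
  | add F F' h h' =>
    obtain ⟨a, ha⟩ := h
    obtain ⟨a', ha'⟩ := h'
    exact ⟨a + a', by rw [map_add, map_add, Polynomial.eval_add, ha, ha', map_add]⟩
  | mul_X F v h =>
    refine ⟨0, ?_⟩
    have h1 : D.proj (X v) = D.x v := rfl
    rw [map_mul, map_mul, h1, positiveCoaction_x]
    simp [positiveWeight_ne_zero]

/-- The coaction maps a unit to a unit of `R[z]`, which is constant in `z` because `R` is a domain.
Its value at `z = 1` is the given unit, and its value at `z = 0` is a scalar because all weights are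
positive. -/
theorem units_map_bijective [IsAlgClosed 𝕜] [CharZero 𝕜] :
    Function.Bijective (Units.map (algebraMap 𝕜 D.R : 𝕜 →* D.R)) := by
  refine ⟨Units.map_injective (algebraMap 𝕜 D.R).injective, fun u => ?_⟩
  obtain ⟨r, -, hr⟩ := Polynomial.isUnit_iff.1 (u.isUnit.map (positiveCoaction (D := D)))
  have h1 := eval_one_positiveCoaction (u : D.R)
  obtain ⟨a, ha⟩ := exists_eval_zero_positiveCoaction_eq (u : D.R)
  rw [← hr, Polynomial.eval_C] at h1 ha
  have ha0 : a ≠ 0 := by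
    rintro rfl
    rw [map_zero] at ha
    exact u.ne_zero (h1.symm.trans ha)
  exact ⟨Units.mk0 a ha0, Units.ext (ha.symm.trans h1)⟩

end Units

theorem isEffectiveGrading_component [IsAlgClosed 𝕜] [CharZero 𝕜] :
    IsEffectiveGrading D.component := by
  classical
  rw [IsEffectiveGrading, eq_top_iff]
  intro w _
  obtain ⟨u, rfl⟩ := Submodule.mkQ_surjective _ w
  have h : (u : D.Var → ℤ) = ∑ v, u v • Pi.single v 1 := by
    ext v
    simp [Finset.sum_apply, Pi.single_apply]
  rw [h, map_sum]
  refine AddSubgroup.sum_mem _ fun v _ => ?_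
  rw [map_zsmul]
  have hv : D.component (D.degree v) ≠ ⊥ := fun h =>
    x_ne_zero v ((Submodule.eq_bot_iff _).1 h _ (x_mem_component v))
  exact AddSubgroup.zsmul_mem _ (AddSubgroup.subset_closure hv) _

theorem isGradingOfComplexity_component [IsAlgClosed 𝕜] [CharZero 𝕜] :
    IsGradingOfComplexity D.component D.c := by
  refine ⟨isEffectiveGrading_component, ?_⟩
  rw [ringKrullDim_R]
  congr 2
  have := finrank_K₀_add (D := D)
  omega

end GradingProperties

end ArrangementData

namespace MvPolynomial

/-! ### Factors of homogeneous polynomials -/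

section HomogeneousFactor

variable {σ k : Type*} [Field k]

/-- The polynomial in `z` whose coefficients are the homogeneous components. -/
noncomputable def expandDegrees : MvPolynomial σ k →ₐ[k] Polynomial (MvPolynomial σ k) :=
  aeval fun i => Polynomial.C (X i) * Polynomial.X

theorem coeff_expandDegrees (p : MvPolynomial σ k) (n : ℕ) :
    (expandDegrees p).coeff n = homogeneousComponent n p := by
  classical
  induction p using MvPolynomial.induction_on' with
  | monomial e a =>
    have h : expandDegrees (monomial e a) = Polynomial.monomial e.degree (monomial e a) := by
      rw [expandDegrees, aeval_monomial, Finsupp.prod]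
      simp only [mul_pow, Finset.prod_mul_distrib, Finset.prod_pow_eq_pow_sum]
      rw [← Polynomial.C_mul_X_pow_eq_monomial, ← mul_assoc, monomial_eq (a := a), Finsupp.prod,
        map_mul, map_prod]
      simp only [map_pow]
      rfl
    rw [h, Polynomial.coeff_monomial]
    ext e'
    rw [coeff_homogeneousComponent]
    split_ifs with h1 h2 h2
    · rfl
    · rw [coeff_monomial, if_neg (by rintro rfl; exact h2 h1)]
    · rw [coeff_monomial, if_neg (by rintro rfl; exact h1 h2), coeff_zero]
    · rfl
  | add p q hp hq => rw [map_add, map_add, Polynomial.coeff_add, hp, hq]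

theorem expandDegrees_of_isHomogeneous {p : MvPolynomial σ k} {d : ℕ} (h : p.IsHomogeneous d) :
    expandDegrees p = Polynomial.monomial d p := by
  ext1 n
  rw [coeff_expandDegrees, Polynomial.coeff_monomial, homogeneousComponent_of_mem h]
  simp only [eq_comm]

/-- Factors of homogeneous polynomials are homogeneous. -/
theorem IsHomogeneous.exists_of_mul_left {p q : MvPolynomial σ k} {d : ℕ} (hp : p ≠ 0) (hq : q ≠ 0)
    (h : (p * q).IsHomogeneous d) : ∃ n, p.IsHomogeneous n := by
  have hne {r : MvPolynomial σ k} (hr : r ≠ 0) : expandDegrees r ≠ 0 := by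
    intro h0
    obtain ⟨e, he⟩ := MvPolynomial.ne_zero_iff.1 hr
    have h1 := congrArg (coeff e) (coeff_expandDegrees r e.degree)
    rw [h0, Polynomial.coeff_zero, coeff_homogeneousComponent, if_pos rfl] at h1
    exact he h1.symm
  have h1 := expandDegrees_of_isHomogeneous h
  rw [map_mul] at h1
  have hdeg := congrArg Polynomial.natDegree h1
  have htrail := congrArg Polynomial.natTrailingDegree h1
  rw [Polynomial.natDegree_mul (hne hp) (hne hq),
    Polynomial.natDegree_monomial_eq _ (mul_ne_zero hp hq)] at hdeg
  rw [Polynomial.natTrailingDegree_mul (hne hp) (hne hq),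
    Polynomial.natTrailingDegree_monomial (mul_ne_zero hp hq)] at htrail
  -- Lowest and highest degree in `z` are both additive and agree for the product, so they agree for
  -- each factor.
  have hp' := Polynomial.natTrailingDegree_le_natDegree (expandDegrees p)
  have hq' := Polynomial.natTrailingDegree_le_natDegree (expandDegrees q)
  refine ⟨(expandDegrees p).natDegree, fun e he => ?_⟩
  by_contra hne'
  change ¬ Finsupp.weight (fun _ => 1) e = _ at hne'
  rw [← Finsupp.degree_eq_weight_one] at hne'
  refine he ?_
  have h2 := congrArg (coeff e) (coeff_expandDegrees p e.degree)
  rw [coeff_homogeneousComponent, if_pos rfl] at h2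
  rw [← h2]
  rcases lt_or_gt_of_ne hne' with h3 | h3
  · rw [Polynomial.coeff_eq_zero_of_lt_natTrailingDegree (by omega), coeff_zero]
  · rw [Polynomial.coeff_eq_zero_of_natDegree_lt h3, coeff_zero]

theorem prime_rename_of_injective {τ : Type*} {f : σ → τ} (hf : Function.Injective f)
    {p : MvPolynomial σ k} (hp : Prime p) : Prime (rename f p) := by
  have h := (prime_rename_iff (Set.range f)
    (p := renameEquiv k (Equiv.ofInjective f hf) p)).2 ((MulEquiv.prime_iff _).2 hp)
  rw [renameEquiv_apply, rename_rename] at h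
  exact h

end HomogeneousFactor

end MvPolynomial

/-! ### Factorizations into graded primes up to constants -/

section GradedPrime

variable {𝕜 R K : Type*} [Field 𝕜] [CommRing R] [Algebra 𝕜 R]
  {𝒜 : K → Submodule 𝕜 R}

theorem IsGradedPrime.smul {f : R} (hf : IsGradedPrime 𝒜 f) {a : 𝕜} (ha : a ≠ 0) :
    IsGradedPrime 𝒜 (a • f) := by
  have hu : IsUnit (algebraMap 𝕜 R a) := ha.isUnit.map _
  have hdvd (g : R) : a • f ∣ g ↔ f ∣ g := by
    rw [Algebra.smul_def, hu.mul_left_dvd]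
  obtain ⟨⟨w, hw⟩, h0, h1, h2⟩ := hf
  refine ⟨⟨w, Submodule.smul_mem _ _ hw⟩, smul_ne_zero ha h0, fun h => h1 ?_, fun g h => ?_⟩
  · exact isUnit_of_dvd_one ((hdvd 1).1 h.dvd)
  · simpa only [hdvd] using h2 g h

theorem Prime.isGradedPrime {f : R} (hf : Prime f) (h : SetLike.IsHomogeneousElem 𝒜 f) :
    IsGradedPrime 𝒜 f :=
  ⟨h, hf.ne_zero, hf.not_isUnit, fun _ _ _ _ => hf.dvd_or_dvd⟩

/-- Being a nonzero constant times a product of graded primes. -/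
def HasGradedFactorization (𝒜 : K → Submodule 𝕜 R) (f : R) : Prop :=
  ∃ (a : 𝕜) (s : Multiset R), a ≠ 0 ∧ (∀ p ∈ s, IsGradedPrime 𝒜 p) ∧ a • s.prod = f

theorem HasGradedFactorization.mul {f g : R} (hf : HasGradedFactorization 𝒜 f)
    (hg : HasGradedFactorization 𝒜 g) : HasGradedFactorization 𝒜 (f * g) := by
  obtain ⟨a, s, ha, hs, rfl⟩ := hf
  obtain ⟨b, t, hb, ht, rfl⟩ := hg
  refine ⟨a * b, s + t, mul_ne_zero ha hb, fun p hp => ?_, ?_⟩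
  · rcases Multiset.mem_add.1 hp with h | h
    exacts [hs p h, ht p h]
  · rw [Multiset.prod_add, smul_mul_smul_comm]

theorem IsGradedPrime.hasGradedFactorization {f : R} (hf : IsGradedPrime 𝒜 f) :
    HasGradedFactorization 𝒜 f :=
  ⟨1, {f}, one_ne_zero, by simpa using hf, by simp⟩

theorem hasGradedFactorization_algebraMap {a : 𝕜} (ha : a ≠ 0) :
    HasGradedFactorization 𝒜 (algebraMap 𝕜 R a) :=
  ⟨a, 0, ha, by simp, by rw [Multiset.prod_zero, Algebra.algebraMap_eq_smul_one]⟩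

theorem hasGradedFactorization_one : HasGradedFactorization 𝒜 (1 : R) := by
  simpa using hasGradedFactorization_algebraMap (R := R) (𝒜 := 𝒜) (one_ne_zero (α := 𝕜))

/-- The constant is absorbed into one of the primes; if there is none, the element is a unit. -/
theorem HasGradedFactorization.exists_prod_eq {f : R} (hf : HasGradedFactorization 𝒜 f)
    (hu : ¬ IsUnit f) : ∃ s : Multiset R, (∀ p ∈ s, IsGradedPrime 𝒜 p) ∧ s.prod = f := by
  obtain ⟨a, s, ha, hs, rfl⟩ := hf
  induction s using Multiset.induction with
  | empty =>
    refine absurd ?_ hu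
    rw [Multiset.prod_zero, ← Algebra.algebraMap_eq_smul_one]
    exact ha.isUnit.map _
  | cons p s _ =>
    refine ⟨(a • p) ::ₘ s, fun q hq => ?_, ?_⟩
    · rcases Multiset.mem_cons.1 hq with rfl | h
      · exact (hs p (Multiset.mem_cons_self p s)).smul ha
      · exact hs q (Multiset.mem_cons_of_mem h)
    · rw [Multiset.prod_cons, Multiset.prod_cons, smul_mul_assoc]

end GradedPrime

namespace ArrangementData

/-! ### Factoriality of the grading -/

section Factorial

open MvPolynomial

variable {𝕜 : Type*} [Field 𝕜] {D : ArrangementData 𝕜}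

/-- The element of `R(A, P₀)` that belongs to a polynomial in the `Y_p`. -/
noncomputable def linBase : MvPolynomial (Fin (D.c + 1)) 𝕜 →ₐ[𝕜] D.R :=
  base.comp (rename Sum.inl)

theorem linBase_apply (q : MvPolynomial (Fin (D.c + 1)) 𝕜) :
    D.linBase q = base (rename Sum.inl q) := rfl

variable (D) in
/-- The `i`-th linear form as a polynomial in the `Y_p`. -/
noncomputable def linForm (i : Fin (D.r + 1)) : MvPolynomial (Fin (D.c + 1)) 𝕜 :=
  ∑ p, C (D.A p i) * X p

theorem rename_linForm (i : Fin (D.r + 1)) : rename Sum.inl (D.linForm i) = D.form i := by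
  simp [linForm, form]

theorem isHomogeneous_linForm (i : Fin (D.r + 1)) : (D.linForm i).IsHomogeneous 1 :=
  IsHomogeneous.sum _ _ _ fun p _ => by
    simpa using (isHomogeneous_C _ (D.A p i)).mul (isHomogeneous_X 𝕜 p)

theorem base_form_mem_component (i : Fin (D.r + 1)) :
    base (D.form i) ∈ D.component D.blockDegree := by
  rw [base_form_eq_mono, ← deg_expand_single_inl i]
  exact mono_mem_component _

/-- The `Y_p` are linear combinations of the forms, whose images `T_i^{l_i}` all have the same
degree. -/
theorem linBase_X_mem_component (p : Fin (D.c + 1)) :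
    D.linBase (X p) ∈ D.component D.blockDegree := by
  have h : (X (Sum.inl p) : D.FormPoly) =
      ∑ q, C (D.firstMatrix⁻¹ q p) * D.form (D.firstIndex q) := by
    rw [← formHom_formSection (X (Sum.inl p))]
    simp [formSection]
  rw [linBase_apply, rename_X, h, map_sum]
  refine Submodule.sum_mem _ fun q _ => ?_
  rw [← MvPolynomial.smul_eq_C_mul, map_smul]
  exact Submodule.smul_mem _ _ (base_form_mem_component _)

theorem linBase_mem_component {q : MvPolynomial (Fin (D.c + 1)) 𝕜} {d : ℕ} (hq : q.IsHomogeneous d) :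
    D.linBase q ∈ D.component (d • D.blockDegree) := by
  rw [q.as_sum, map_sum]
  refine Submodule.sum_mem _ fun e he => ?_
  have hd : ∑ p, e p • D.blockDegree = d • D.blockDegree := by
    have h1 := hq (mem_support_iff.1 he)
    rw [Finsupp.weight_apply, Finsupp.sum_fintype _ _ (by simp)] at h1
    rw [← Finset.sum_smul, ← h1]
    simp
  rw [monomial_eq, ← MvPolynomial.smul_eq_C_mul, map_smul, Finsupp.prod_fintype _ _ (by simp),
    map_prod, ← hd]
  simp only [map_pow]
  exact Submodule.smul_mem _ _ (SetLike.prod_pow_mem_graded D.component _ _ _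
    fun p _ => linBase_X_mem_component p)

/-- Homogeneous elements are products of a monomial and a form in the `Y_p`. -/
theorem exists_eq_mono_mul_linBase {w : D.K₀} {f : D.R} (hf : f ∈ D.component w) :
    ∃ (e : D.Var →₀ ℕ) (q : MvPolynomial (Fin (D.c + 1)) 𝕜) (d : ℕ),
      q.IsHomogeneous d ∧ f = D.mono e * D.linBase q := by
  by_cases hw : D.component w = ⊥
  · rw [hw, Submodule.mem_bot] at hf
    exact ⟨0, 0, 0, isHomogeneous_zero _ _ _, by rw [hf, map_zero, mul_zero]⟩
  obtain ⟨e₀, rfl⟩ := exists_deg_eq_of_component_ne_bot hw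
  let κ : D.BlockVar →₀ ℕ :=
    Finsupp.equivFunOnFinite.symm (Sum.elim 0 fun k => e₀ (Sum.inr k))
  -- Monomials of equal degree share their residue and their part in the `S_k`; they differ only in
  -- a product of the forms, of fixed total degree.
  have key (e : D.Var →₀ ℕ) (he : D.deg e = D.deg e₀) : D.mono e =
      D.mono (residue e₀ + expand κ) *
        D.linBase (∏ i, D.linForm i ^ blockPart e (Sum.inl i)) := by
    obtain ⟨h1, h2, -⟩ := eq_of_deg_eq he
    have h3 : D.formMono κ = ∏ k, X (Sum.inr k) ^ blockPart e (Sum.inr k) := by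
      have h4 : ∏ i, D.form i ^ κ (Sum.inl i) = 1 :=
        Finset.prod_eq_one fun i _ => pow_zero (D.form i)
      rw [formMono_eq, h4, one_mul]
      refine Finset.prod_congr rfl fun k _ => ?_
      rw [blockPart_inr, h2]
      rfl
    rw [mono_eq, h1, mono_add, ← base_formMono, linBase_apply, mul_assoc, ← map_mul, map_prod]
    simp only [map_pow, rename_linForm]
    rw [formMono_eq (blockPart e), h3, mul_comm (∏ i, D.form i ^ blockPart e (Sum.inl i))]
  suffices h : ∃ q : MvPolynomial (Fin (D.c + 1)) 𝕜,
      q.IsHomogeneous (∑ i, blockPart e₀ (Sum.inl i)) ∧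
        f = D.mono (residue e₀ + expand κ) * D.linBase q from
    ⟨_, h.choose, _, h.choose_spec⟩
  refine component_induction (p := fun f => ∃ q : MvPolynomial (Fin (D.c + 1)) 𝕜,
      q.IsHomogeneous (∑ i, blockPart e₀ (Sum.inl i)) ∧
        f = D.mono (residue e₀ + expand κ) * D.linBase q) f hf (fun e he => ?_) ?_ ?_ ?_
  · refine ⟨_, ?_, key e he⟩
    rw [← (eq_of_deg_eq he).2.2]
    refine IsHomogeneous.prod _ _ _ fun i _ => ?_
    simpa using (isHomogeneous_linForm i).pow (blockPart e (Sum.inl i))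
  · exact ⟨0, isHomogeneous_zero _ _ _, by rw [map_zero, mul_zero]⟩
  · rintro _ _ ⟨q, hq, rfl⟩ ⟨q', hq', rfl⟩
    exact ⟨q + q', hq.add hq', by rw [map_add, mul_add]⟩
  · rintro a _ ⟨q, hq, rfl⟩
    refine ⟨a • q, ?_, by rw [map_smul, mul_smul_comm]⟩
    rw [MvPolynomial.smul_eq_C_mul]
    simpa using (isHomogeneous_C _ a).mul hq

theorem x_inl_dvd_mono_mul_base_iff' (i : Fin (D.r + 1)) (j : Fin (D.size i)) (e : D.Var →₀ ℕ)
    (b : D.FormPoly) :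
    D.x (Sum.inl ⟨i, j⟩) ∣ D.mono e * base b ↔ e (Sum.inl ⟨i, j⟩) ≠ 0 ∨ D.form i ∣ b := by
  refine ⟨fun h => ?_, fun h => ?_⟩
  · rw [mono_eq, mul_assoc, ← map_mul,
      x_inl_dvd_mono_mul_base_iff i j (isReducedExponent_residue e)] at h
    by_contra! hne
    obtain ⟨he, hb⟩ := hne
    have hquot : blockPart e (Sum.inl i) = 0 := by
      have h1 := quot_mul_le e i j
      rw [he, Nat.le_zero, mul_eq_zero] at h1
      exact h1.resolve_right (D.l_pos i j).ne'
    rcases h with h | h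
    · rw [residue_inl, he, Nat.zero_sub] at h
      exact h rfl
    · rcases (prime_form i).dvd_or_dvd h with h | h
      · rcases dvd_formMono (prime_form i) h with ⟨i', h1, h2⟩ | ⟨k, -, h2⟩
        · exact h1 (form_dvd_form h2 ▸ hquot)
        · exact not_form_dvd_X _ _ h2
      · exact hb h
  · rcases h with h | h
    · exact (x_dvd_mono h).mul_right _
    · exact ((x_dvd_base_form i j).trans (map_dvd _ h)).mul_left _

theorem base_dvd_mono_mul_base_iff' {q : D.FormPoly} (hq : Prime q) (hform : ∀ i, ¬ q ∣ D.form i)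
    (hX : ∀ k, ¬ q ∣ X (Sum.inr k)) (e : D.Var →₀ ℕ) (b : D.FormPoly) :
    base q ∣ D.mono e * base b ↔ q ∣ b := by
  rw [mono_eq, mul_assoc, ← map_mul, base_dvd_mono_mul_base_iff (isReducedExponent_residue e)]
  refine ⟨fun h => (hq.dvd_or_dvd h).resolve_left fun h => ?_, fun h => h.mul_left _⟩
  rcases dvd_formMono hq h with ⟨i, -, h⟩ | ⟨k, -, h⟩
  exacts [hform i h, hX k h]

theorem not_rename_dvd_X {q : MvPolynomial (Fin (D.c + 1)) 𝕜} (hq : Prime q) (k : Fin D.m) :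
    ¬ rename Sum.inl q ∣ (X (Sum.inr k) : D.FormPoly) := by
  intro h
  let φ : D.FormPoly →ₐ[𝕜] MvPolynomial (Fin (D.c + 1)) 𝕜 := aeval (Sum.elim X fun _ => 1)
  have h1 := map_dvd φ h
  have h2 : φ (rename Sum.inl q) = q := by
    rw [aeval_rename, Sum.elim_comp_inl, aeval_X_left_apply]
  rw [h2, aeval_X, Sum.elim_inr] at h1
  exact hq.not_isUnit (isUnit_of_dvd_one h1)

/-- Homogeneous elements are products `T^e b` with `b` from the `Y_p`, so a divisibility criterion
that is prime in `e` and in `b` separately is enough. This is why the `T_{ij}` are `K₀`-prime even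
for `c = 1`. -/
theorem isGradedPrime_of_forall_dvd_iff {f : D.R} (hf : SetLike.IsHomogeneousElem D.component f)
    (h0 : f ≠ 0) (hu : ¬ IsUnit f) {p : (D.Var →₀ ℕ) → Prop} {a : D.FormPoly} (ha : Prime a)
    (hp : ∀ e e', p (e + e') → p e ∨ p e')
    (h : ∀ e b, f ∣ D.mono e * base b ↔ p e ∨ a ∣ b) : IsGradedPrime D.component f := by
  refine ⟨hf, h0, hu, ?_⟩
  rintro g g' ⟨w, hg⟩ ⟨w', hg'⟩ hdvd
  obtain ⟨e, q, -, -, rfl⟩ := exists_eq_mono_mul_linBase hg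
  obtain ⟨e', q', -, -, rfl⟩ := exists_eq_mono_mul_linBase hg'
  rw [mul_mul_mul_comm, ← mono_add, linBase_apply, linBase_apply, ← map_mul, h] at hdvd
  rw [linBase_apply, linBase_apply, h, h]
  rcases hdvd with h1 | h1
  · rcases hp e e' h1 with h2 | h2
    exacts [Or.inl (Or.inl h2), Or.inr (Or.inl h2)]
  · rcases ha.dvd_or_dvd h1 with h2 | h2
    exacts [Or.inl (Or.inr h2), Or.inr (Or.inr h2)]

variable [IsAlgClosed 𝕜] [CharZero 𝕜]

theorem isGradedPrime_x (v : D.Var) : IsGradedPrime D.component (D.x v) := by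
  rcases v with ⟨i, j⟩ | k
  · refine isGradedPrime_of_forall_dvd_iff ⟨_, x_mem_component _⟩ (x_ne_zero _) (not_isUnit_x _)
      (prime_form i) (p := fun e => e (Sum.inl ⟨i, j⟩) ≠ 0) (fun e e' h => ?_)
      (x_inl_dvd_mono_mul_base_iff' i j)
    by_contra! h1
    exact h (by rw [Finsupp.add_apply, h1.1, h1.2])
  · exact (prime_x_inr k).isGradedPrime ⟨_, x_mem_component _⟩

theorem hasGradedFactorization_mono (e : D.Var →₀ ℕ) :
    HasGradedFactorization D.component (D.mono e) := by
  induction e using Finsupp.induction_linear with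
  | zero => rw [mono_zero]; exact hasGradedFactorization_one
  | add e e' h h' => rw [mono_add]; exact h.mul h'
  | single v n =>
    induction n with
    | zero => rw [Finsupp.single_zero, mono_zero]; exact hasGradedFactorization_one
    | succ n ih =>
      rw [Finsupp.single_add, mono_add, mono_single]
      exact ih.mul (isGradedPrime_x v).hasGradedFactorization

/-- If `q` divides a form, it is associated to it, and its image is a constant times a monomial
`T_i^{l_i}`. Otherwise `q` is coprime to all factors that can split off from monomials, and its
image is `K₀`-prime. -/
theorem hasGradedFactorization_linBase_of_prime {q : MvPolynomial (Fin (D.c + 1)) 𝕜} (hq : Prime q)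
    {d : ℕ} (hd : q.IsHomogeneous d) : HasGradedFactorization D.component (D.linBase q) := by
  have hq' : Prime (rename Sum.inl q : D.FormPoly) :=
    prime_rename_of_injective Sum.inl_injective hq
  by_cases hform : ∃ i, (rename Sum.inl q : D.FormPoly) ∣ D.form i
  · obtain ⟨i, hi⟩ := hform
    obtain ⟨u, hu⟩ := ((hq'.dvd_prime_iff_associated (prime_form i)).1 hi).symm
    obtain ⟨a, ha, hau⟩ := MvPolynomial.isUnit_iff_eq_C_of_isReduced.1 u.isUnit
    rw [linBase_apply, ← hu, map_mul, hau, base_form_eq_mono]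
    refine (hasGradedFactorization_mono _).mul ?_
    rw [← algebraMap_eq, AlgHom.commutes]
    exact hasGradedFactorization_algebraMap ha.ne_zero
  · push Not at hform
    have hdvd := base_dvd_mono_mul_base_iff' hq' hform (not_rename_dvd_X hq)
    refine IsGradedPrime.hasGradedFactorization (isGradedPrime_of_forall_dvd_iff
      ⟨_, linBase_mem_component hd⟩ ?_ (fun h => ?_) hq' (p := fun _ => False) (fun _ _ => False.elim)
      fun e b => by rw [linBase_apply, hdvd, false_or])
    · rw [linBase_apply, map_ne_zero_iff _ base_injective]
      exact hq'.ne_zero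
    · have h1 : base (rename Sum.inl q) ∣ D.mono 0 * base 1 := by
        rw [mono_zero, map_one, one_mul]
        exact h.dvd
      exact hq'.not_isUnit (isUnit_of_dvd_one ((hdvd _ _).1 h1))

/-- Factors of homogeneous polynomials are homogeneous, so the prime factorization of `q` stays
among elements with homogeneous image. -/
theorem hasGradedFactorization_linBase {q : MvPolynomial (Fin (D.c + 1)) 𝕜} (hq : q ≠ 0)
    {d : ℕ} (hd : q.IsHomogeneous d) : HasGradedFactorization D.component (D.linBase q) := by
  induction q using UniqueFactorizationMonoid.induction_on_prime generalizing d with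
  | h₁ => exact absurd rfl hq
  | h₂ q hu =>
    obtain ⟨a, ha, rfl⟩ := MvPolynomial.isUnit_iff_eq_C_of_isReduced.1 hu
    rw [← algebraMap_eq, AlgHom.commutes]
    exact hasGradedFactorization_algebraMap ha.ne_zero
  | h₃ q p hq0 hp ih =>
    obtain ⟨n, hn⟩ := hd.exists_of_mul_left hp.ne_zero hq0
    rw [mul_comm] at hd
    obtain ⟨n', hn'⟩ := hd.exists_of_mul_left hq0 hp.ne_zero
    rw [map_mul]
    exact (hasGradedFactorization_linBase_of_prime hp hn).mul (ih hq0 hn')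

theorem isGradedFactorial_component : IsGradedFactorial D.component := by
  refine ⟨fun f g _ _ => mul_eq_zero.1, ?_⟩
  rintro f ⟨w, hf⟩ h0 hu
  obtain ⟨e, q, d, hq, rfl⟩ := exists_eq_mono_mul_linBase hf
  have hq0 : q ≠ 0 := by
    rintro rfl
    exact h0 (by rw [map_zero, mul_zero])
  exact ((hasGradedFactorization_mono e).mul
    (hasGradedFactorization_linBase hq0 hq)).exists_prod_eq hu

end Factorial

end ArrangementData

theorem mainTheorem6 {𝕜 : Type*} [Field 𝕜] [IsAlgClosed 𝕜] [CharZero 𝕜]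
    (D : ArrangementData 𝕜) :
    -- the components form a grading by `K₀`
    IsGrading D.component ∧
    -- integral, normal, complete intersection
    IsDomain D.R ∧
    IsIntegrallyClosed D.R ∧
    IsCompleteIntersectionPresentation D.g ∧
    -- dimension and units
    ringKrullDim D.R = ((D.n + D.m - D.r + D.c : ℕ) : WithBot ℕ∞) ∧
    Function.Bijective (Units.map (algebraMap 𝕜 D.R : 𝕜 →* D.R)) ∧
    -- the grading is effective, pointed, factorial and of complexity `c`
    IsEffectiveGrading D.component ∧
    IsPointedGrading D.component ∧
    IsGradedFactorial D.component ∧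
    IsGradingOfComplexity D.component D.c ∧
    -- the variables are pairwise non-associated `K₀`-primes, and primes if `c ≥ 2`
    (∀ v : D.Var, IsGradedPrime D.component (D.x v)) ∧
    (Pairwise fun v v' : D.Var => ¬ Associated (D.x v) (D.x v')) ∧
    (2 ≤ D.c → ∀ v : D.Var, Prime (D.x v)) :=
  ⟨ArrangementData.isGrading_component, inferInstance, inferInstance,
    ArrangementData.isCompleteIntersectionPresentation_g, ArrangementData.ringKrullDim_R,
    ArrangementData.units_map_bijective, ArrangementData.isEffectiveGrading_component,
    ArrangementData.isPointedGrading_component, ArrangementData.isGradedFactorial_component,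
    ArrangementData.isGradingOfComplexity_component, ArrangementData.isGradedPrime_x,
    fun _ _ hne h => hne (ArrangementData.x_dvd_x h.dvd), fun hc v => by
      rcases v with ⟨i, j⟩ | k
      exacts [ArrangementData.prime_x_inl hc i j, ArrangementData.prime_x_inr k]⟩
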